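/- Let $m,r\ge 0$ be integers, $\mathcal Z=\mathbb Z[\upsilon,\upsilon^{-1}]$ and $\boldsymbol q=\upsilon^2$. Let $\mathcal H$ be the Hecke algebra of $\mathfrak S_r$ over $\mathcal Z$, with basis $\{T_w\}$ and $T_wT_s=T_{ws}$ if $\ell(ws)>\ell(w)$, $T_wT_s=(\boldsymbol q-1)T_w+\boldsymbol qT_{ws}$ otherwise. For a composition $\lambda$ of $r$ into $m$ parts (zeros allowed) let $W_\lambda$ be its parabolic subgroup and $x_\lambda=\sum_{w\in W_\lambda}T_w$. Let $$\mathcal S(m|0,r)=\operatorname{End}_{\mathcal H}\Big(\bigoplus_\lambda x_\lambda\mathcal H\Big)$$ be the ordinary $\boldsymbol q$-Schur algebra, i.e. the $n=0$ case of the $q$-Schur superalgebra $\mathcal S(m|n,r)$. For an $m\times m$ matrix $A=(a_{i,j})$ over $\mathbb N$ with entries summing to $r$, with row sums $\lambda$ and column sums $\mu$, let $d$ be the shortest representative of the $W_\lambda$-$W_\mu$ double coset with $a_{i,j}=|\mathbb N^\lambda_i\cap d(\mathbb N^\mu_j)|$ for all $i,j$, where $\mathbb N^\lambda_i$ is the $i$-th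 block of $\lambda$, and let $\phi_A\in\mathcal S(m|0,r)$ be the $\mathcal H$-homomorphism with $\phi_A(x_\alpha h)=\delta_{\alpha,\mu}\,T_{W_\lambda dW_\mu}h$, where $T_{W_\lambda dW_\mu}=x_\lambda T_d\sum_wT_w$, the sum being over the shortest representatives $w$ in $W_\mu$ of the right cosets of $d^{-1}W_\lambda d\cap W_\mu$ in $W_\mu$. For $1\le h<m$ put $A^{+}_{h,k}=A+E_{h,k}-E_{h+1,k}$ (if $a_{h+1,k}\ge1$) and $A^-_{h,k}=A-E_{h,k}+E_{h+1,k}$ (if $a_{h,k}\ge1$). For a finite field $K$ and an $r$-dimensional $K$-vector space $V$, let $e_A$ be the characteristic function of the set of pairs $(F,F')$ of flags $0=V_0\subseteq V_1\subseteq\dots\subseteq V_m=V$, $0=V_0'\subseteq V_1'\subseteq\dots\subseteq V_m'=V$ with $a_{i,j}=\dim\frac{V_{i-1}+V_i\cap V_j'}{V_{i-1}+V_i\cap V_{j-1}'}$ for all $i,j$, and let $*$ be the convolution product $(f*g)(F,F'')=\sum_{F'}f(F,F')g(F',F'')$. Then each $\phi_A$ exists and is unique, and the multiplication formulas of the $q$-Schur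 superalgebra specialise at $n=0$ to the formulas of Beilinson, Lusztig and MacPherson. That is, for all $A$ and $1\le h<m$: (1) If $D^+_h$ is a matrix over $\mathbb N$ such that $D^+_h-E_{h,h+1}$ is diagonal and the column sums of $D^+_h$ are the row sums of $A$, then $$\phi_{D_h^+}\phi_A=\sum_{k:\,a_{h+1,k}\ge1}\dot{\boldsymbol q}_{h+1}^{\sum_{j<k}a_{h+1,j}}\ddot{\boldsymbol q}_h^{\sum_{j>k}a_{h,j}}[\![a_{h,k}+1]\!]_{\boldsymbol q_h}\,\phi_{A^+_{h,k}},\qquad e_{D_h^+}*e_A=\sum_{k:\,a_{h+1,k}\ge1}g^+_{h,k}(|K|)\,e_{A^+_{h,k}}$$ for all $K,V$ as above, where $g^+_{h,k}(x)=x^{\sum_{j>k}a_{h,j}}\frac{x^{a_{h,k}+1}-1}{x-1}$, and the coefficient of $\phi_{A^+_{h,k}}$ in the first formula equals $g^+_{h,k}(\boldsymbol q)$. (2) If $D^-_h$ is a matrix over $\mathbb N$ such that $D^-_h-E_{h+1,h}$ is diagonal and the column sums of $D^-_h$ are the row sums of $A$, then $$\phi_{D_h^-}\phi_A=\sum_{k:\,a_{h,k}\ge1}\dot{\boldsymbol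 q}_{h}^{\sum_{j>k}a_{h,j}}\ddot{\boldsymbol q}_{h+1}^{\sum_{j<k}a_{h+1,j}}[\![a_{h+1,k}+1]\!]_{\boldsymbol q_{h+1}}\,\phi_{A^-_{h,k}},\qquad e_{D_h^-}*e_A=\sum_{k:\,a_{h,k}\ge1}g^-_{h,k}(|K|)\,e_{A^-_{h,k}}$$ for all $K,V$ as above, where $g^-_{h,k}(x)=x^{\sum_{j<k}a_{h+1,j}}\frac{x^{a_{h+1,k}+1}-1}{x-1}$, and the coefficient of $\phi_{A^-_{h,k}}$ in the first formula equals $g^-_{h,k}(\boldsymbol q)$. Here $[\![k]\!]_x=1+x+\dots+x^{k-1}$, and $\dot{\boldsymbol q}_i=1$, $\ddot{\boldsymbol q}_i=\boldsymbol q$, $\boldsymbol q_i=\boldsymbol q$ for the even indices $i\le m$ (at $n=0$ every index is even), while $\dot{\boldsymbol q}_i=-\boldsymbol q^{-1}$, $\ddot{\boldsymbol q}_i=-1$, $\boldsymbol q_i=\boldsymbol q^{-1}$ for the odd indices $m<i\le m+n$ of the general superalgebra. -/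

import Mathlib

namespace QSchur

open Equiv

/-- `s` is one of the basic transpositions `(k, k+1)` of `Fin r`. -/
def IsSimple {r : ℕ} (s : Perm (Fin r)) : Prop :=
  ∃ i j : Fin r, (j : ℕ) = i + 1 ∧ s = swap i j

/-- The length function of the symmetric group with respect to the basic transpositions. -/
noncomputable def len {r : ℕ} (w : Perm (Fin r)) : ℕ :=
  sInf {k | ∃ l : List (Perm (Fin r)), (∀ s ∈ l, IsSimple s) ∧ l.prod = w ∧ l.length = k}

/-- The set of inversions of a permutation (used to compute lengths). -/
def invs {r : ℕ} (w : Perm (Fin r)) : Finset (Fin r × Fin r) :=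
  Finset.univ.filter fun p => p.1 < p.2 ∧ w p.2 < w p.1

theorem mem_invs {r : ℕ} (w : Perm (Fin r)) (a b : Fin r) :
    (a, b) ∈ invs w ↔ a < b ∧ w b < w a := by
  simp [invs]

theorem swap_lt_swap {r : ℕ} {i j : Fin r} (hij : (j : ℕ) = i + 1) {a b : Fin r}
    (hab : a < b) (hne : ¬ (a = i ∧ b = j)) : swap i j a < swap i j b := by
  simp only [swap_apply_def]
  split_ifs <;> simp only [Fin.lt_def, Fin.ext_iff] at * <;> omega

theorem card_invs_mul {r : ℕ} {i j : Fin r} (hij : (j : ℕ) = i + 1) (w : Perm (Fin r))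
    (h : w i < w j) : (invs (w * swap i j)).card = (invs w).card + 1 := by
  have hlt : i < j := by rw [Fin.lt_def]; omega
  have key : invs (w * swap i j) =
      insert (i, j) ((invs w).map
        ((swap i j).prodCongr (swap i j)).toEmbedding) := by
    ext ⟨a, b⟩
    simp only [mem_invs, Perm.mul_apply,
      Finset.mem_insert, Prod.mk.injEq, Finset.mem_map, Equiv.toEmbedding_apply,
      Equiv.prodCongr_apply, Prod.map_apply, Prod.exists]
    constructor
    · rintro ⟨h1, h2⟩
      by_cases hc : a = i ∧ b = j
      · exact Or.inl hc
      · right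
        exact ⟨swap i j a, swap i j b, ⟨swap_lt_swap hij h1 hc, h2⟩, by simp, by simp⟩
    · rintro (⟨rfl, rfl⟩ | ⟨x, y, ⟨h1, h2⟩, rfl, rfl⟩)
      · exact ⟨hlt, by simpa using h⟩
      · refine ⟨swap_lt_swap hij h1 ?_, by simpa using h2⟩
        rintro ⟨rfl, rfl⟩
        exact absurd h2 (not_lt.mpr h.le)
  rw [key, Finset.card_insert_of_notMem, Finset.card_map]
  simp only [invs, Finset.mem_map, Finset.mem_filter, Finset.mem_univ, true_and,
    Equiv.toEmbedding_apply, Equiv.prodCongr_apply, Prod.exists, Prod.map_apply, Prod.mk.injEq,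
    not_exists, not_and]
  rintro x y ⟨h1, h2⟩ h3 h4
  rw [swap_apply_eq_iff] at h3 h4
  simp only [swap_apply_left, swap_apply_right] at h3 h4
  subst h3 h4
  exact absurd h1 (not_lt.mpr hlt.le)

theorem card_invs_mul' {r : ℕ} {i j : Fin r} (hij : (j : ℕ) = i + 1) (w : Perm (Fin r))
    (h : w j < w i) : (invs w).card = (invs (w * swap i j)).card + 1 := by
  have := card_invs_mul hij (w * swap i j) (by simpa using h)
  simpa [mul_assoc] using this

theorem exists_descent {r : ℕ} (w : Perm (Fin r)) (hw : w ≠ 1) :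
    ∃ i j : Fin r, (j : ℕ) = i + 1 ∧ w j < w i := by
  by_contra! hc
  apply hw
  rcases r with _ | r
  · exact Subsingleton.elim _ _
  have hm : StrictMono w := by
    rw [Fin.strictMono_iff_lt_succ]
    intro i
    refine lt_of_le_of_ne (hc _ _ (by simp)) fun h => ?_
    exact absurd (w.injective h) (Fin.castSucc_lt_succ).ne
  have := Subsingleton.elim (hm.orderIsoOfSurjective w w.surjective) (OrderIso.refl (Fin (r + 1)))
  ext x
  exact congrArg Fin.val (DFunLike.congr_fun this x)

theorem invs_one {r : ℕ} : (invs (1 : Perm (Fin r))).card = 0 := by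
  simp only [invs, Finset.card_eq_zero, Finset.filter_eq_empty_iff]
  rintro ⟨a, b⟩ - ⟨h1, h2⟩
  exact absurd h1 (not_lt.mpr h2.le)

theorem exists_word {r : ℕ} (k : ℕ) : ∀ w : Perm (Fin r), (invs w).card = k →
    ∃ l : List (Perm (Fin r)), (∀ s ∈ l, IsSimple s) ∧ l.prod = w ∧ l.length = k := by
  induction k with
  | zero =>
    intro w hw
    have : w = 1 := by
      by_contra h
      obtain ⟨i, j, hij, hlt⟩ := exists_descent w h
      have := card_invs_mul' hij w hlt
      omega
    exact ⟨[], by simp, by simp [this], rfl⟩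
  | succ k ih =>
    intro w hw
    have h1 : w ≠ 1 := by
      rintro rfl
      rw [invs_one] at hw
      omega
    obtain ⟨i, j, hij, hlt⟩ := exists_descent w h1
    obtain ⟨l, hl, hp, hk⟩ := ih (w * swap i j) (by have := card_invs_mul' hij w hlt; omega)
    refine ⟨l ++ [swap i j], ?_, by simp [hp, mul_assoc], by simp [hk]⟩
    intro s hs
    rcases List.mem_append.mp hs with hs | hs
    · exact hl s hs
    · rw [List.mem_singleton] at hs
      exact ⟨i, j, hij, hs⟩

theorem card_invs_le {r : ℕ} (l : List (Perm (Fin r))) :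
    (∀ s ∈ l, IsSimple s) → (invs l.prod).card ≤ l.length := by
  induction l using List.reverseRecOn with
  | nil => intro _; simp [invs_one]
  | append_singleton l s ih =>
    intro h
    have h1 := ih fun t ht => h t (by simp [ht])
    obtain ⟨i, j, hij, rfl⟩ := h s (by simp)
    simp only [List.prod_append, List.prod_cons, List.prod_nil, mul_one, List.length_append,
      List.length_cons, List.length_nil]
    have hne : i ≠ j := by rintro rfl; omega
    rcases lt_or_gt_of_ne (l.prod.injective.ne hne) with h2 | h2
    · have := card_invs_mul hij _ h2; omega
    · have := card_invs_mul' hij _ h2; omega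

theorem len_eq_card_invs {r : ℕ} (w : Perm (Fin r)) : len w = (invs w).card := by
  apply le_antisymm
  · exact Nat.sInf_le (exists_word _ w rfl)
  · refine le_csInf ⟨_, exists_word _ w rfl⟩ ?_
    rintro k ⟨l, hl, rfl, rfl⟩
    exact card_invs_le l hl

theorem IsSimple.mul_self {r : ℕ} {s : Perm (Fin r)} (hs : IsSimple s) : s * s = 1 := by
  obtain ⟨i, j, -, rfl⟩ := hs
  simp

theorem len_inv_le {r : ℕ} (w : Perm (Fin r)) : len w⁻¹ ≤ len w := by
  obtain ⟨l, hl, hp, hk⟩ := exists_word _ w rfl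
  rw [len_eq_card_invs w, ← hk]
  refine Nat.sInf_le ⟨(l.map fun s => s⁻¹).reverse, ?_, ?_, by simp⟩
  · intro s hs
    simp only [List.mem_reverse, List.mem_map] at hs
    obtain ⟨t, ht, rfl⟩ := hs
    obtain ⟨i, j, hij, rfl⟩ := hl t ht
    exact ⟨i, j, hij, by simp⟩
  · rw [← List.prod_inv_reverse, hp]

theorem len_inv {r : ℕ} (w : Perm (Fin r)) : len w⁻¹ = len w :=
  le_antisymm (len_inv_le w) (by simpa using len_inv_le w⁻¹)

theorem len_lt_mul_iff {r : ℕ} {i j : Fin r} (hij : (j : ℕ) = i + 1) (w : Perm (Fin r)) :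
    len w < len (w * swap i j) ↔ w i < w j := by
  have hne : i ≠ j := by rintro rfl; omega
  rw [len_eq_card_invs, len_eq_card_invs]
  rcases lt_or_gt_of_ne (w.injective.ne hne) with h2 | h2
  · have := card_invs_mul hij _ h2; exact ⟨fun _ => h2, fun _ => by omega⟩
  · have := card_invs_mul' hij _ h2
    exact ⟨fun _ => by omega, fun h => absurd h2 (not_lt.mpr h.le)⟩

theorem len_mul_lt_iff {r : ℕ} {s : Perm (Fin r)} (hs : IsSimple s) (w : Perm (Fin r)) :
    len (w * s) < len w ↔ ¬ len w < len (w * s) := by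
  obtain ⟨i, j, hij, rfl⟩ := hs
  have hne : i ≠ j := by rintro rfl; omega
  rw [len_lt_mul_iff hij]
  have := len_lt_mul_iff hij (w * swap i j)
  simp only [mul_assoc, swap_mul_self, mul_one, Perm.mul_apply, swap_apply_left,
    swap_apply_right] at this
  rw [this, not_lt]
  exact ⟨le_of_lt, fun h => lt_of_le_of_ne h (w.injective.ne hne.symm)⟩

theorem len_lt_mul_left_iff {r : ℕ} (s w : Perm (Fin r)) (hs : IsSimple s) :
    len w < len (s * w) ↔ len w⁻¹ < len (w⁻¹ * s) := by
  have : (s * w)⁻¹ = w⁻¹ * s := by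
    rw [mul_inv_rev, inv_eq_of_mul_eq_one_left hs.mul_self]
  rw [← this, len_inv, len_inv]

theorem ascent_stable {r : ℕ} {s t : Perm (Fin r)} (hs : IsSimple s) (ht : IsSimple t)
    (w : Perm (Fin r)) (h : s * w ≠ w * t) :
    len (s * w) < len (s * w * t) ↔ len w < len (w * t) := by
  obtain ⟨i, j, hij, rfl⟩ := hs
  obtain ⟨k, l, hkl, rfl⟩ := ht
  rw [len_lt_mul_iff hkl, len_lt_mul_iff hkl, Perm.mul_apply, Perm.mul_apply]
  have hkne : w k ≠ w l := w.injective.ne (by rintro rfl; omega)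
  have e : w * swap k l = swap (w k) (w l) * w := mul_swap_eq_swap_mul w k l
  have h1 : ¬ (w k = i ∧ w l = j) := by
    rintro ⟨rfl, rfl⟩
    exact h e.symm
  have h2 : ¬ (w l = i ∧ w k = j) := by
    rintro ⟨rfl, rfl⟩
    exact h (by rw [e, swap_comm])
  constructor
  · intro h3
    by_contra h4
    exact absurd h3 (not_lt.mpr
      (swap_lt_swap hij (lt_of_le_of_ne (not_lt.mp h4) hkne.symm) h2).le)
  · exact fun h3 => swap_lt_swap hij h3 h1

theorem ascent_stable_left {r : ℕ} {s t : Perm (Fin r)} (hs : IsSimple s) (ht : IsSimple t)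
    (w : Perm (Fin r)) (h : s * w ≠ w * t) :
    len (w * t) < len (s * (w * t)) ↔ len w < len (s * w) := by
  rw [len_lt_mul_left_iff _ _ hs, len_lt_mul_left_iff _ _ hs, mul_inv_rev,
    inv_eq_of_mul_eq_one_left ht.mul_self]
  refine ascent_stable ht hs _ fun h' => h ?_
  have := congrArg (fun x => w * x * w) h'
  simpa [mul_assoc] using this.symm

section Hecke

variable {R : Type*} [CommRing R] (q : R) {r : ℕ}

/-- The `R`-linear operator of right multiplication by `T_s` on the free module with basis
`Perm (Fin r)`. -/
noncomputable def rightMul (s : Perm (Fin r)) : Module.End R (Perm (Fin r) →₀ R) :=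
  Finsupp.linearCombination R fun w =>
    if len w < len (w * s) then Finsupp.single (w * s) 1
    else (q - 1) • Finsupp.single w 1 + q • Finsupp.single (w * s) 1

/-- The analogous operator of left multiplication by `T_s`. -/
noncomputable def leftMul (s : Perm (Fin r)) : Module.End R (Perm (Fin r) →₀ R) :=
  Finsupp.linearCombination R fun w =>
    if len w < len (s * w) then Finsupp.single (s * w) 1
    else (q - 1) • Finsupp.single w 1 + q • Finsupp.single (s * w) 1

theorem rightMul_single (s w : Perm (Fin r)) : rightMul q s (Finsupp.single w 1) =
    if len w < len (w * s) then Finsupp.single (w * s) 1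
    else (q - 1) • Finsupp.single w 1 + q • Finsupp.single (w * s) 1 := by
  simp [rightMul]

theorem leftMul_single (s w : Perm (Fin r)) : leftMul q s (Finsupp.single w 1) =
    if len w < len (s * w) then Finsupp.single (s * w) 1
    else (q - 1) • Finsupp.single w 1 + q • Finsupp.single (s * w) 1 := by
  simp [leftMul]

theorem leftMul_rightMul {s t : Perm (Fin r)} (hs : IsSimple s) (ht : IsSimple t) :
    rightMul q t * leftMul q s = leftMul q s * rightMul q t := by
  have hs1 : ∀ w, s * (s * w) = w := fun w => by rw [← mul_assoc, hs.mul_self, one_mul]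
  have ht1 : ∀ w, w * t * t = w := fun w => by rw [mul_assoc, ht.mul_self, mul_one]
  refine Finsupp.lhom_ext' fun w => LinearMap.ext_ring ?_
  simp only [LinearMap.comp_apply, Finsupp.lsingle_apply, Module.End.mul_apply]
  rw [rightMul_single, leftMul_single]
  by_cases h : s * w = w * t
  · have h3 := len_mul_lt_iff ht w
    by_cases h1 : len w < len (w * t)
    · have h2 : ¬ len (w * t) < len w := not_lt.mpr h1.le
      have e1 := rightMul_single q t (w * t)
      rw [ht1, if_neg h2] at e1
      have e2 := leftMul_single q s (s * w)
      rw [hs1, h, if_neg h2] at e2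
      rw [h, if_pos h1, e1, e2]
    · have e1 := rightMul_single q t (w * t)
      rw [ht1, if_pos (h3.mpr h1)] at e1
      have e2 := leftMul_single q s (s * w)
      rw [hs1, h, if_pos (h3.mpr h1)] at e2
      rw [h, if_neg h1]
      simp only [map_add, map_smul, e1, e2, rightMul_single, leftMul_single, h, if_neg h1]
  · have h1 := ascent_stable hs ht w h
    have h2 := ascent_stable_left hs ht w h
    rw [mul_assoc] at h1
    by_cases h3 : len w < len (w * t) <;> by_cases h4 : len w < len (s * w) <;>
      (simp only [h3, h4, iff_true, iff_false] at h1 h2) <;>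
      simp only [h1, h2, h3, h4, if_true, if_false, map_add, map_smul, rightMul_single,
        leftMul_single, mul_assoc] <;>
      module

variable (R r) in
/-- The Hecke algebra of the symmetric group on `r` letters with parameter `q`. It is realised as
the algebra of all endomorphisms of the free module with basis `T_w` (`w` in the symmetric group)
that commute with the right multiplications by all `T_s`, i.e. as the left multiplications; see
`heckeBasis`, `T_mul_T` and `T_one` for the usual description by a basis and multiplication
rules. -/
abbrev Hecke : Type _ :=
  Subalgebra.centralizer R
    {f : Module.End R (Perm (Fin r) →₀ R) | ∃ s, IsSimple s ∧ f = rightMul q s}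

/-- Evaluation at the basis element `T_1`. -/
noncomputable def heckeEval : Hecke R q r →ₗ[R] (Perm (Fin r) →₀ R) :=
  LinearMap.applyₗ (Finsupp.single 1 1) ∘ₗ (Subalgebra.val _).toLinearMap

theorem heckeEval_apply (a : Hecke R q r) :
    heckeEval q a = a.1 (Finsupp.single 1 1) := rfl

theorem hecke_comm (a : Hecke R q r) {s : Perm (Fin r)} (hs : IsSimple s)
    (x : Perm (Fin r) →₀ R) : rightMul q s (a.1 x) = a.1 (rightMul q s x) :=
  DFunLike.congr_fun (Subalgebra.mem_centralizer_iff R |>.mp a.2 _ ⟨s, hs, rfl⟩) x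

theorem len_one : len (1 : Perm (Fin r)) = 0 := by rw [len_eq_card_invs, invs_one]

theorem exists_right_descent (w : Perm (Fin r)) (hw : w ≠ 1) :
    ∃ s v, IsSimple s ∧ w = v * s ∧ len v < len w := by
  obtain ⟨i, j, hij, hlt⟩ := exists_descent w hw
  refine ⟨swap i j, w * swap i j, ⟨i, j, hij, rfl⟩, by simp [mul_assoc], ?_⟩
  rw [len_mul_lt_iff ⟨i, j, hij, rfl⟩, len_lt_mul_iff hij]
  exact not_lt.mpr hlt.le

theorem heckeEval_injective : Function.Injective (heckeEval (R := R) (r := r) q) := by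
  intro a b hab
  have key : ∀ k, ∀ w : Perm (Fin r), len w = k →
      a.1 (Finsupp.single w 1) = b.1 (Finsupp.single w 1) := by
    intro k
    induction k using Nat.strong_induction_on with
    | _ k ih =>
      intro w hw
      by_cases h1 : w = 1
      · rw [h1]; exact hab
      obtain ⟨s, v, hs, rfl, hlt⟩ := exists_right_descent w h1
      have ha := hecke_comm q a hs (Finsupp.single v 1)
      have hb := hecke_comm q b hs (Finsupp.single v 1)
      rw [rightMul_single, if_pos hlt] at ha hb
      rw [← ha, ← hb, ih _ (hw ▸ hlt) v rfl]
  apply Subtype.ext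
  refine Finsupp.lhom_ext' fun w => LinearMap.ext_ring ?_
  simp only [LinearMap.comp_apply, Finsupp.lsingle_apply]
  exact key _ w rfl

theorem heckeEval_surjective : Function.Surjective (heckeEval (R := R) (r := r) q) := by
  have key : ∀ k, ∀ w : Perm (Fin r), len w = k →
      ∃ a : Hecke R q r, heckeEval q a = Finsupp.single w 1 := by
    intro k
    induction k using Nat.strong_induction_on with
    | _ k ih =>
      intro w hw
      by_cases h1 : w = 1
      · exact ⟨1, by rw [h1]; rfl⟩
      obtain ⟨s, v, hs, he, hlt⟩ := exists_right_descent w⁻¹ (by simpa using h1)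
      have hsi : s⁻¹ = s := inv_eq_of_mul_eq_one_left hs.mul_self
      have hw' : w = s * v⁻¹ := by rw [← inv_inv w, he, mul_inv_rev, hsi]
      rw [len_inv] at hlt
      rw [← len_inv v] at hlt
      obtain ⟨a, ha⟩ := ih _ (hw ▸ hlt) v⁻¹ rfl
      have hL : leftMul q s ∈ Subalgebra.centralizer R
          {f : Module.End R (Perm (Fin r) →₀ R) | ∃ s, IsSimple s ∧ f = rightMul q s} := by
        rw [Subalgebra.mem_centralizer_iff]
        rintro _ ⟨t, ht, rfl⟩
        exact leftMul_rightMul q hs ht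
      refine ⟨⟨_, hL⟩ * a, ?_⟩
      rw [heckeEval_apply] at ha ⊢
      change leftMul q s (a.1 (Finsupp.single 1 1)) = _
      rw [ha, leftMul_single, ← hw', if_pos hlt]
  intro x
  induction x using Finsupp.induction_linear with
  | zero => exact ⟨0, map_zero _⟩
  | add x y hx hy =>
    obtain ⟨a, rfl⟩ := hx
    obtain ⟨b, rfl⟩ := hy
    exact ⟨a + b, map_add _ _ _⟩
  | single w c =>
    obtain ⟨a, ha⟩ := key _ w rfl
    exact ⟨c • a, by rw [map_smul, ha, Finsupp.smul_single, smul_eq_mul, mul_one]⟩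

noncomputable instance : Ring (Hecke R q r) := Algebra.semiringToRing R

variable (R r) in
/-- The basis `T_w` of the Hecke algebra. -/
noncomputable def heckeBasis : Module.Basis (Perm (Fin r)) R (Hecke R q r) :=
  .ofRepr (LinearEquiv.ofBijective (heckeEval q)
    ⟨heckeEval_injective q, heckeEval_surjective q⟩)

variable (R) in
/-- The basis element `T_w` of the Hecke algebra. -/
noncomputable def T (w : Perm (Fin r)) : Hecke R q r := heckeBasis R q r w

theorem heckeEval_T (w : Perm (Fin r)) : heckeEval q (T R q w) = Finsupp.single w 1 :=
  (LinearEquiv.ofBijective (heckeEval q)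
    ⟨heckeEval_injective q, heckeEval_surjective q⟩).apply_symm_apply _

/-- `T_1` is the identity. -/
theorem T_one : T R q (1 : Perm (Fin r)) = 1 := by
  apply heckeEval_injective q
  rw [heckeEval_T]
  rfl

/-- The multiplication rules of the Hecke algebra. -/
theorem T_mul_T {s : Perm (Fin r)} (hs : IsSimple s) (w : Perm (Fin r)) :
    T R q w * T R q s =
      if len w < len (w * s) then T R q (w * s)
      else (q - 1) • T R q w + q • T R q (w * s) := by
  have h0 : heckeEval q (T R q w * T R q s) = rightMul q s (Finsupp.single w 1) := by
    have h1 : heckeEval q (T R q w * T R q s) =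
        (T R q w).1 (heckeEval q (T R q s)) := rfl
    have h2 := rightMul_single q s 1
    by_cases hs1 : s = 1
    · obtain ⟨i, j, hij, rfl⟩ := hs
      rw [swap_eq_one_iff] at hs1
      subst hs1
      omega
    have h3 : len (1 : Perm (Fin r)) < len (1 * s) := by
      obtain ⟨i, j, hij, rfl⟩ := hs
      rw [len_lt_mul_iff hij, Perm.one_apply, Perm.one_apply, Fin.lt_def]
      omega
    rw [if_pos h3, one_mul] at h2
    rw [h1, heckeEval_T, ← h2, ← hecke_comm q _ hs, ← heckeEval_apply, heckeEval_T]
  apply heckeEval_injective q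
  rw [h0, rightMul_single]
  split_ifs <;> simp only [map_add, map_smul, heckeEval_T]

end Hecke

section Compositions

/-- Compositions of `r` with `N` (possibly zero) parts. -/
abbrev Comp (N r : ℕ) : Type := {c : Fin N → ℕ // ∑ i, c i = r}

/-- The `i`-th block of consecutive elements of `Fin r` determined by a composition. -/
def block {N r : ℕ} (c : Comp N r) (i : Fin N) : Set (Fin r) :=
  {x | ∑ j with j < i, c.1 j ≤ (x : ℕ) ∧ (x : ℕ) < ∑ j with j ≤ i, c.1 j}

/-- The parabolic subgroup of all permutations that leave every block invariant. -/
def parabolic {N r : ℕ} (c : Comp N r) : Subgroup (Perm (Fin r)) where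
  carrier := {w | ∀ i x, w x ∈ block c i ↔ x ∈ block c i}
  mul_mem' {a b} ha hb i x := by rw [Perm.mul_apply, ha, hb]
  one_mem' _ _ := Iff.rfl
  inv_mem' {a} ha i x := by rw [← ha i (a⁻¹ x), show a (a⁻¹ x) = x from Equiv.apply_symm_apply a x]

/-- The permutations that fix every point of every block whose index satisfies `p`. -/
def fixBlocks {N r : ℕ} (c : Comp N r) (p : Fin N → Prop) : Subgroup (Perm (Fin r)) where
  carrier := {w | ∀ i x, p i → x ∈ block c i → w x = x}
  mul_mem' {a b} ha hb i x hp hx := by rw [Perm.mul_apply, hb i x hp hx, ha i x hp hx]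
  one_mem' _ _ _ _ := rfl
  inv_mem' {a} ha i x hp hx := by rw [Perm.inv_eq_iff_eq, ha i x hp hx]

/-- The even part of the parabolic subgroup of a composition with `m + n` parts: it permutes the
first `m` blocks only. -/
def evenPart {m n r : ℕ} (c : Comp (m + n) r) : Subgroup (Perm (Fin r)) :=
  parabolic c ⊓ fixBlocks c fun i => m ≤ (i : ℕ)

/-- The odd part of the parabolic subgroup of a composition with `m + n` parts: it permutes the
last `n` blocks only. -/
def oddPart {m n r : ℕ} (c : Comp (m + n) r) : Subgroup (Perm (Fin r)) :=
  parabolic c ⊓ fixBlocks c fun i => (i : ℕ) < m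

/-- The elements of minimal length in the right cosets `P w` of a subgroup `P`. -/
def minReps {r : ℕ} (P : Subgroup (Perm (Fin r))) : Set (Perm (Fin r)) :=
  {d | ∀ w ∈ P, len d ≤ len (w * d)}

/-- The shortest double coset representatives attached to two compositions. -/
def doubleReps {N r : ℕ} (a b : Comp N r) : Set (Perm (Fin r)) :=
  {d | d ∈ minReps (parabolic a) ∧ d⁻¹ ∈ minReps (parabolic b)}

/-- The conjugate `d⁻¹ P d`. -/
def conjBy {r : ℕ} (P : Subgroup (Perm (Fin r))) (d : Perm (Fin r)) :
    Subgroup (Perm (Fin r)) :=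
  P.map (MulAut.conj d⁻¹).toMonoidHom

/-- The double coset representatives satisfying the trivial intersection conditions between even
and odd parts. -/
def superReps {m n r : ℕ} (a b : Comp (m + n) r) : Set (Perm (Fin r)) :=
  {d | d ∈ doubleReps a b ∧ conjBy (evenPart a) d ⊓ oddPart b = ⊥ ∧
    conjBy (oddPart a) d ⊓ evenPart b = ⊥}

/-- The matrix with entries `|N_i^a ∩ d (N_j^b)|`. -/
noncomputable def cosetMatrix {N r : ℕ} (a : Comp N r) (d : Perm (Fin r)) (b : Comp N r) :
    Matrix (Fin N) (Fin N) ℕ :=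
  Matrix.of fun i j => (block a i ∩ d '' block b j).ncard

/-- The index set `M(m|n,r)`. -/
def superMatrices (m n r : ℕ) : Set (Matrix (Fin (m + n)) (Fin (m + n)) ℕ) :=
  {A | ∃ (a b : Comp (m + n) r) (d : Perm (Fin r)), d ∈ superReps a b ∧ A = cosetMatrix a d b}

end Compositions

section SuperAlgebra

variable {R : Type*} [CommRing R] (q : Rˣ) {m n r : ℕ}

open Classical in
/-- `T_D = ∑ T_{w₀} (-q)^{-ℓ(w₁)} T_{w₁}`, the sum over all `w₀` in `D ∩ W_{c⁽⁰⁾}` and all `w₁` in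
`D ∩ W_{c⁽¹⁾}`. -/
noncomputable def superSum (c : Comp (m + n) r) (D : Set (Perm (Fin r))) : Hecke R (q : R) r :=
  ∑ w₀ with w₀ ∈ D ∧ w₀ ∈ evenPart c, ∑ w₁ with w₁ ∈ D ∧ w₁ ∈ oddPart c,
    (((-q)⁻¹ ^ len w₁ : Rˣ) : R) • (T R (q : R) w₀ * T R (q : R) w₁)

open Classical in
/-- The element `x_{c⁽⁰⁾} = ∑ T_w`, the sum over the even part. -/
noncomputable def xEven (c : Comp (m + n) r) : Hecke R (q : R) r :=
  ∑ w with w ∈ evenPart c, T R (q : R) w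

open Classical in
/-- The element `y_{c⁽¹⁾} = ∑ (-q)^{-ℓ(w)} T_w`, the sum over the odd part. -/
noncomputable def yOdd (c : Comp (m + n) r) : Hecke R (q : R) r :=
  ∑ w with w ∈ oddPart c, (((-q)⁻¹ ^ len w : Rˣ) : R) • T R (q : R) w

/-- The element `[xy]_c = x_{c⁽⁰⁾} y_{c⁽¹⁾}`. -/
noncomputable def xy (c : Comp (m + n) r) : Hecke R (q : R) r := xEven q c * yOdd q c

/-- The right ideal generated by `[xy]_c`, a right module over the Hecke algebra. -/
noncomputable abbrev xyIdeal (c : Comp (m + n) r) :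
    Submodule (Hecke R (q : R) r)ᵐᵒᵖ (Hecke R (q : R) r) :=
  Submodule.span _ {xy q c}

variable (m n r) in
/-- The tensor space, the direct sum of the right ideals generated by the `[xy]_c`. -/
noncomputable abbrev TensorSpace : Type _ := DirectSum (Comp (m + n) r) fun c => xyIdeal q c

variable (m n r) in
/-- The `q`-Schur superalgebra: the endomorphism algebra of the tensor space as a right module over
the Hecke algebra. -/
noncomputable abbrev SchurAlg : Type _ := Module.End (Hecke R (q : R) r)ᵐᵒᵖ (TensorSpace q m n r)

set_option synthInstance.maxHeartbeats 200000 in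
noncomputable instance instAlgebraSchurAlg : Algebra R (SchurAlg q m n r) := inferInstance

noncomputable instance instModuleSchurAlg : Module R (SchurAlg q m n r) :=
  (instAlgebraSchurAlg q).toModule

noncomputable instance instSMulSchurAlg : SMul R (SchurAlg q m n r) :=
  (instAlgebraSchurAlg q).toSMul

/-- The inclusion of a summand into the tensor space. -/
noncomputable abbrev incl (c : Comp (m + n) r) :
    xyIdeal q c →ₗ[(Hecke R (q : R) r)ᵐᵒᵖ] TensorSpace q m n r :=
  DirectSum.lof (Hecke R (q : R) r)ᵐᵒᵖ (Comp (m + n) r) (fun c => xyIdeal q c) c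

theorem xy_mul_mem (c : Comp (m + n) r) (h : Hecke R (q : R) r) : xy q c * h ∈ xyIdeal q c :=
  Submodule.smul_mem _ (MulOpposite.op h) (Submodule.subset_span rfl)

/-- The element `T_{W_a d W_b} = [xy]_a T_d T_{D_ν ∩ W_b}`, where `W_ν = d⁻¹ W_a d ∩ W_b`. -/
noncomputable def doubleCosetElt (a : Comp (m + n) r) (d : Perm (Fin r)) (b : Comp (m + n) r) :
    Hecke R (q : R) r :=
  xy q a * (T R (q : R) d *
    superSum q b (minReps (conjBy (parabolic a) d ⊓ parabolic b) ∩ parabolic b))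

theorem doubleCosetElt_mul_mem (a : Comp (m + n) r) (d : Perm (Fin r)) (b : Comp (m + n) r)
    (h : Hecke R (q : R) r) : doubleCosetElt q a d b * h ∈ xyIdeal q a := by
  rw [doubleCosetElt, mul_assoc]
  exact xy_mul_mem q a _

open Classical in
/-- `f` is the homomorphism `φ_A`: if `A` is the matrix of `(a, d, b)`, then `f` maps `[xy]_c h` to
`δ_{b,c} T_{W_a d W_b} h` for all `c` and all `h` in the Hecke algebra. -/
def IsPhi (A : Matrix (Fin (m + n)) (Fin (m + n)) ℕ) (f : SchurAlg q m n r) : Prop :=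
  ∃ (a b : Comp (m + n) r) (d : Perm (Fin r)), d ∈ superReps a b ∧ A = cosetMatrix a d b ∧
    ∀ (c : Comp (m + n) r) (h : Hecke R (q : R) r),
      f (incl q c ⟨xy q c * h, xy_mul_mem q c h⟩) =
        if c = b then incl q a ⟨doubleCosetElt q a d b * h, doubleCosetElt_mul_mem q a d b h⟩
        else 0

open Classical in
variable (m n r) in
/-- The element `φ_A` of the `q`-Schur superalgebra, for `A` in `M(m|n,r)`. -/
noncomputable def phi (A : Matrix (Fin (m + n)) (Fin (m + n)) ℕ) : SchurAlg q m n r :=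
  if h : ∃ f : SchurAlg q m n r, IsPhi q A f then h.choose else 0

end SuperAlgebra

section Formulas

/-- The unit `𝒒 = υ²` of `ℤ[υ, υ⁻¹]`. -/
noncomputable def qZ : (LaurentPolynomial ℤ)ˣ where
  val := LaurentPolynomial.T 2
  inv := LaurentPolynomial.T (-2)
  val_inv := by rw [← LaurentPolynomial.T_add]; exact LaurentPolynomial.T_zero
  inv_val := by rw [← LaurentPolynomial.T_add]; exact LaurentPolynomial.T_zero

/-- The Gaussian integer `1 + x + ⋯ + x^{k-1}`. -/
def gauss {S : Type*} [Semiring S] (k : ℕ) (x : S) : S := ∑ t ∈ Finset.range k, x ^ t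

variable (m n : ℕ)

/-- `1` for even indices and `-𝒒⁻¹` for odd indices. -/
noncomputable def qDot (h : Fin (m + n)) : LaurentPolynomial ℤ :=
  if (h : ℕ) < m then 1 else -((qZ⁻¹ : (LaurentPolynomial ℤ)ˣ) : LaurentPolynomial ℤ)

/-- `𝒒` for even indices and `-1` for odd indices. -/
noncomputable def qDdot (h : Fin (m + n)) : LaurentPolynomial ℤ :=
  if (h : ℕ) < m then (qZ : LaurentPolynomial ℤ) else -1

/-- `𝒒_h = υ_h²`, i.e. `𝒒` for even indices and `𝒒⁻¹` for odd indices. -/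
noncomputable def qIdx (h : Fin (m + n)) : LaurentPolynomial ℤ :=
  if (h : ℕ) < m then (qZ : LaurentPolynomial ℤ)
  else ((qZ⁻¹ : (LaurentPolynomial ℤ)ˣ) : LaurentPolynomial ℤ)

/-- The coefficient of `φ_{A⁺_{h,k}}` in the super multiplication formula for `φ_{D⁺_h} φ_A`; here
`h'` stands for `h + 1`. -/
noncomputable def superCoeffPlus (A : Matrix (Fin (m + n)) (Fin (m + n)) ℕ)
    (h h' k : Fin (m + n)) : LaurentPolynomial ℤ :=
  qDot m n h' ^ (∑ j with j < k, A h' j) * qDdot m n h ^ (∑ j with k < j, A h j) *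
    gauss (A h k + 1) (qIdx m n h)

/-- The coefficient of `φ_{A⁻_{h,k}}` in the super multiplication formula for `φ_{D⁻_h} φ_A`; here
`h'` stands for `h + 1`. -/
noncomputable def superCoeffMinus (A : Matrix (Fin (m + n)) (Fin (m + n)) ℕ)
    (h h' k : Fin (m + n)) : LaurentPolynomial ℤ :=
  qDot m n h ^ (∑ j with k < j, A h j) * qDdot m n h' ^ (∑ j with j < k, A h' j) *
    gauss (A h' k + 1) (qIdx m n h')

end Formulas

section Matrices

variable {N : ℕ}

/-- `D = D(i,j;A)`: the matrix `D - E_{i,j}` is diagonal and the column sums of `D` are the row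
sums of `A`. The matrices `D⁺_h` and `D⁻_h` are the cases `(i,j) = (h,h+1)` and `(h+1,h)`. -/
def IsElementary (A D : Matrix (Fin N) (Fin N) ℕ) (i j : Fin N) : Prop :=
  (∃ c : Fin N → ℕ, D = Matrix.diagonal c + Matrix.single i j 1) ∧
    ∀ l, ∑ k, D k l = ∑ k, A l k

/-- The matrix `A + E_{i,k} - E_{j,k}`, used for `i ≠ j` and `A j k ≥ 1` only. The matrices
`A⁺_{h,k}` and `A⁻_{h,k}` are the cases `(i,j) = (h,h+1)` and `(h+1,h)`. -/
def shift (A : Matrix (Fin N) (Fin N) ℕ) (i j k : Fin N) : Matrix (Fin N) (Fin N) ℕ :=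
  A + Matrix.single i k 1 - Matrix.single j k 1

end Matrices

section BLM

/-- The `N`-step flags `0 = V_0 ⊆ V_1 ⊆ ⋯ ⊆ V_N = V`. -/
def Flag (K V : Type*) [Field K] [AddCommGroup V] [Module K V] (N : ℕ) : Type _ :=
  {F : Fin (N + 1) → Submodule K V // Monotone F ∧ F 0 = ⊥ ∧ F (Fin.last N) = ⊤}

variable {K V : Type*} [Field K] [AddCommGroup V] [Module K V] {N : ℕ}

/-- The matrix that indexes the `GL(V)`-orbit of a pair of flags: its `(i,j)`-entry is the dimension
of `(V_{i-1} + V_i ∩ V'_j) / (V_{i-1} + V_i ∩ V'_{j-1})`. -/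
noncomputable def relPos (F F' : Flag K V N) : Matrix (Fin N) (Fin N) ℕ :=
  Matrix.of fun i j =>
    Module.finrank K ↥(F.1 i.castSucc ⊔ F.1 i.succ ⊓ F'.1 j.succ) -
      Module.finrank K ↥(F.1 i.castSucc ⊔ F.1 i.succ ⊓ F'.1 j.castSucc)

variable (K V) in
open Classical in
/-- The characteristic function `e_A` of the orbit of pairs of flags indexed by `A`. -/
noncomputable def orbitFun (A : Matrix (Fin N) (Fin N) ℕ) : Flag K V N → Flag K V N → ℤ :=
  fun F F' => if relPos F F' = A then 1 else 0

/-- The convolution product of functions on pairs of flags; it is used for finite `V` only. -/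
noncomputable def conv (f g : Flag K V N → Flag K V N → ℤ) : Flag K V N → Flag K V N → ℤ :=
  fun F F'' => ∑ᶠ F', f F F' * g F' F''

/-- The coefficient `q^{∑_{j>k} a_{h,j}} (1 + q + ⋯ + q^{a_{h,k}})` of Beilinson, Lusztig and
MacPherson, a polynomial in `q`. -/
noncomputable def blmCoeffPlus (A : Matrix (Fin N) (Fin N) ℕ) (h k : Fin N) : Polynomial ℤ :=
  Polynomial.X ^ (∑ j with k < j, A h j) * gauss (A h k + 1) Polynomial.X

/-- The coefficient `q^{∑_{j<k} a_{h+1,j}} (1 + q + ⋯ + q^{a_{h+1,k}})` of Beilinson, Lusztig and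
MacPherson, a polynomial in `q`; here `h'` stands for `h + 1`. -/
noncomputable def blmCoeffMinus (A : Matrix (Fin N) (Fin N) ℕ) (h' k : Fin N) : Polynomial ℤ :=
  Polynomial.X ^ (∑ j with j < k, A h' j) * gauss (A h' k + 1) Polynomial.X

end BLM

end QSchur

namespace QSchur

open Equiv

/-! ### Young subgroups, additivity of lengths and minimal coset representatives -/

section Young

variable {r : ℕ} {α : Type*}

/-! At `n = 0` all odd parts are trivial, and everything on the Hecke side becomes a sum `sumT S` of
`T_w` over a set `S`. A composition is encoded by the monotone colouring `col` of the points by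
their blocks; its parabolic subgroup is the stabiliser of that colouring, and the double coset of
`w` is determined by the matrix `cnt`, which counts the points `y` by the colours of `w y` and `y`
(`exists_of_cnt_eq`). Because lengths add in minimal factorisations, the element defining `φ_A` is
the sum over the double coset `C_A` (`stab_mul_T_mul_eq`), and this sum equals `Z_A x_μ`, where
`Z_A` sums over those `u` in `C_A` that are shortest in `u W_μ`. Hence `φ_A` is left multiplication
by `Z_A` on one summand and zero on the others, and a product `φ_D φ_A` is found by expanding `Z_D *
sumT C_A` (`phi_mul_phi`).

For elementary `D`, the row and column compositions of `D` give colourings that differ at one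
boundary point `p`. The terms of `Z_D` are the cyclic permutations `shuttle p i`, with `i` in the
block that has gained `p`. The coefficients of `Z_D * sumT C_A` are constant on the left orbits of
the parabolic subgroup `W` of the row composition, so they need only be compared at a `w` that is
shortest in `W w`. There `len (u⁻¹ * w) = len u + len w` for each shuttle `u`, so `u` contributes `q
^ len u = q ^ |p - i|` if `u⁻¹ * w` lies in `C_A` and nothing otherwise. That membership depends
only on the column `k` of `i`. In the enlarged block the columns increase weakly and `p` is an end
point, so the `i` with column `k` form a run and the sum is a power of `q` times a Gaussian integer.

On the flag side, `relPos F G` is the matrix of second differences of `dim (F_I ∩ G_J)`. If `relPos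
F F'` is elementary, then `F` and `F'` agree except at one index, where one member is a hyperplane
in the other. Changing one member in this way moves a single unit of `relPos · G` within a column
(`Covers.relPos_add_single`). The structure constant is therefore a number of hyperplanes of `F_h`
that contain one subspace but not another, or dually a number of covers of `F_h`. `card_covers` and
`card_cocovers` compute it by counting vectors, and it is the value at `|K|` of the polynomial whose
value at `q` occurs in the Hecke computation. -/

theorem perm_apply_inv (w : Perm (Fin r)) (x : Fin r) : w (w⁻¹ x) = x := w.apply_symm_apply x

/-- The hypothesis says that `u` reverses no pair already reversed by `w`. The inversions of `u * w`
are then the disjoint union of those of `w` and of those of `u` pulled back along `w`. -/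
theorem len_mul_of_inversions {u w : Perm (Fin r)}
    (h : ∀ a b, a < b → w b < w a → u (w b) < u (w a)) : len (u * w) = len u + len w := by
  rw [len_eq_card_invs, len_eq_card_invs, len_eq_card_invs]
  have key : invs (u * w) =
      (invs u).map ((w⁻¹).prodCongr w⁻¹).toEmbedding ∪ invs w := by
    ext ⟨a, b⟩
    simp only [mem_invs, Perm.mul_apply, Finset.mem_union, Finset.mem_map,
      Equiv.toEmbedding_apply, Equiv.prodCongr_apply, Prod.map_apply, Prod.mk.injEq, Prod.exists]
    constructor
    · rintro ⟨h1, h2⟩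
      rcases lt_or_gt_of_ne (w.injective.ne h1.ne) with h3 | h3
      · exact Or.inl ⟨w a, w b, ⟨h3, h2⟩, by simp, by simp⟩
      · exact Or.inr ⟨h1, h3⟩
    · rintro (⟨x, y, ⟨h1, h2⟩, rfl, rfl⟩ | ⟨h1, h2⟩)
      · refine ⟨?_, by simpa using h2⟩
        by_contra h3
        have h4 : w⁻¹ y < w⁻¹ x :=
          lt_of_le_of_ne (not_lt.mp h3) ((w⁻¹).injective.ne h1.ne')
        have := h _ _ h4 (by simpa using h1)
        simp only [perm_apply_inv] at this
        exact absurd h2 (not_lt.mpr this.le)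
      · exact ⟨h1, h _ _ h1 h2⟩
  rw [key, Finset.card_union_of_disjoint, Finset.card_map]
  rw [Finset.disjoint_left]
  rintro ⟨a, b⟩
  simp only [mem_invs, Finset.mem_map,
      Equiv.toEmbedding_apply, Equiv.prodCongr_apply, Prod.map_apply, Prod.mk.injEq, Prod.exists]
  rintro ⟨x, y, ⟨h1, h2⟩, rfl, rfl⟩ ⟨h3, h4⟩
  simp only [perm_apply_inv] at h4
  exact absurd h1 (not_lt.mpr h4.le)

theorem eq_one_of_len {w : Perm (Fin r)} (h : len w = 0) : w = 1 := by
  by_contra hw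
  obtain ⟨s, v, -, -, hlt⟩ := exists_right_descent w hw
  omega

/-- The Young subgroup of the permutations that preserve a colouring. -/
def stab (f : Fin r → α) : Subgroup (Perm (Fin r)) where
  carrier := {w | ∀ x, f (w x) = f x}
  mul_mem' {a b} ha hb x := by rw [Perm.mul_apply, ha, hb]
  one_mem' _ := rfl
  inv_mem' {a} ha x := by rw [← ha (a⁻¹ x), perm_apply_inv]

theorem mem_stab {f : Fin r → α} {w : Perm (Fin r)} : w ∈ stab f ↔ ∀ x, f (w x) = f x := Iff.rfl

/-- `w` is increasing on the fibres of the colouring `f`. -/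
def IncOn (f : Fin r → α) (w : Perm (Fin r)) : Prop := ∀ x y, x < y → f x = f y → w x < w y

theorem swap_mem_stab {f : Fin r → α} {i j : Fin r} (h : f i = f j) : swap i j ∈ stab f := by
  intro x
  rw [swap_apply_def]
  split_ifs with h1 h2
  · rw [h1, h]
  · rw [h2, h]
  · rfl

variable [LinearOrder α] {f : Fin r → α} (hf : Monotone f)
include hf

/-- As `f` is monotone and `w` preserves it, every inversion of `w` lies inside one fibre, where `u`
keeps the order. -/
theorem len_mul_of_incOn {u w : Perm (Fin r)} (hu : IncOn f u) (hw : w ∈ stab f) :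
    len (u * w) = len u + len w := by
  refine len_mul_of_inversions fun a b h1 h2 => hu _ _ h2 ?_
  have h3 := hf h1.le
  have h4 := hf h2.le
  rw [hw, hw] at *
  exact le_antisymm h4 h3

theorem len_mul_of_incOn_inv {u w : Perm (Fin r)} (hu : IncOn f u⁻¹) (hw : w ∈ stab f) :
    len (w * u) = len w + len u := by
  rw [← len_inv (w * u), mul_inv_rev, len_mul_of_incOn hf hu (inv_mem hw), len_inv, len_inv,
    add_comm]

/-- The fibres of a monotone colouring are intervals, so any two points of a fibre are joined by
adjacent steps inside it. -/
theorem incOn_of_adjacent {u : Perm (Fin r)}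
    (h : ∀ i j : Fin r, (j : ℕ) = i + 1 → f i = f j → u i < u j) : IncOn f u := by
  have key : ∀ k : ℕ, ∀ x y : Fin r, (y : ℕ) = x + k + 1 → f x = f y → u x < u y := by
    intro k
    induction k with
    | zero => exact fun x y hxy => h x y (by omega)
    | succ k ih =>
      intro x y hxy hc
      let z : Fin r := ⟨x + k + 1, by omega⟩
      have hxz : x ≤ z := by rw [Fin.le_def]; simp only [z]; omega
      have hzy : z ≤ y := by rw [Fin.le_def]; simp only [z]; omega
      have h1 : f x = f z := le_antisymm (hf hxz) (hc ▸ hf hzy)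
      exact (ih x z rfl h1).trans (h z y (by simp only [z]; omega) (h1 ▸ hc))
  intro x y hxy
  have := Fin.lt_def.mp hxy
  exact key (y - x - 1) x y (by omega)

/-- If `u` is not increasing on fibres, it reverses an adjacent pair inside a fibre, and multiplying
by that simple reflection shortens it within its coset. -/
theorem incOn_iff_minimal {u : Perm (Fin r)} :
    IncOn f u ↔ ∀ p ∈ stab f, len u ≤ len (u * p) := by
  refine ⟨fun h p hp => by rw [len_mul_of_incOn hf h hp]; omega, fun h => ?_⟩
  refine incOn_of_adjacent hf fun i j hij hc => ?_
  by_contra h1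
  have h2 := h _ (swap_mem_stab hc)
  rw [← len_lt_mul_iff hij, ← len_mul_lt_iff ⟨i, j, hij, rfl⟩] at h1
  omega

theorem exists_eq_mul_incOn (w : Perm (Fin r)) :
    ∃ u p, IncOn f u ∧ p ∈ stab f ∧ w = u * p := by
  classical
  obtain ⟨p, hp, hmin⟩ := Finset.exists_min_image (Finset.univ.filter (· ∈ stab f))
    (fun p => len (w * p)) ⟨1, by simp [one_mem]⟩
  simp only [Finset.mem_filter, Finset.mem_univ, true_and] at hp hmin
  refine ⟨w * p, p⁻¹, (incOn_iff_minimal hf).mpr fun p' hp' => ?_, inv_mem hp, by simp⟩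
  rw [mul_assoc]
  exact hmin _ (mul_mem hp hp')

/-- Additivity in both directions gives `len u = len v + len p` and `len v = len u + len p`, so `p`
has length zero. -/
theorem incOn_unique {u v p : Perm (Fin r)} (hu : IncOn f u) (hv : IncOn f v) (hp : p ∈ stab f)
    (h : u = v * p) : u = v := by
  have h1 := len_mul_of_incOn hf hv hp
  have h2 := len_mul_of_incOn hf hu (inv_mem hp)
  rw [← h] at h1
  rw [h, mul_inv_cancel_right, len_inv, ← h] at h2
  rw [h, eq_one_of_len (w := p) (by omega), mul_one]

/-- A property that is invariant under left multiplication by the simple reflections of a Young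
subgroup can be checked on minimal coset representatives. -/
theorem induction_incOn_inv {motive : Perm (Fin r) → Prop}
    (hmin : ∀ w, IncOn f w⁻¹ → motive w)
    (hs : ∀ s w, IsSimple s → s ∈ stab f → len w < len (s * w) → motive w → motive (s * w))
    (w : Perm (Fin r)) : motive w := by
  induction hk : len w using Nat.strong_induction_on generalizing w with
  | _ k ih =>
    by_cases hw : IncOn f w⁻¹
    · exact hmin w hw
    -- A `w` that is not minimal has a left descent inside the Young subgroup; the induction passes
    -- through the shorter element `swap i j * w`.
    have : ∃ i j : Fin r, (j : ℕ) = i + 1 ∧ f i = f j ∧ ¬ w⁻¹ i < w⁻¹ j := by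
      by_contra! hc
      exact hw (incOn_of_adjacent hf hc)
    obtain ⟨i, j, hij, hc, hlt⟩ := this
    have hsi : IsSimple (swap i j) := ⟨i, j, hij, rfl⟩
    have h1 : len (swap i j * w) < len w := by
      rw [← len_inv (_ * w), mul_inv_rev, swap_inv, ← len_inv w, len_mul_lt_iff hsi,
        len_lt_mul_iff hij]
      exact hlt
    have h2 := hs (swap i j) (swap i j * w) hsi (swap_mem_stab hc)
      (by simpa [← mul_assoc] using h1) (ih _ (hk ▸ h1) _ rfl)
    simpa [← mul_assoc] using h2

end Young

/-! ### Compositions as colourings, double cosets as matrices -/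

section Colours

variable {N r : ℕ}

/-- The block of `x` is the least index at which the partial sums of `c` exceed `x`; minimality
gives the lower bound. -/
theorem exists_mem_block (c : Comp N r) (x : Fin r) : ∃ i, x ∈ block c i := by
  have h0 : ∃ k : ℕ, ∃ hk : k < N, (x : ℕ) < ∑ j with j ≤ (⟨k, hk⟩ : Fin N), c.1 j := by
    rcases N with _ | N
    · have h1 : ∑ i, c.1 i = 0 := Finset.sum_of_isEmpty _
      exact absurd x.2 (by rw [c.2] at h1; omega)
    · refine ⟨N, by omega, ?_⟩
      have : (Finset.univ.filter fun j : Fin (N + 1) => j ≤ ⟨N, by omega⟩) = Finset.univ := by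
        ext j
        simp [Fin.le_def]
        omega
      rw [this, c.2]
      exact x.2
  classical
  obtain ⟨hk, hx⟩ := Nat.find_spec h0
  refine ⟨⟨Nat.find h0, hk⟩, ?_, hx⟩
  by_contra hlt
  rw [not_le] at hlt
  rcases hk0 : Nat.find h0 with _ | k
  · simp [hk0, Fin.lt_def] at hlt
  · refine Nat.find_min h0 (m := k) (by omega) ⟨by omega, ?_⟩
    have : (Finset.univ.filter fun j : Fin N => j ≤ ⟨k, by omega⟩) =
        Finset.univ.filter fun j => j < ⟨Nat.find h0, hk⟩ := by
      ext j
      simp only [Finset.mem_filter, Finset.mem_univ, true_and, Fin.lt_def, Fin.le_def, hk0]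
      omega
    rwa [this]

theorem block_lt {c : Comp N r} {i j : Fin N} (hij : i < j) {x y : Fin r} (hx : x ∈ block c i)
    (hy : y ∈ block c j) : x < y := by
  rw [Fin.lt_def]
  refine hx.2.trans_le (le_trans (Finset.sum_le_sum_of_subset fun l => ?_) hy.1)
  simp only [Finset.mem_filter, Finset.mem_univ, true_and]
  exact fun h => h.trans_lt hij

/-- The index of the block that contains a given point. -/
noncomputable def col (c : Comp N r) (x : Fin r) : Fin N := (exists_mem_block c x).choose

theorem mem_block_iff {c : Comp N r} {x : Fin r} {i : Fin N} : x ∈ block c i ↔ col c x = i := by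
  have h := (exists_mem_block c x).choose_spec
  change x ∈ block c (col c x) at h
  constructor
  · intro hx
    rcases lt_trichotomy (col c x) i with h1 | h1 | h1
    · exact absurd (block_lt h1 h hx) (lt_irrefl _)
    · exact h1
    · exact absurd (block_lt h1 hx h) (lt_irrefl _)
  · rintro rfl
    exact h

theorem col_monotone (c : Comp N r) : Monotone (col c) := by
  intro x y hxy
  by_contra h
  exact absurd (block_lt (not_le.mp h) (mem_block_iff.mpr rfl) (mem_block_iff.mpr rfl))
    (not_lt.mpr hxy)

theorem parabolic_eq_stab (c : Comp N r) : parabolic c = stab (col c) := by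
  ext w
  change (∀ i x, w x ∈ block c i ↔ x ∈ block c i) ↔ ∀ x, col c (w x) = col c x
  simp only [mem_block_iff]
  exact ⟨fun h x => (h _ x).mpr rfl, fun h i x => by rw [h]⟩

theorem card_col (c : Comp N r) (i : Fin N) :
    (Finset.univ.filter fun x => col c x = i).card = c.1 i := by
  have h1 : (Finset.univ.filter fun x : Fin r => col c x = i).map Fin.valEmbedding =
      Finset.Ico (∑ j with j < i, c.1 j) (∑ j with j ≤ i, c.1 j) := by
    ext k
    simp only [Finset.mem_map, Finset.mem_filter, Finset.mem_univ, true_and, ← mem_block_iff,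
      Fin.valEmbedding_apply, Finset.mem_Ico]
    constructor
    · rintro ⟨x, hx, rfl⟩
      exact hx
    · intro hk
      have h3 : ∑ j with j ≤ i, c.1 j ≤ ∑ j, c.1 j :=
        Finset.sum_le_sum_of_subset (Finset.filter_subset _ _)
      have : k < r := hk.2.trans_le (h3.trans_eq c.2)
      exact ⟨⟨k, this⟩, hk, rfl⟩
  have h2 := congrArg Finset.card h1
  rw [Finset.card_map, Nat.card_Ico] at h2
  have h3 : (Finset.univ.filter fun j => j ≤ i) = insert i (Finset.univ.filter fun j => j < i) := by
    ext j
    simp [le_iff_eq_or_lt]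
  rw [h2, h3, Finset.sum_insert (by simp)]
  omega

/-- The matrix that counts the points with given colours. -/
def cnt (f g : Fin r → Fin N) : Matrix (Fin N) (Fin N) ℕ :=
  Matrix.of fun i j => (Finset.univ.filter fun y => f y = i ∧ g y = j).card

theorem cosetMatrix_eq_cnt (a b : Comp N r) (d : Perm (Fin r)) :
    cosetMatrix a d b = cnt (col a ∘ d) (col b) := by
  ext i j
  simp only [cosetMatrix, cnt, Matrix.of_apply, Function.comp_apply]
  have h : block a i ∩ d '' block b j =
      d '' ↑(Finset.univ.filter fun y => col a (d y) = i ∧ col b y = j) := by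
    ext x
    simp only [Set.mem_inter_iff, mem_block_iff, Set.mem_image, Finset.coe_filter,
      Finset.mem_univ, true_and]
    constructor
    · rintro ⟨h1, y, h2, rfl⟩
      exact ⟨y, ⟨h1, h2⟩, rfl⟩
    · rintro ⟨y, ⟨h1, h2⟩, rfl⟩
      exact ⟨h1, y, h2, rfl⟩
  rw [h, Set.ncard_image_of_injective _ d.injective, Set.ncard_coe_finset]

theorem cnt_row_sum (f g : Fin r → Fin N) (i : Fin N) :
    ∑ j, cnt f g i j = (Finset.univ.filter fun y => f y = i).card := by
  rw [Finset.card_eq_sum_card_fiberwise (f := g) (t := Finset.univ) (by simp)]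
  simp only [cnt, Matrix.of_apply, Finset.filter_filter]

theorem cnt_col_sum (f g : Fin r → Fin N) (j : Fin N) :
    ∑ i, cnt f g i j = (Finset.univ.filter fun y => g y = j).card := by
  rw [Finset.card_eq_sum_card_fiberwise (f := f) (t := Finset.univ) (by simp)]
  simp only [cnt, Matrix.of_apply, Finset.filter_filter, and_comm]

theorem card_comp_perm (f : Fin r → Fin N) (w : Perm (Fin r)) (i : Fin N) :
    (Finset.univ.filter fun y => f (w y) = i).card =
      (Finset.univ.filter fun y => f y = i).card :=
  Finset.card_equiv w (by simp)

theorem cosetMatrix_row_sum (a b : Comp N r) (d : Perm (Fin r)) (i : Fin N) :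
    ∑ j, cosetMatrix a d b i j = a.1 i := by
  rw [cosetMatrix_eq_cnt, cnt_row_sum, ← card_col a]
  exact card_comp_perm (col a) d i

theorem cosetMatrix_col_sum (a b : Comp N r) (d : Perm (Fin r)) (j : Fin N) :
    ∑ i, cosetMatrix a d b i j = b.1 j := by
  rw [cosetMatrix_eq_cnt, cnt_col_sum, card_col]

theorem cnt_comp_perm (f g : Fin r → Fin N) (w : Perm (Fin r)) : cnt (f ∘ w) (g ∘ w) = cnt f g := by
  ext i j
  simp only [cnt, Matrix.of_apply]
  exact Finset.card_equiv w (by simp)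

theorem cnt_mul_mul {f g : Fin r → Fin N} {p w v : Perm (Fin r)} (hp : p ∈ stab f)
    (hv : v ∈ stab g) : cnt (f ∘ (p * w * v)) g = cnt (f ∘ w) g := by
  have h1 : f ∘ (p * w * v) = (f ∘ w) ∘ v := funext fun x => hp _
  have h2 : g ∘ v = g := funext hv
  rw [h1, ← cnt_comp_perm (f ∘ w) g v, h2]

/-- Two permutations with the same matrix lie in the same double coset. -/
theorem exists_of_cnt_eq {f g : Fin r → Fin N} {d w : Perm (Fin r)}
    (h : cnt (f ∘ w) g = cnt (f ∘ d) g) : ∃ p ∈ stab f, ∃ v ∈ stab g, w = p * d * v := by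
  have h1 : ∀ t : Fin N × Fin N, Nonempty ({y // (f (w y), g y) = t} ≃ {y // (f (d y), g y) = t}) := by
    rintro ⟨i, j⟩
    rw [← Fintype.card_eq, Fintype.card_subtype, Fintype.card_subtype]
    have := congrFun (congrFun h i) j
    simpa only [cnt, Matrix.of_apply, Function.comp_apply, Prod.mk.injEq] using this
  -- Equal matrices make the fibres of `y ↦ (f (w y), g y)` and `y ↦ (f (d y), g y)` equinumerous.
  -- Gluing bijections between them gives `e` in the stabiliser of `g` with `f ∘ d ∘ e = f ∘ w`,
  -- whence `w = (w e⁻¹ d⁻¹) d e`.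
  let e : Perm (Fin r) := (Equiv.sigmaFiberEquiv fun y => (f (w y), g y)).symm.trans
    ((Equiv.sigmaCongrRight fun t => (h1 t).some).trans
      (Equiv.sigmaFiberEquiv fun y => (f (d y), g y)))
  have he : ∀ y, (f (d (e y)), g (e y)) = (f (w y), g y) := fun y =>
    ((h1 (f (w y), g y)).some ⟨y, rfl⟩).2
  simp only [Prod.mk.injEq] at he
  refine ⟨w * e⁻¹ * d⁻¹, fun x => ?_, e, fun x => (he x).2, by simp [mul_assoc]⟩
  have := (he (e⁻¹ (d⁻¹ x))).1
  simpa using this.symm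

/-- Both colourings count the points other than `x` alike. The identity is written with sums on both
sides, so no subtraction in `ℕ` occurs. -/
theorem cnt_update (f g : Fin r → Fin N) (x : Fin r) (i : Fin N) :
    cnt (Function.update f x i) g + Matrix.single (f x) (g x) 1 =
      cnt f g + Matrix.single i (g x) 1 := by
  classical
  have key : ∀ (f : Fin r → Fin N), cnt f g =
      Matrix.of (fun a b =>
        (((Finset.univ.erase x).filter fun y => f y = a ∧ g y = b)).card) +
        Matrix.single (f x) (g x) 1 := by
    intro f
    ext a b
    simp only [cnt, Matrix.of_apply, Matrix.add_apply, Matrix.single_apply]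
    conv_lhs => rw [← Finset.insert_erase (Finset.mem_univ x), Finset.filter_insert]
    split_ifs with h
    · rw [Finset.card_insert_of_notMem (by simp)]
    · simp
  rw [key f, key (Function.update f x i), add_right_comm, Function.update_self]
  have h : ∀ a b, ((Finset.univ.erase x).filter fun y => Function.update f x i y = a ∧ g y = b) =
      (Finset.univ.erase x).filter fun y => f y = a ∧ g y = b := fun a b =>
    Finset.filter_congr fun y hy => by rw [Function.update_of_ne (Finset.ne_of_mem_erase hy)]
  simp only [h]

end Colours

/-! ### Products and coefficients in the Hecke algebra -/

section HeckeProducts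

variable {R : Type*} [CommRing R] (q : R) {r : ℕ}

theorem len_mul_le (u w : Perm (Fin r)) : len (u * w) ≤ len u + len w := by
  obtain ⟨l, hl, hp, hk⟩ := exists_word _ u rfl
  obtain ⟨l', hl', hp', hk'⟩ := exists_word _ w rfl
  rw [len_eq_card_invs u, len_eq_card_invs w, ← hk, ← hk', ← List.length_append]
  refine Nat.sInf_le ⟨l ++ l', fun s hs => ?_, by simp [hp, hp'], rfl⟩
  rcases List.mem_append.mp hs with h | h
  · exact hl s h
  · exact hl' s h

theorem IsSimple.inv_eq {s : Perm (Fin r)} (hs : IsSimple s) : s⁻¹ = s :=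
  inv_eq_of_mul_eq_one_left hs.mul_self

theorem IsSimple.mul_mul_cancel {s : Perm (Fin r)} (hs : IsSimple s) (w : Perm (Fin r)) :
    s * (s * w) = w := by rw [← mul_assoc, hs.mul_self, one_mul]

theorem IsSimple.len {s : Perm (Fin r)} (hs : IsSimple s) : len s = 1 := by
  obtain ⟨i, j, hij, rfl⟩ := hs
  have h : (1 : Perm (Fin r)) i < (1 : Perm (Fin r)) j := by
    rw [Perm.one_apply, Perm.one_apply, Fin.lt_def]
    omega
  have h1 := card_invs_mul hij 1 h
  rw [one_mul, invs_one] at h1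
  rw [len_eq_card_invs, h1]

theorem IsSimple.len_mul_left_lt_iff {s : Perm (Fin r)} (hs : IsSimple s) (w : Perm (Fin r)) :
    QSchur.len (s * w) < QSchur.len w ↔ ¬ QSchur.len w < QSchur.len (s * w) := by
  have h : (s * w)⁻¹ = w⁻¹ * s := by rw [mul_inv_rev, hs.inv_eq]
  rw [← len_inv (s * w), ← len_inv w, h]
  exact len_mul_lt_iff hs _

theorem T_mul_T_of_len {u w : Perm (Fin r)} (h : len (u * w) = len u + len w) :
    T R q u * T R q w = T R q (u * w) := by
  induction hk : len w using Nat.strong_induction_on generalizing w with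
  | _ k ih =>
    by_cases hw : w = 1
    · rw [hw, mul_one, T_one, mul_one]
    obtain ⟨s, v, hs, rfl, hlt⟩ := exists_right_descent w hw
    have h1 := len_mul_le (u * v) s
    have h2 := len_mul_le u v
    have h3 := len_mul_le v s
    rw [← mul_assoc] at h ⊢
    rw [hs.len] at h1 h3
    have e1 := T_mul_T q hs v
    rw [if_pos hlt] at e1
    have e2 := T_mul_T q hs (u * v)
    rw [if_pos (by omega)] at e2
    rw [← e1, ← mul_assoc, ih _ (hk ▸ hlt) (by omega) rfl, e2]

/-- The left-handed form of `T_mul_T`: at a left descent `T_w = T_s T_{sw}`, and the quadratic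
relation for `T_s` applies. -/
theorem T_simple_mul_T {s : Perm (Fin r)} (hs : IsSimple s) (w : Perm (Fin r)) :
    T R q s * T R q w =
      if len w < len (s * w) then T R q (s * w)
      else (q - 1) • T R q w + q • T R q (s * w) := by
  have key : ∀ w, len w < len (s * w) → T R q s * T R q w = T R q (s * w) := by
    intro w hw
    have h1 := len_mul_le s w
    rw [hs.len] at h1
    exact T_mul_T_of_len q (by rw [hs.len]; omega)
  split_ifs with h
  · exact key w h
  · have h2 : len (s * w) < len (s * (s * w)) := by
      rw [hs.mul_mul_cancel]
      exact (hs.len_mul_left_lt_iff w).mpr h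
    have h3 := key _ h2
    have h4 := T_mul_T q hs s
    rw [hs.mul_self, len_one, hs.len, if_neg (by omega), T_one] at h4
    rw [hs.mul_mul_cancel] at h3
    rw [← h3, ← mul_assoc, h4, add_mul, smul_mul_assoc, smul_mul_assoc, one_mul]

theorem heckeEval_T_apply (v w : Perm (Fin r)) [Decidable (v = w)] :
    heckeEval q (T R q v) w = if v = w then 1 else 0 := by
  rw [heckeEval_T, Finsupp.single_apply]

theorem lhom_ext_T {M : Type*} [AddCommMonoid M] [Module R M] {f g : Hecke R q r →ₗ[R] M}
    (h : ∀ w, f (T R q w) = g (T R q w)) : f = g :=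
  (heckeBasis R q r).ext h

theorem heckeEval_T_simple_mul {s : Perm (Fin r)} (hs : IsSimple s) (Y : Hecke R q r)
    (w : Perm (Fin r)) :
    heckeEval q (T R q s * Y) w =
      if len w < len (s * w) then q * heckeEval q Y (s * w)
      else heckeEval q Y (s * w) + (q - 1) * heckeEval q Y w := by
  classical
  let ev : Perm (Fin r) → Hecke R q r →ₗ[R] R := fun v => Finsupp.lapply v ∘ₗ heckeEval q
  have h : ev w ∘ₗ LinearMap.mulLeft R (T R q s) =
      if len w < len (s * w) then q • ev (s * w) else ev (s * w) + (q - 1) • ev w := by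
    refine lhom_ext_T q fun v => ?_
    have h1 : (ev w ∘ₗ LinearMap.mulLeft R (T R q s)) (T R q v) =
      heckeEval q (T R q s * T R q v) w := rfl
    have e1 : s * v = w ↔ v = s * w := by
      rw [← hs.inv_eq, inv_mul_eq_iff_eq_mul, hs.inv_eq]
    have h2 : ∀ a, ev a (T R q v) = if v = a then 1 else 0 := fun a => heckeEval_T_apply q v a
    have h3 := hs.mul_mul_cancel w
    have h4 := hs.len_mul_left_lt_iff w
    have h5 : s * w ≠ w := fun h => by
      have := congrArg QSchur.len (mul_right_cancel (h.trans (one_mul w).symm))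
      rw [hs.len, len_one] at this
      omega
    rw [h1, T_simple_mul_T q hs]
    by_cases hv : v = w
    · subst hv
      split_ifs <;> simp [h2, heckeEval_T_apply, h5, h5.symm]
    · by_cases hv2 : v = s * w
      · subst hv2
        rw [h3]
        split_ifs <;> first | omega | simp_all [heckeEval_T_apply]
      · split_ifs <;> simp [h2, heckeEval_T_apply, hv, hv2, e1]
  have := LinearMap.congr_fun h Y
  split_ifs at this ⊢ <;> exact this

/-- Along a reduced word, every simple factor of `u⁻¹` lengthens what stands to its right, so each
step falls in the ascending case of `heckeEval_T_simple_mul` and contributes exactly one factor `q`.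
-/
theorem heckeEval_T_mul {u w : Perm (Fin r)} (Y : Hecke R q r)
    (h : len (u⁻¹ * w) = len u + len w) :
    heckeEval q (T R q u * Y) w = q ^ len u * heckeEval q Y (u⁻¹ * w) := by
  induction hk : len u using Nat.strong_induction_on generalizing u Y with
  | _ k ih =>
    by_cases hu : u = 1
    · subst hk
      rw [hu, T_one, len_one, inv_one, one_mul, one_mul, pow_zero, one_mul]
    obtain ⟨s, v, hs, rfl, hlt⟩ := exists_right_descent u hu
    have h1 := len_mul_le v⁻¹ w
    have h2 := len_mul_le s (v⁻¹ * w)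
    have h3 := len_mul_le v s
    rw [mul_inv_rev, hs.inv_eq, mul_assoc] at h ⊢
    rw [len_inv] at h1
    rw [hs.len] at h2 h3
    have e1 := T_mul_T q hs v
    rw [if_pos hlt] at e1
    rw [← e1, mul_assoc, ih _ (hk ▸ hlt) _ (by omega) rfl, heckeEval_T_simple_mul q hs,
      if_pos (by omega), ← mul_assoc, ← pow_succ]
    congr 2
    omega

theorem heckeEval_sum_T (S : Finset (Perm (Fin r))) (w : Perm (Fin r)) :
    heckeEval q (∑ v ∈ S, T R q v) w = if w ∈ S then 1 else 0 := by
  classical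
  rw [map_sum, Finsupp.finsetSum_apply]
  simp only [heckeEval_T_apply, Finset.sum_ite_eq']

theorem T_simple_mul_sum_T {s : Perm (Fin r)} (hs : IsSimple s) {S : Finset (Perm (Fin r))}
    (hS : ∀ w, s * w ∈ S ↔ w ∈ S) :
    T R q s * ∑ v ∈ S, T R q v = q • ∑ v ∈ S, T R q v := by
  apply heckeEval_injective q
  ext w
  rw [heckeEval_T_simple_mul q hs, map_smul, Finsupp.smul_apply, heckeEval_sum_T, heckeEval_sum_T,
    smul_eq_mul]
  simp only [hS]
  split_ifs <;> ring

/-- For `T_s Y = q Y`, the coefficient of `T_w` reads `q` times that of `Y` at `s * w` on one side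
and `q` times that at `w` on the other; cancelling the unit `q` shows that `Y` is constant along
`s`. -/
theorem heckeEval_simple_mul_eq {q : Rˣ} {s : Perm (Fin r)} (hs : IsSimple s)
    {Y : Hecke R (q : R) r}
    (hY : T R (q : R) s * Y = (q : R) • Y) {w : Perm (Fin r)} (hw : len w < len (s * w)) :
    heckeEval (q : R) Y (s * w) = heckeEval (q : R) Y w := by
  have h := heckeEval_T_simple_mul (q : R) hs Y w
  rw [if_pos hw, hY, map_smul, Finsupp.smul_apply, smul_eq_mul] at h
  exact (q.isUnit.mul_left_cancel h).symm

end HeckeProducts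

/-! ### Sums over double cosets -/

section DoubleCosets

variable {R : Type*} [CommRing R] (q : R) {r N : ℕ}

open Classical in
/-- The sum of all `T_w` with `w` in a given set. -/
noncomputable def sumT (S : Set (Perm (Fin r))) : Hecke R q r := ∑ w with w ∈ S, T R q w

/-- A factorisation of all elements of a set with additive lengths factorises the sum. -/
theorem sumT_mul_sumT {S S' S'' : Set (Perm (Fin r))}
    (hmul : ∀ u ∈ S, ∀ v ∈ S', u * v ∈ S'' ∧ len (u * v) = len u + len v)
    (hinj : ∀ u ∈ S, ∀ v ∈ S', ∀ u' ∈ S, ∀ v' ∈ S', u * v = u' * v' → u = u')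
    (hsurj : ∀ w ∈ S'', ∃ u ∈ S, ∃ v ∈ S', w = u * v) :
    sumT q S * sumT q S' = sumT q S'' := by
  classical
  rw [sumT, sumT, sumT, Finset.sum_mul_sum, ← Finset.sum_product']
  refine Finset.sum_bij (fun p _ => p.1 * p.2) ?_ ?_ ?_ ?_
  · rintro ⟨u, v⟩ h
    simp only [Finset.mem_product, Finset.mem_filter, Finset.mem_univ, true_and] at h ⊢
    exact (hmul u h.1 v h.2).1
  · rintro ⟨u, v⟩ h ⟨u', v'⟩ h' he
    simp only [Finset.mem_product, Finset.mem_filter, Finset.mem_univ, true_and] at h h' he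
    have := hinj u h.1 v h.2 u' h'.1 v' h'.2 he
    subst this
    rw [mul_left_cancel he]
  · intro w hw
    simp only [Finset.mem_filter, Finset.mem_univ, true_and] at hw
    obtain ⟨u, hu, v, hv, rfl⟩ := hsurj w hw
    exact ⟨(u, v), by simp [hu, hv], rfl⟩
  · rintro ⟨u, v⟩ h
    simp only [Finset.mem_product, Finset.mem_filter, Finset.mem_univ, true_and] at h
    exact T_mul_T_of_len q (hmul u h.1 v h.2).2

/-- The double coset with a given matrix. -/
def cosetOf (f g : Fin r → Fin N) (A : Matrix (Fin N) (Fin N) ℕ) : Set (Perm (Fin r)) :=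
  {w | cnt (f ∘ w) g = A}

variable {f g : Fin r → Fin N}

theorem mul_mem_cosetOf_iff {A : Matrix (Fin N) (Fin N) ℕ} {p w v : Perm (Fin r)}
    (hp : p ∈ stab f) (hv : v ∈ stab g) : p * w * v ∈ cosetOf f g A ↔ w ∈ cosetOf f g A := by
  change cnt _ _ = A ↔ cnt _ _ = A
  rw [cnt_mul_mul hp hv]

/-- The double coset is a union of left cosets of `stab g`, and each element factors uniquely, with
additive length, through the minimal element of its coset. The left factor here is the `Z_A` by
which `φ_A` multiplies. -/
theorem sumT_cosetOf_eq_mul (hg : Monotone g) (A : Matrix (Fin N) (Fin N) ℕ) :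
    sumT q {u | u ∈ cosetOf f g A ∧ IncOn g u} * sumT q (stab g : Set (Perm (Fin r))) =
      sumT q (cosetOf f g A) := by
  refine sumT_mul_sumT q ?_ ?_ ?_
  · rintro u ⟨hu, hu'⟩ v hv
    refine ⟨?_, len_mul_of_incOn hg hu' hv⟩
    have := mul_mem_cosetOf_iff (A := A) (w := u) (one_mem (stab f)) hv
    rw [one_mul] at this
    exact this.mpr hu
  · rintro u ⟨-, hu⟩ v hv u' ⟨-, hu'⟩ v' hv' h
    exact incOn_unique hg hu hu' (mul_mem hv' (inv_mem hv))
      (by rw [← mul_assoc, ← h, mul_inv_cancel_right])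
  · intro w hw
    obtain ⟨u, p, hu, hp, rfl⟩ := exists_eq_mul_incOn hg w
    refine ⟨u, ⟨?_, hu⟩, p, hp, rfl⟩
    have := mul_mem_cosetOf_iff (A := A) (w := u) (one_mem (stab f)) hp
    rw [one_mul] at this
    exact this.mp hw

/-- The elements `T_{W_λ d W_μ}` are sums over double cosets. -/
theorem stab_mul_T_mul_eq (hf : Monotone f) (hg : Monotone g) {d : Perm (Fin r)}
    (hd : IncOn g d) (hd' : IncOn f d⁻¹) :
    sumT q (stab f : Set (Perm (Fin r))) * (T R q d *
      sumT q {v | v ∈ stab g ∧ ∀ p ∈ stab g, d * p * d⁻¹ ∈ stab f → len v ≤ len (p * v)}) =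
      sumT q (cosetOf f g (cnt (f ∘ d) g)) := by
  -- The lexicographic colouring makes `stab g ∩ d⁻¹ (stab f) d` itself a Young subgroup: `γ` is
  -- monotone because `d` is increasing on the fibres of `g`, and `stab γ` is that intersection.
  let γ : Fin r → Fin N ×ₗ Fin N := fun x => toLex (g x, f (d x))
  have hγ : Monotone γ := by
    intro x y hxy
    rw [Prod.Lex.toLex_le_toLex]
    rcases hxy.eq_or_lt with rfl | hlt
    · exact Or.inr ⟨rfl, le_rfl⟩
    rcases (hg hxy).lt_or_eq with h | h
    · exact Or.inl h
    · exact Or.inr ⟨h, hf (hd _ _ hlt h).le⟩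
  have hstab : ∀ p, p ∈ stab γ ↔ p ∈ stab g ∧ d * p * d⁻¹ ∈ stab f := by
    intro p
    simp only [mem_stab, γ, EmbeddingLike.apply_eq_iff_eq, Prod.mk.injEq, forall_and,
      Perm.mul_apply]
    refine and_congr_right fun _ => ⟨fun h x => ?_, fun h x => ?_⟩
    · rw [h, perm_apply_inv]
    · simpa using h (d x)
  have hset : {v | v ∈ stab g ∧ ∀ p ∈ stab g, d * p * d⁻¹ ∈ stab f → len v ≤ len (p * v)} =
      {v | v ∈ stab g ∧ IncOn γ v⁻¹} := by
    ext v
    refine and_congr_right fun _ => ?_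
    rw [incOn_iff_minimal hγ]
    constructor
    · intro h p hp
      obtain ⟨h1, h2⟩ := (hstab _).mp (inv_mem hp)
      have := h _ h1 h2
      rwa [← len_inv (p⁻¹ * v), mul_inv_rev, inv_inv, ← len_inv v] at this
    · intro h p h1 h2
      have := h _ (inv_mem ((hstab p).mpr ⟨h1, h2⟩))
      rwa [← mul_inv_rev, len_inv, len_inv] at this
  rw [hset]
  have h1 : T R q d = sumT q {d} := by
    classical
    rw [sumT, Finset.sum_filter]
    simp
  -- If `v` is shortest in its right coset of `stab γ`, then `d * v` is shortest in its right coset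
  -- of `stab f`. This gives additivity of lengths in the product with `stab f`.
  have hinc : ∀ v ∈ stab g, IncOn γ v⁻¹ → IncOn f (d * v)⁻¹ := by
    intro v hv hv' x y hxy hc
    have h2 := hd' x y hxy hc
    rw [mul_inv_rev, Perm.mul_apply, Perm.mul_apply]
    by_cases h3 : g (d⁻¹ x) = g (d⁻¹ y)
    · refine hv' _ _ h2 ?_
      simp only [γ, h3, perm_apply_inv, hc]
    · have h4 : g (v⁻¹ (d⁻¹ x)) < g (v⁻¹ (d⁻¹ y)) := by
        rw [inv_mem hv, inv_mem hv]
        exact lt_of_le_of_ne (hg h2.le) h3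
      exact not_le.mp fun h => absurd (hg h) (not_le.mpr h4)
  have h2 : T R q d * sumT q {v | v ∈ stab g ∧ IncOn γ v⁻¹} =
      sumT q {w | ∃ v ∈ stab g, IncOn γ v⁻¹ ∧ w = d * v} := by
    rw [h1]
    refine sumT_mul_sumT q ?_ ?_ ?_
    · rintro _ rfl v ⟨hv, hv'⟩
      exact ⟨⟨v, hv, hv', rfl⟩, len_mul_of_incOn hg hd hv⟩
    · rintro _ rfl v - _ rfl v' - -
      rfl
    · rintro _ ⟨v, hv, hv', rfl⟩
      exact ⟨d, rfl, v, ⟨hv, hv'⟩, rfl⟩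
  rw [h2]
  refine sumT_mul_sumT q ?_ ?_ ?_
  · rintro p hp _ ⟨v, hv, hv', rfl⟩
    refine ⟨?_, len_mul_of_incOn_inv hf (hinc v hv hv') hp⟩
    rw [← mul_assoc, mul_mem_cosetOf_iff hp hv]
    rfl
  · rintro p hp _ ⟨v, hv, hv', rfl⟩ p' hp' _ ⟨v', hv1, hv1', rfl⟩ h
    have h3 : v' * v⁻¹ = d⁻¹ * (p'⁻¹ * p) * d := by
      rw [← mul_right_inj (p' * d), ← mul_left_inj v]
      simp only [mul_assoc, inv_mul_cancel, mul_one, mul_inv_cancel_left] at h ⊢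
      exact h.symm
    have h4 : v' * v⁻¹ ∈ stab γ := by
      rw [hstab]
      refine ⟨mul_mem hv1 (inv_mem hv), ?_⟩
      rw [h3]
      simpa [mul_assoc] using mul_mem (inv_mem hp') hp
    have h5 : v⁻¹ = v'⁻¹ := incOn_unique hγ hv' hv1' h4 (by simp)
    rw [inv_inj.mp h5] at h
    exact mul_right_cancel h
  · intro w hw
    obtain ⟨p, hp, v, hv, rfl⟩ := exists_of_cnt_eq hw
    -- The part `t⁻¹` of `v` that lies in `stab γ` is moved across `d` and absorbed in the factor
    -- from `stab f`.
    obtain ⟨u, t, hu, ht, he⟩ := exists_eq_mul_incOn hγ v⁻¹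
    have h3 := (hstab _).mp (inv_mem ht)
    have h4 : v = t⁻¹ * u⁻¹ := by rw [← mul_inv_rev, ← he, inv_inv]
    refine ⟨p * (d * t⁻¹ * d⁻¹), mul_mem hp h3.2, d * u⁻¹, ⟨u⁻¹, ?_, by rwa [inv_inv], rfl⟩, ?_⟩
    · have : u⁻¹ = t * v := by rw [h4]; simp
      rw [this]
      exact mul_mem ((hstab t).mp ht).1 hv
    · rw [h4]
      simp [mul_assoc]

theorem heckeEval_sumT (S : Set (Perm (Fin r))) (w : Perm (Fin r)) [Decidable (w ∈ S)] :
    heckeEval q (sumT q S) w = if w ∈ S then 1 else 0 := by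
  rw [sumT, heckeEval_sum_T]
  simp

theorem T_simple_mul_sumT {s : Perm (Fin r)} (hs : IsSimple s) {S : Set (Perm (Fin r))}
    (hS : ∀ w, s * w ∈ S ↔ w ∈ S) : T R q s * sumT q S = q • sumT q S :=
  T_simple_mul_sum_T q hs (by simpa using hS)

end DoubleCosets

/-! ### The case `n = 0`: the homomorphisms `φ_A` and their products -/

section SchurAlgebra

variable {R : Type*} [CommRing R] (q : Rˣ) {m r : ℕ}

theorem fixBlocks_eq_bot {N : ℕ} (c : Comp N r) (p : Fin N → Prop) (hp : ∀ i, p i) :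
    fixBlocks c p = ⊥ := by
  rw [eq_bot_iff]
  intro w hw
  rw [Subgroup.mem_bot]
  ext x
  rw [hw (col c x) x (hp _) (mem_block_iff.mpr rfl), Perm.one_apply]

theorem oddPart_eq_bot (c : Comp (m + 0) r) : oddPart c = ⊥ := by
  have h : fixBlocks c (fun i => (i : ℕ) < m) = ⊥ := fixBlocks_eq_bot c _ fun i => i.2
  rw [oddPart, h, inf_bot_eq]

theorem evenPart_eq_stab (c : Comp (m + 0) r) : evenPart c = stab (col c) := by
  rw [evenPart, parabolic_eq_stab, inf_eq_left]
  exact fun w _ i x hi _ => absurd i.2 (not_lt.mpr hi)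

theorem superSum_eq_sumT (c : Comp (m + 0) r) {D : Set (Perm (Fin r))} (hD : 1 ∈ D) :
    superSum q c D = sumT (q : R) {w | w ∈ stab (col c) ∧ w ∈ D} := by
  classical
  rw [superSum, sumT]
  refine Finset.sum_congr ?_ fun w _ => ?_
  · ext w
    simp [evenPart_eq_stab, and_comm]
  · have : (Finset.univ.filter fun w₁ => w₁ ∈ D ∧ w₁ ∈ oddPart c) = {1} := by
      ext w
      simp only [oddPart_eq_bot, Subgroup.mem_bot, Finset.mem_filter, Finset.mem_univ, true_and,
        Finset.mem_singleton, and_iff_right_iff_imp]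
      rintro rfl
      exact hD
    rw [this, Finset.sum_singleton, len_one, pow_zero, Units.val_one, one_smul, T_one, mul_one]

theorem xy_eq_sumT (c : Comp (m + 0) r) :
    xy q c = sumT (q : R) (stab (col c) : Set (Perm (Fin r))) := by
  classical
  have hy : yOdd q c = 1 := by
    rw [yOdd, Finset.sum_eq_single 1]
    · rw [len_one, pow_zero, Units.val_one, one_smul, T_one]
    · intro w hw hw1
      simp only [oddPart_eq_bot, Subgroup.mem_bot, Finset.mem_filter] at hw
      exact absurd hw.2 hw1
    · intro h
      simp [one_mem] at h
  rw [xy, hy, mul_one, xEven, sumT]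
  refine Finset.sum_congr ?_ fun _ _ => rfl
  ext w
  simp [evenPart_eq_stab]

theorem mem_minReps_parabolic_iff {N : ℕ} (c : Comp N r) (d : Perm (Fin r)) :
    d ∈ minReps (parabolic c) ↔ IncOn (col c) d⁻¹ := by
  rw [incOn_iff_minimal (col_monotone c), parabolic_eq_stab]
  constructor
  · intro h p hp
    have := h _ (inv_mem hp)
    rwa [← len_inv (p⁻¹ * d), mul_inv_rev, inv_inv, ← len_inv d] at this
  · intro h p hp
    have := h _ (inv_mem hp)
    rwa [← mul_inv_rev, len_inv, len_inv] at this

/-- The trivial intersection conditions hold automatically because the odd parts are trivial. -/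
theorem mem_superReps_iff (a b : Comp (m + 0) r) (d : Perm (Fin r)) :
    d ∈ superReps a b ↔ IncOn (col b) d ∧ IncOn (col a) d⁻¹ := by
  have : d ∈ superReps a b ↔ d ∈ doubleReps a b := by
    refine ⟨fun h => h.1, fun h => ⟨h, ?_, ?_⟩⟩
    · rw [oddPart_eq_bot, inf_bot_eq]
    · rw [oddPart_eq_bot, conjBy, Subgroup.map_bot, bot_inf_eq]
  rw [this]
  change d ∈ minReps (parabolic a) ∧ d⁻¹ ∈ minReps (parabolic b) ↔ _
  rw [mem_minReps_parabolic_iff, mem_minReps_parabolic_iff, inv_inv, and_comm]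

theorem doubleCosetElt_eq_sumT {a b : Comp (m + 0) r} {d : Perm (Fin r)} (hd : d ∈ superReps a b) :
    doubleCosetElt q a d b =
      sumT (q : R) (cosetOf (col a) (col b) (cosetMatrix a d b)) := by
  obtain ⟨h1, h2⟩ := (mem_superReps_iff a b d).mp hd
  rw [doubleCosetElt, xy_eq_sumT, superSum_eq_sumT, cosetMatrix_eq_cnt,
    ← stab_mul_T_mul_eq _ (col_monotone a) (col_monotone b) h1 h2]
  · congr 3
    ext v
    change v ∈ stab (col b) ∧ (∀ w ∈ _, len v ≤ len (w * v)) ∧ v ∈ parabolic b ↔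
      v ∈ stab (col b) ∧ _
    rw [parabolic_eq_stab b]
    refine and_congr_right fun hv => ?_
    simp only [hv, and_true, conjBy, Subgroup.mem_inf, Subgroup.mem_map, parabolic_eq_stab]
    constructor
    · intro h p hp hp'
      exact h p ⟨⟨_, hp', by simp [mul_assoc]⟩, hp⟩
    · rintro h p ⟨⟨p', hp', rfl⟩, hp⟩
      exact h _ hp (by simpa [mul_assoc] using hp')
  · refine ⟨fun w _ => ?_, one_mem _⟩
    rw [len_one]
    exact Nat.zero_le _

/-- Every matrix of a permutation is the matrix of a minimal double coset representative. -/
theorem cosetMatrix_mem_superMatrices (a b : Comp (m + 0) r) (w : Perm (Fin r)) :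
    cosetMatrix a w b ∈ superMatrices m 0 r := by
  classical
  -- A shortest element of the whole double coset is in particular shortest in both of its one-sided
  -- cosets.
  obtain ⟨d, hd, hmin⟩ := Finset.exists_min_image
    (Finset.univ.filter (· ∈ cosetOf (col a) (col b) (cosetMatrix a w b))) len
    ⟨w, by simp [cosetOf, cosetMatrix_eq_cnt]⟩
  simp only [Finset.mem_filter, Finset.mem_univ, true_and] at hd hmin
  refine ⟨a, b, d, (mem_superReps_iff a b d).mpr ⟨?_, ?_⟩, ?_⟩
  · rw [incOn_iff_minimal (col_monotone b)]
    intro p hp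
    refine hmin _ ?_
    have := (mul_mem_cosetOf_iff (A := cosetMatrix a w b) (w := d)
      (one_mem (stab (col a))) hp).mpr hd
    rwa [one_mul] at this
  · rw [incOn_iff_minimal (col_monotone a)]
    intro p hp
    rw [len_inv, ← len_inv (_ * _), mul_inv_rev, inv_inv]
    refine hmin _ ?_
    have := (mul_mem_cosetOf_iff (A := cosetMatrix a w b) (w := d) (inv_mem hp)
      (one_mem (stab (col b)))).mpr hd
    rwa [mul_one] at this
  · rw [cosetMatrix_eq_cnt a b d]
    exact hd.symm

/-- The row and column sums of `A` determine both compositions, so the existential data in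
`superMatrices` and `IsPhi` can be fixed in advance. -/
theorem exists_mem_superReps {a b : Comp (m + 0) r} {A : Matrix (Fin (m + 0)) (Fin (m + 0)) ℕ}
    (hA : A ∈ superMatrices m 0 r) (ha : ∀ i, ∑ j, A i j = a.1 i) (hb : ∀ j, ∑ i, A i j = b.1 j) :
    ∃ d ∈ superReps a b, A = cosetMatrix a d b := by
  obtain ⟨a', b', d, hd, rfl⟩ := hA
  have h1 : a' = a := Subtype.ext (funext fun i => by rw [← ha, cosetMatrix_row_sum])
  have h2 : b' = b := Subtype.ext (funext fun i => by rw [← hb, cosetMatrix_col_sum])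
  subst h1 h2
  exact ⟨d, hd, rfl⟩

/-- Left multiplication in the Hecke algebra as a homomorphism of right modules. -/
noncomputable def leftMulHom (Z : Hecke R (q : R) r) :
    Hecke R (q : R) r →ₗ[(Hecke R (q : R) r)ᵐᵒᵖ] Hecke R (q : R) r where
  toFun x := Z * x
  map_add' := mul_add Z
  map_smul' h x := (mul_assoc Z x h.unop).symm

theorem mem_xyIdeal_iff (c : Comp (m + 0) r) (x : Hecke R (q : R) r) :
    x ∈ xyIdeal q c ↔ ∃ h, x = xy q c * h := by
  rw [Submodule.mem_span_singleton]
  exact ⟨fun ⟨h, hh⟩ => ⟨h.unop, hh.symm⟩, fun ⟨h, hh⟩ => ⟨MulOpposite.op h, hh.symm⟩⟩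

open Classical in
-- Project to the summand of `b`, multiply by `Z` on the left and include in the summand of `a`;
-- left multiplication commutes with the right action.
theorem exists_schurAlg (a b : Comp (m + 0) r) (Z : Hecke R (q : R) r)
    (hZ : ∀ h, Z * xy q b * h ∈ xyIdeal q a) :
    ∃ f : SchurAlg q m 0 r, ∀ (c : Comp (m + 0) r) (h : Hecke R (q : R) r),
      f (incl q c ⟨xy q c * h, xy_mul_mem q c h⟩) =
        if c = b then incl q a ⟨Z * xy q b * h, hZ h⟩ else 0 := by
  have h0 : ∀ x ∈ xyIdeal q b, leftMulHom q Z x ∈ xyIdeal q a := by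
    intro x hx
    obtain ⟨h, rfl⟩ := (mem_xyIdeal_iff q b x).mp hx
    have := hZ h
    rwa [mul_assoc] at this
  refine ⟨incl q a ∘ₗ (leftMulHom q Z).restrict h0 ∘ₗ
    DirectSum.component (Hecke R (q : R) r)ᵐᵒᵖ (Comp (m + 0) r) (fun c => xyIdeal q c) b, ?_⟩
  intro c h
  simp only [LinearMap.comp_apply]
  split_ifs with hc
  · subst hc
    rw [DirectSum.component.lof_self]
    exact congrArg _ (Subtype.ext (mul_assoc _ _ _).symm)
  · have : DirectSum.component (Hecke R (q : R) r)ᵐᵒᵖ (Comp (m + 0) r) (fun c => xyIdeal q c) b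
      (incl q c ⟨xy q c * h, xy_mul_mem q c h⟩) = 0 := by
      rw [DirectSum.component.of, dif_neg hc]
    rw [this, map_zero, map_zero]

theorem schurAlg_ext {f g : SchurAlg q m 0 r} (H : ∀ (c : Comp (m + 0) r) (h : Hecke R (q : R) r),
    f (incl q c ⟨xy q c * h, xy_mul_mem q c h⟩) = g (incl q c ⟨xy q c * h, xy_mul_mem q c h⟩)) :
    f = g := by
  refine DirectSum.linearMap_ext _ fun c => LinearMap.ext fun ⟨x, hx⟩ => ?_
  obtain ⟨h, rfl⟩ := (mem_xyIdeal_iff q c x).mp hx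
  exact H c h

theorem sumT_cosetOf_mul_mem {a b : Comp (m + 0) r} {A : Matrix (Fin (m + 0)) (Fin (m + 0)) ℕ}
    (hA : A ∈ superMatrices m 0 r) (ha : ∀ i, ∑ j, A i j = a.1 i) (hb : ∀ j, ∑ i, A i j = b.1 j)
    (h : Hecke R (q : R) r) :
    sumT (q : R) (cosetOf (col a) (col b) A) * h ∈ xyIdeal q a := by
  obtain ⟨d, hd, rfl⟩ := exists_mem_superReps hA ha hb
  rw [← doubleCosetElt_eq_sumT q hd]
  exact doubleCosetElt_mul_mem q a d b h

open Classical in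
theorem isPhi_iff {a b : Comp (m + 0) r} {A : Matrix (Fin (m + 0)) (Fin (m + 0)) ℕ}
    (hA : A ∈ superMatrices m 0 r) (ha : ∀ i, ∑ j, A i j = a.1 i) (hb : ∀ j, ∑ i, A i j = b.1 j)
    (f : SchurAlg q m 0 r) :
    IsPhi q A f ↔ ∀ (c : Comp (m + 0) r) (h : Hecke R (q : R) r),
      f (incl q c ⟨xy q c * h, xy_mul_mem q c h⟩) =
        if c = b then incl q a ⟨sumT (q : R) (cosetOf (col a) (col b) A) * h,
          sumT_cosetOf_mul_mem q hA ha hb h⟩ else 0 := by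
  constructor
  · rintro ⟨a', b', d, hd, rfl, H⟩ c h
    have h1 : a' = a := Subtype.ext (funext fun i => by rw [← ha, cosetMatrix_row_sum])
    have h2 : b' = b := Subtype.ext (funext fun i => by rw [← hb, cosetMatrix_col_sum])
    subst h1 h2
    rw [H]
    simp only [doubleCosetElt_eq_sumT q hd]
  · intro H
    obtain ⟨d, hd, rfl⟩ := exists_mem_superReps hA ha hb
    refine ⟨a, b, d, hd, rfl, fun c h => ?_⟩
    rw [H]
    simp only [doubleCosetElt_eq_sumT q hd]

theorem exists_comp_of_mem {A : Matrix (Fin (m + 0)) (Fin (m + 0)) ℕ}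
    (hA : A ∈ superMatrices m 0 r) : ∃ a b : Comp (m + 0) r,
      (∀ i, ∑ j, A i j = a.1 i) ∧ ∀ j, ∑ i, A i j = b.1 j := by
  obtain ⟨a, b, d, -, rfl⟩ := hA
  exact ⟨a, b, cosetMatrix_row_sum a b d, cosetMatrix_col_sum a b d⟩

/-- Existence rests on the factorisation of the double coset sum as `Z * xy q b`: left
multiplication by `Z` is automatically well defined on the right ideal. Uniqueness holds since the
elements `xy q c * h` exhaust each summand. -/
theorem existsUnique_isPhi {A : Matrix (Fin (m + 0)) (Fin (m + 0)) ℕ}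
    (hA : A ∈ superMatrices m 0 r) : ∃! f : SchurAlg q m 0 r, IsPhi q A f := by
  obtain ⟨a, b, ha, hb⟩ := exists_comp_of_mem hA
  have h1 := sumT_cosetOf_eq_mul (q : R) (f := col a) (col_monotone b) A
  rw [← xy_eq_sumT] at h1
  obtain ⟨f, hf⟩ := exists_schurAlg q a b _ (h1 ▸ sumT_cosetOf_mul_mem q hA ha hb)
  refine ⟨f, (isPhi_iff q hA ha hb f).mpr fun c h => ?_, fun g hg => schurAlg_ext q fun c h => ?_⟩
  · rw [hf]
    simp only [h1]
  · rw [(isPhi_iff q hA ha hb g).mp hg, hf]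
    simp only [h1]

theorem phi_isPhi {A : Matrix (Fin (m + 0)) (Fin (m + 0)) ℕ} (hA : A ∈ superMatrices m 0 r) :
    IsPhi q A (phi q m 0 r A) := by
  have h : ∃ f : SchurAlg q m 0 r, IsPhi q A f := (existsUnique_isPhi q hA).exists
  rw [phi, dif_pos h]
  exact h.choose_spec

theorem smul_mem_xyIdeal (t : R) {c : Comp (m + 0) r} {x : Hecke R (q : R) r}
    (hx : x ∈ xyIdeal q c) : t • x ∈ xyIdeal q c := by
  obtain ⟨h, rfl⟩ := (mem_xyIdeal_iff q c x).mp hx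
  rw [← mul_smul_comm]
  exact xy_mul_mem q c _

theorem smul_incl (t : R) (c : Comp (m + 0) r) (x : xyIdeal q c) :
    t • incl q c x = incl q c ⟨t • x.1, smul_mem_xyIdeal q t x.2⟩ := by
  rw [← LinearMap.map_smul_of_tower]
  rfl

theorem smul_schurAlg_apply (t : R) (f : SchurAlg q m 0 r) (x : TensorSpace q m 0 r) :
    (t • f) x = t • f x := rfl

/-- Products of the `φ_A` are determined by identities in the Hecke algebra. -/
theorem phi_mul_phi {ι : Type*} {a l b : Comp (m + 0) r}
    {A D : Matrix (Fin (m + 0)) (Fin (m + 0)) ℕ}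
    (hD : D ∈ superMatrices m 0 r) (hDa : ∀ i, ∑ j, D i j = a.1 i)
    (hDl : ∀ j, ∑ i, D i j = l.1 j)
    (hA : A ∈ superMatrices m 0 r) (hAl : ∀ i, ∑ j, A i j = l.1 i)
    (hAb : ∀ j, ∑ i, A i j = b.1 j)
    (s : Finset ι) (B : ι → Matrix (Fin (m + 0)) (Fin (m + 0)) ℕ) (t : ι → R)
    (hB : ∀ k ∈ s, B k ∈ superMatrices m 0 r) (hBa : ∀ k ∈ s, ∀ i, ∑ j, B k i j = a.1 i)
    (hBb : ∀ k ∈ s, ∀ j, ∑ i, B k i j = b.1 j)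
    (hprod : sumT (q : R) {u | u ∈ cosetOf (col a) (col l) D ∧ IncOn (col l) u} *
      sumT (q : R) (cosetOf (col l) (col b) A) =
        ∑ k ∈ s, t k • sumT (q : R) (cosetOf (col a) (col b) (B k))) :
    phi q m 0 r D * phi q m 0 r A = ∑ k ∈ s, t k • phi q m 0 r (B k) := by
  classical
  refine schurAlg_ext q fun c h => ?_
  rw [Module.End.mul_apply, (isPhi_iff q hA hAl hAb _).mp (phi_isPhi q hA), LinearMap.sum_apply]
  have h1 : ∀ k ∈ s, (t k • phi q m 0 r (B k)) (incl q c ⟨xy q c * h, xy_mul_mem q c h⟩) =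
      t k • if hk : k ∈ s then (if c = b then
        incl q a ⟨sumT (q : R) (cosetOf (col a) (col b) (B k)) * h,
          sumT_cosetOf_mul_mem q (hB k hk) (hBa k hk) (hBb k hk) h⟩ else 0) else 0 := by
    intro k hk
    rw [smul_schurAlg_apply,
      (isPhi_iff q (hB k hk) (hBa k hk) (hBb k hk) _).mp (phi_isPhi q (hB k hk)), dif_pos hk]
  rw [Finset.sum_congr rfl h1]
  split_ifs with hc
  -- Write the image under `φ_A` as `x_l g`. Since `φ_D` sends it to `sumT C_D * g = Z_D * x_l * g`,
  -- the result is `Z_D * sumT C_A * h`, to which `hprod` applies.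
  · obtain ⟨g, hg⟩ := (mem_xyIdeal_iff q l _).mp (sumT_cosetOf_mul_mem q hA hAl hAb h)
    have h2 : sumT (q : R) (cosetOf (col a) (col l) D) * g =
        ∑ k ∈ s, t k • (sumT (q : R) (cosetOf (col a) (col b) (B k)) * h) := by
      rw [← sumT_cosetOf_eq_mul _ (col_monotone l), mul_assoc, ← xy_eq_sumT, ← hg, ← mul_assoc,
        hprod, Finset.sum_mul]
      exact Finset.sum_congr rfl fun _ _ => smul_mul_assoc _ _ _
    simp only [hg]
    rw [(isPhi_iff q hD hDa hDl _).mp (phi_isPhi q hD), if_pos rfl]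
    -- Membership in the ideal is known only for `k ∈ s`; outside `s` the value `0` is a dummy.
    let y : ι → xyIdeal q a := fun k =>
      if hk : k ∈ s then ⟨t k • (sumT (q : R) (cosetOf (col a) (col b) (B k)) * h),
        smul_mem_xyIdeal q _ (sumT_cosetOf_mul_mem q (hB k hk) (hBa k hk) (hBb k hk) h)⟩ else 0
    have h3 : (∑ k ∈ s, y k : xyIdeal q a) = ⟨sumT (q : R) (cosetOf (col a) (col l) D) * g,
        sumT_cosetOf_mul_mem q hD hDa hDl g⟩ := by
      refine Subtype.ext ?_
      refine Eq.trans ?_ h2.symm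
      rw [AddSubmonoidClass.coe_finsetSum]
      refine Finset.sum_congr rfl fun k hk => ?_
      simp only [y, dif_pos hk]
    rw [← h3, map_sum]
    refine Finset.sum_congr rfl fun k hk => ?_
    simp only [y, dif_pos hk]
    rw [smul_incl]
  · rw [map_zero]
    refine (Finset.sum_eq_zero fun k hk => ?_).symm
    simp

end SchurAlgebra

/-! ### Cyclic permutations of intervals -/

section Shuttle

variable {r : ℕ}

/-- The cyclic permutation of the interval between `p` and `i` that sends `p` to `i`. -/
theorem exists_shuttle (p i : Fin r) : ∃ u : Perm (Fin r), u p = i ∧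
    ∀ x, x ≠ p → (u x : ℕ) =
      if (x : ℕ) < p then (if (x : ℕ) < i then (x : ℕ) else (x : ℕ) + 1)
      else (if (x : ℕ) ≤ i then (x : ℕ) - 1 else (x : ℕ)) := by
  rcases r with _ | r
  · exact p.elim0
  -- Deleting `p` from the source and `i` from the target leaves two chains of `r` elements, which
  -- are matched in increasing order.
  refine ⟨(finSuccEquiv' p).trans (finSuccEquiv' i).symm, by simp, fun x hx => ?_⟩
  obtain ⟨y, rfl⟩ := Fin.exists_succAbove_eq hx
  rw [Equiv.trans_apply, finSuccEquiv'_succAbove, finSuccEquiv'_symm_some]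
  simp only [Fin.succAbove, Fin.lt_def, Fin.val_castSucc]
  split_ifs <;> simp only [Fin.val_castSucc, Fin.val_succ] at * <;> omega

/-- The cyclic permutation of the interval between `p` and `i` that sends `p` to `i`. -/
noncomputable def shuttle (p i : Fin r) : Perm (Fin r) := (exists_shuttle p i).choose

theorem shuttle_self (p i : Fin r) : shuttle p i p = i := (exists_shuttle p i).choose_spec.1

theorem shuttle_val (p i x : Fin r) (hx : x ≠ p) : (shuttle p i x : ℕ) =
      if (x : ℕ) < p then (if (x : ℕ) < i then (x : ℕ) else (x : ℕ) + 1)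
      else (if (x : ℕ) ≤ i then (x : ℕ) - 1 else (x : ℕ)) :=
  (exists_shuttle p i).choose_spec.2 x hx

theorem shuttle_lt {p i x y : Fin r} (hx : x ≠ p) (hy : y ≠ p) (h : x < y) :
    shuttle p i x < shuttle p i y := by
  rw [Fin.lt_def, shuttle_val p i x hx, shuttle_val p i y hy]
  rw [Fin.lt_def] at h
  rw [ne_eq, Fin.ext_iff] at hx hy
  split_ifs <;> omega

/-- Only points between `p` and `i` move, they stay in that interval, and `f` is constant on it. -/
theorem shuttle_mem_stab {α : Type*} [LinearOrder α] {f : Fin r → α} (hf : Monotone f)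
    {p i : Fin r} (h : f i = f p) : shuttle p i ∈ stab f := by
  intro x
  by_cases hx : x = p
  · rw [hx, shuttle_self, h]
  have hv := shuttle_val p i x hx
  have hx' : (x : ℕ) ≠ p := fun h => hx (Fin.ext h)
  have key : ∀ y z : Fin r, y ≤ z → f y = f z → y ≤ x → x ≤ z → y ≤ shuttle p i x →
      shuttle p i x ≤ z → f (shuttle p i x) = f x := fun y z hyz hc h1 h2 h3 h4 =>
    (le_antisymm (hc ▸ hf h4) (hf h3)).trans (le_antisymm (hf h1) (hc ▸ hf h2))
  by_cases h1 : (shuttle p i x : ℕ) = x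
  · rw [Fin.ext h1]
  · rcases le_total p i with hpi | hpi
    · refine key p i hpi h.symm ?_ ?_ ?_ ?_ <;> rw [Fin.le_def] at * <;> split_ifs at hv <;> omega
    · refine key i p hpi h ?_ ?_ ?_ ?_ <;> rw [Fin.le_def] at * <;> split_ifs at hv <;> omega

/-- The inversions are the pairs formed by `p` and each other point of the interval. The sum of two
truncated differences is `|p - i|`. -/
theorem len_shuttle (p i : Fin r) : len (shuttle p i) = (p - i : ℕ) + (i - p : ℕ) := by
  rw [len_eq_card_invs]
  have h1 : invs (shuttle p i) = (Finset.Ico i p) ×ˢ {p} ∪ {p} ×ˢ (Finset.Ioc p i) := by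
    ext ⟨x, y⟩
    rw [mem_invs]
    simp only [Finset.mem_union, Finset.mem_product, Finset.mem_Ico, Finset.mem_singleton,
      Finset.mem_Ioc]
    by_cases hx : x = p
    · subst hx
      by_cases hy : y = x
      · subst hy
        simp
      · have := shuttle_val x i y hy
        rw [shuttle_self]
        simp only [Fin.lt_def, Fin.le_def, Fin.ext_iff, true_and] at *
        split_ifs at this <;> omega
    · by_cases hy : y = p
      · subst hy
        have := shuttle_val y i x hx
        rw [shuttle_self]
        simp only [Fin.lt_def, Fin.le_def, Fin.ext_iff, and_true] at *
        split_ifs at this <;> omega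
      · simp only [hx, hy, and_false, false_and, or_false, iff_false, not_and, not_lt]
        exact fun h => (shuttle_lt hx hy h).le
  rw [h1, Finset.card_union_of_disjoint]
  · simp
  · rw [Finset.disjoint_left]
    rintro ⟨x, y⟩
    simp only [Finset.mem_product, Finset.mem_Ico, Finset.mem_singleton, Finset.mem_Ioc]
    rintro ⟨⟨-, h⟩, -⟩ ⟨rfl, -⟩
    exact lt_irrefl _ h

end Shuttle

/-! ### Multiplication by an elementary double coset -/

section Elementary

variable {r N : ℕ} {f f' g : Fin r → Fin N} {p : Fin r} {H H' : Fin N}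

theorem shift_add_single {A : Matrix (Fin N) (Fin N) ℕ} (hH : H ≠ H') {k : Fin N}
    (hk : 1 ≤ A H' k) :
    shift A H H' k + Matrix.single H' k 1 = A + Matrix.single H k 1 := by
  ext x y
  simp only [shift, Matrix.add_apply, Matrix.sub_apply, Matrix.single_apply]
  by_cases h : H' = x ∧ k = y
  · obtain ⟨rfl, rfl⟩ := h
    simp only [hH, false_and, and_self, if_true, if_false]
    omega
  · simp only [h, if_false]
    omega

/-- The additive form contains the positivity condition on `A H' k`, so it can replace `shift` and
its truncated subtraction throughout. -/
theorem eq_shift_iff {A B : Matrix (Fin N) (Fin N) ℕ} (hH : H ≠ H') {k : Fin N} :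
    B + Matrix.single H' k 1 = A + Matrix.single H k 1 ↔ 1 ≤ A H' k ∧ B = shift A H H' k := by
  constructor
  · intro h
    have h1 : 1 ≤ A H' k := by
      have := congrFun (congrFun h H') k
      simp only [Matrix.add_apply, Matrix.single_apply, hH, and_self, if_true, false_and,
        if_false] at this
      omega
    exact ⟨h1, add_right_cancel (h.trans (shift_add_single hH h1).symm)⟩
  · rintro ⟨h1, rfl⟩
    exact shift_add_single hH h1

/-- The colourings `f` and `f'` differ at `p` only, where `f` has the value `H'` and `f'` has the
value `H`. -/
structure Recolour (f f' : Fin r → Fin N) (p : Fin r) (H H' : Fin N) : Prop where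
  mono : Monotone f
  mono' : Monotone f'
  ne : H ≠ H'
  apply_self : f p = H'
  eq_update : f' = Function.update f p H

namespace Recolour

variable (hff : Recolour f f' p H H')
include hff

theorem apply_self' : f' p = H := by rw [hff.eq_update, Function.update_self]

theorem apply_ne {x : Fin r} (hx : x ≠ p) : f' x = f x := by
  rw [hff.eq_update, Function.update_of_ne hx]

theorem shuttle_mem {i : Fin r} (hi : f' i = H) : shuttle p i ∈ stab f' :=
  shuttle_mem_stab hff.mono' (hi.trans hff.apply_self'.symm)

/-- Away from `p` a shuttle is increasing. A pair in a fibre of `f` that involves `p` is separated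
by `f'`, which is monotone and preserved by the shuttle, so its order is kept as well. -/
theorem incOn_shuttle {i : Fin r} (hi : f' i = H) : IncOn f (shuttle p i) := by
  have h0 := hff.shuttle_mem hi
  have key : ∀ x y, x < y → f' x ≠ f' y → shuttle p i x < shuttle p i y := by
    intro x y hxy hc
    by_contra h
    have h1 := hff.mono' (not_lt.mp h)
    rw [h0, h0] at h1
    exact hc (le_antisymm (hff.mono' hxy.le) h1)
  intro x y hxy hc
  by_cases hx : x = p
  · have hy : y ≠ p := fun h => by rw [hx, h] at hxy; exact lt_irrefl _ hxy
    refine key x y hxy ?_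
    rw [hff.apply_ne hy, ← hc, hx, hff.apply_self', hff.apply_self]
    exact hff.ne
  by_cases hy : y = p
  · refine key x y hxy ?_
    rw [hff.apply_ne hx, hc, hy, hff.apply_self', hff.apply_self]
    exact hff.ne.symm
  exact shuttle_lt hx hy hxy

theorem apply_shuttle_inv {i : Fin r} (hi : f' i = H) (x : Fin r) :
    f ((shuttle p i)⁻¹ x) = Function.update f' i H' x := by
  by_cases hx : x = i
  · rw [hx, Function.update_self, ← hff.apply_self]
    congr 1
    rw [Perm.inv_eq_iff_eq, shuttle_self]
  · have h1 : (shuttle p i)⁻¹ x ≠ p := by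
      rw [ne_eq, Perm.inv_eq_iff_eq, shuttle_self]
      exact hx
    rw [Function.update_of_ne hx, ← hff.apply_ne h1, inv_mem (hff.shuttle_mem hi)]

/-- The double coset in question is that of the identity. An element `w * v` of it, with `w ∈ stab
f'` and `v ∈ stab f`, lies in the left coset of `stab f` that contains the shuttle from `p` to `w
p`, and minimal representatives are unique. -/
theorem sumT_incOn_eq_sum_shuttle {R : Type*} [CommRing R] (q : R) :
    sumT q {u | u ∈ cosetOf f' f (cnt f' f) ∧ IncOn f u} =
      ∑ i with f' i = H, T R q (shuttle p i) := by
  classical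
  rw [sumT]
  symm
  refine Finset.sum_bij (fun i _ => shuttle p i) ?_ ?_ ?_ fun _ _ => rfl
  · intro i hi
    simp only [Finset.mem_filter, Finset.mem_univ, true_and] at hi ⊢
    refine ⟨?_, hff.incOn_shuttle hi⟩
    have : f' ∘ shuttle p i = f' := funext (hff.shuttle_mem hi)
    change cnt (f' ∘ shuttle p i) f = _
    rw [this]
  · intro i _ j _ h
    rw [← shuttle_self p i, h, shuttle_self]
  · intro u hu
    simp only [Finset.mem_filter, Finset.mem_univ, true_and] at hu
    obtain ⟨hu1, hu2⟩ := hu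
    obtain ⟨w, hw, v, hv, he⟩ := exists_of_cnt_eq (f := f') (g := f) (d := 1) hu1
    rw [mul_one] at he
    have hi : f' (w p) = H := (hw p).trans hff.apply_self'
    refine ⟨w p, by simpa using hi, ?_⟩
    have h1 : (shuttle p (w p))⁻¹ * w ∈ stab f := by
      intro x
      rw [Perm.mul_apply, hff.apply_shuttle_inv hi]
      by_cases hx : x = p
      · rw [hx, Function.update_self, hff.apply_self]
      · rw [Function.update_of_ne (w.injective.ne hx), hw, hff.apply_ne hx]
    refine (incOn_unique hff.mono hu2 (hff.incOn_shuttle hi) (mul_mem h1 hv) ?_).symm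
    rw [he]
    simp [mul_assoc]

theorem cnt_shuttle_inv {i : Fin r} (hi : f' i = H) (w : Perm (Fin r)) :
    cnt (f ∘ ((shuttle p i)⁻¹ * w)) g + Matrix.single H (g (w⁻¹ i)) 1 =
      cnt (f' ∘ w) g + Matrix.single H' (g (w⁻¹ i)) 1 := by
  rw [← cnt_update (f' ∘ w) g (w⁻¹ i) H']
  have h1 : f ∘ ((shuttle p i)⁻¹ * w) = Function.update (f' ∘ w) (w⁻¹ i) H' := by
    funext y
    rw [Function.comp_apply, Perm.mul_apply, hff.apply_shuttle_inv hi]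
    by_cases hy : y = w⁻¹ i
    · rw [hy, perm_apply_inv, Function.update_self, Function.update_self]
    · have : w y ≠ i := fun h => hy (by rw [← h]; simp)
      rw [Function.update_of_ne hy, Function.update_of_ne this, Function.comp_apply]
  rw [h1, Function.comp_apply, perm_apply_inv, hi]

/-- The product formula, with coefficients expressed as sums over a fibre. -/
theorem sumT_mul_sumT {R : Type*} [CommRing R] (q : Rˣ) {A : Matrix (Fin N) (Fin N) ℕ}
    (hA : ∃ x, sumT (q : R) (cosetOf f g A) = sumT (q : R) (stab f : Set (Perm (Fin r))) * x)
    (t : Fin N → R)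
    (ht : ∀ w, IncOn f' w⁻¹ → ∀ k,
      cnt (f' ∘ w) g + Matrix.single H' k 1 = A + Matrix.single H k 1 →
      ∑ i with f' i = H ∧ g (w⁻¹ i) = k, (q : R) ^ ((p - i : ℕ) + (i - p : ℕ)) = t k) :
    sumT (q : R) {u | u ∈ cosetOf f' f (cnt f' f) ∧ IncOn f u} *
      sumT (q : R) (cosetOf f g A) =
        ∑ k with 1 ≤ A H' k, t k • sumT (q : R) (cosetOf f' g (shift A H H' k)) := by
  classical
  have hinv : ∀ s : Perm (Fin r), s ∈ stab f' → ∀ h B w,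
      s * w ∈ cosetOf f' h B ↔ w ∈ cosetOf f' h B := by
    intro s hs h B w
    have := mul_mem_cosetOf_iff (A := B) (w := w) hs (one_mem (stab h))
    rwa [mul_one] at this
  have hL : ∀ s, IsSimple s → s ∈ stab f' → ∀ w, len w < len (s * w) →
      heckeEval (q : R) (sumT (q : R) {u | u ∈ cosetOf f' f (cnt f' f) ∧ IncOn f u} *
        sumT (q : R) (cosetOf f g A)) (s * w) =
      heckeEval (q : R) (sumT (q : R) {u | u ∈ cosetOf f' f (cnt f' f) ∧ IncOn f u} *
        sumT (q : R) (cosetOf f g A)) w := by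
    intro s hs hs' w hw
    refine heckeEval_simple_mul_eq hs ?_ hw
    obtain ⟨x, hx⟩ := hA
    -- The sum of minimal representatives alone need not be an eigenvector of `T_s`. Multiplied by
    -- the sum over `stab f`, which `hA` splits off from the second factor, it becomes the sum over
    -- a full double coset, where `T_s` acts as `q`.
    rw [hx, ← mul_assoc _ _ x, sumT_cosetOf_eq_mul _ hff.mono, ← mul_assoc,
      T_simple_mul_sumT _ hs fun w => hinv s hs' _ _ w, smul_mul_assoc]
  have hR : ∀ w, heckeEval (q : R)
      (∑ k with 1 ≤ A H' k, t k • sumT (q : R) (cosetOf f' g (shift A H H' k))) w =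
      ∑ k with 1 ≤ A H' k, t k * if w ∈ cosetOf f' g (shift A H H' k) then 1 else 0 := by
    intro w
    rw [map_sum, Finsupp.finsetSum_apply]
    refine Finset.sum_congr rfl fun k _ => ?_
    rw [map_smul, Finsupp.smul_apply, smul_eq_mul, heckeEval_sumT]
  apply heckeEval_injective (q : R)
  ext w
  -- Both sides are constant along simple reflections in `stab f'`, so only minimal `w` remain. For
  -- those, multiplication by the inverse shuttle is additive in length and `heckeEval_T_mul` gives
  -- each coefficient.
  induction w using induction_incOn_inv hff.mono' with
  | hs s w hs hs' hlt ih =>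
    rw [hL s hs hs' w hlt, ih, hR, hR]
    simp only [hinv s hs']
  | hmin w hw =>
    rw [hR, hff.sumT_incOn_eq_sum_shuttle, Finset.sum_mul, map_sum, Finsupp.finsetSum_apply]
    have h1 : ∀ i ∈ Finset.univ.filter (fun i => f' i = H),
        heckeEval (q : R) (T R (q : R) (shuttle p i) * sumT (q : R) (cosetOf f g A)) w =
          if cnt (f' ∘ w) g + Matrix.single H' (g (w⁻¹ i)) 1 = A + Matrix.single H (g (w⁻¹ i)) 1
          then (q : R) ^ ((p - i : ℕ) + (i - p : ℕ)) else 0 := by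
      intro i hi
      simp only [Finset.mem_filter, Finset.mem_univ, true_and] at hi
      have h2 := hff.shuttle_mem hi
      rw [heckeEval_T_mul, heckeEval_sumT, len_shuttle]
      · have h3 : (shuttle p i)⁻¹ * w ∈ cosetOf f g A ↔
            cnt (f' ∘ w) g + Matrix.single H' (g (w⁻¹ i)) 1 =
              A + Matrix.single H (g (w⁻¹ i)) 1 := by
          rw [← hff.cnt_shuttle_inv hi, add_left_inj]
          rfl
        simp only [h3, mul_ite, mul_one, mul_zero]
      · rw [len_mul_of_incOn_inv hff.mono' hw (inv_mem h2), len_inv]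
    -- The condition on `i` involves only its column `g (w⁻¹ i)`, so the sum over the block is
    -- grouped by columns.
    rw [Finset.sum_congr rfl h1,
      ← Finset.sum_fiberwise_of_maps_to (g := fun i => g (w⁻¹ i)) (t := Finset.univ) (by simp),
      Finset.sum_filter]
    refine Finset.sum_congr rfl fun k _ => ?_
    have h2 := eq_shift_iff (A := A) (B := cnt (f' ∘ w) g) hff.ne (k := k)
    rw [Finset.filter_filter]
    have h3 : ∀ i ∈ Finset.univ.filter (fun i => f' i = H ∧ g (w⁻¹ i) = k),
        (if cnt (f' ∘ w) g + Matrix.single H' (g (w⁻¹ i)) 1 = A + Matrix.single H (g (w⁻¹ i)) 1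
          then (q : R) ^ ((p - i : ℕ) + (i - p : ℕ)) else 0) =
        if 1 ≤ A H' k ∧ cnt (f' ∘ w) g = shift A H H' k
          then (q : R) ^ ((p - i : ℕ) + (i - p : ℕ)) else 0 := by
      intro i hi
      simp only [Finset.mem_filter, Finset.mem_univ, true_and] at hi
      rw [hi.2]
      simp only [h2]
    rw [Finset.sum_congr rfl h3]
    by_cases h4 : 1 ≤ A H' k ∧ cnt (f' ∘ w) g = shift A H H' k
    · simp only [h4.1, h4.2, cosetOf, and_self, if_true, Set.mem_ofPred_eq, mul_one]
      exact ht w hw k (h2.mpr h4)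
    · simp only [h4, if_false, Finset.sum_const_zero]
      rcases not_and_or.mp h4 with h5 | h5
      · rw [if_neg h5]
      · simp [cosetOf, h5]

end Recolour

end Elementary

/-! ### Generating functions for positions in a monotonically coloured set -/

section Counting

variable {α β R : Type*} [LinearOrder α] [LinearOrder β] [Fintype β] [CommSemiring R] (x : R)

/-- The number of later elements takes each of the values `0, …, S.card - 1` once. -/
theorem sum_pow_card_filter_lt (S : Finset α) :
    ∑ i ∈ S, x ^ (S.filter fun j => i < j).card = gauss S.card x := by
  induction S using Finset.induction_on_min with
  | empty => simp [gauss]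
  | insert a S ha ih =>
    have h1 : a ∉ S := fun h => lt_irrefl _ (ha a h)
    rw [Finset.sum_insert h1, Finset.card_insert_of_notMem h1, gauss, Finset.sum_range_succ,
      ← gauss, ← ih, add_comm]
    congr 1
    · refine Finset.sum_congr rfl fun i hi => ?_
      rw [Finset.filter_insert, if_neg (not_lt.mpr (ha i hi).le)]
    · rw [Finset.filter_insert, if_neg (lt_irrefl _), Finset.filter_true_of_mem ha]

/-- The elements of `S` after a point of colour `k` are all those of larger colour, a fixed number,
and the later ones of colour `k`. -/
theorem sum_pow_card_filter_lt_fiber (S : Finset α) (K : α → β) (hK : MonotoneOn K S) (k : β) :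
    ∑ i ∈ S with K i = k, x ^ (S.filter fun j => i < j).card =
      x ^ (∑ b with k < b, (S.filter fun j => K j = b).card) *
        gauss (S.filter fun j => K j = k).card x := by
  rw [← sum_pow_card_filter_lt, Finset.mul_sum]
  refine Finset.sum_congr rfl fun i hi => ?_
  rw [Finset.mem_filter] at hi
  rw [← pow_add]
  congr 1
  have h1 : S.filter (fun j => i < j) =
      (S.filter fun j => k < K j) ∪ ((S.filter fun j => K j = k).filter fun j => i < j) := by
    ext j
    simp only [Finset.mem_filter, Finset.mem_union]
    constructor
    · rintro ⟨hj, hlt⟩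
      rcases (hK hi.1 hj hlt.le).lt_or_eq with h | h
      · exact Or.inl ⟨hj, hi.2 ▸ h⟩
      · exact Or.inr ⟨⟨hj, h.symm.trans hi.2⟩, hlt⟩
    · rintro (⟨hj, hlt⟩ | ⟨⟨hj, -⟩, hlt⟩)
      · refine ⟨hj, not_le.mp fun h => ?_⟩
        have := hK hj hi.1 h
        rw [hi.2] at this
        exact absurd hlt (not_lt.mpr this)
      · exact ⟨hj, hlt⟩
  rw [h1, Finset.card_union_of_disjoint]
  · congr 1
    rw [Finset.card_eq_sum_card_fiberwise (f := K) (t := Finset.univ.filter fun b => k < b)]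
    · refine Finset.sum_congr rfl fun b hb => ?_
      rw [Finset.filter_filter]
      congr 1
      refine Finset.filter_congr fun j _ => ?_
      simp only [Finset.mem_filter, Finset.mem_univ, true_and] at hb
      exact ⟨fun h => h.2, fun h => ⟨h ▸ hb, h⟩⟩
    · intro j hj
      simpa using (Finset.mem_filter.mp hj).2
  · rw [Finset.disjoint_left]
    intro j
    simp only [Finset.mem_filter]
    rintro ⟨-, h⟩ ⟨⟨-, h'⟩, -⟩
    exact absurd h' h.ne'

theorem sum_pow_card_filter_gt_fiber (S : Finset α) (K : α → β) (hK : MonotoneOn K S) (k : β) :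
    ∑ i ∈ S with K i = k, x ^ (S.filter fun j => j < i).card =
      x ^ (∑ b with b < k, (S.filter fun j => K j = b).card) *
        gauss (S.filter fun j => K j = k).card x :=
  sum_pow_card_filter_lt_fiber (α := αᵒᵈ) (β := βᵒᵈ) x S K
    (fun _ hi _ hj h => hK hj hi h) k

end Counting

/-! ### Adjacent blocks and the multiplication formulas for `φ_A` -/

section Adjacent

variable {N r : ℕ}

theorem Recolour.symm {f f' : Fin r → Fin N} {p : Fin r} {H H' : Fin N}
    (h : Recolour f f' p H H') : Recolour f' f p H' H where
  mono := h.mono'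
  mono' := h.mono
  ne := h.ne.symm
  apply_self := h.apply_self'
  eq_update := by
    rw [h.eq_update, Function.update_idem, ← h.apply_self, Function.update_eq_self]

/-- Moving the boundary between two adjacent blocks by one recolours one point. -/
theorem exists_recolour {l a : Comp N r} {h h' : Fin N} (hh : (h' : ℕ) = h + 1)
    (ha : ∀ i, a.1 i + (if i = h' then 1 else 0) = l.1 i + if i = h then 1 else 0) :
    ∃ p, Recolour (col l) (col a) p h h' := by
  have hne : h ≠ h' := by rintro rfl; omega
  have hsum : ∀ s : Finset (Fin N), ∑ j ∈ s, a.1 j + (if h' ∈ s then 1 else 0) =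
      ∑ j ∈ s, l.1 j + if h ∈ s then 1 else 0 := by
    intro s
    have := Finset.sum_congr (rfl : s = s) fun i _ => ha i
    simpa only [Finset.sum_add_distrib, Finset.sum_ite_eq'] using this
  have h1 : 1 ≤ l.1 h' := by
    have := ha h'
    simp only [if_true, if_neg hne.symm] at this
    omega
  -- The recoloured point is the first point of block `h'` of `l`, which becomes the last point of
  -- block `h` of `a`. By `hsum`, the partial sums of `a` and `l` agree except at this boundary,
  -- where they differ by one.
  obtain ⟨p, hp⟩ : ∃ p : Fin r, (p : ℕ) = ∑ j with j < h', l.1 j := by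
    have h2 : ∑ j ∈ insert h' (Finset.univ.filter fun j => j < h'), l.1 j ≤ ∑ j, l.1 j :=
      Finset.sum_le_sum_of_subset (Finset.subset_univ _)
    rw [l.2, Finset.sum_insert (by simp)] at h2
    exact ⟨⟨∑ j with j < h', l.1 j, by omega⟩, rfl⟩
  have hle : ∀ i : Fin N, ∑ j with j ≤ i, l.1 j = ∑ j with j < i, l.1 j + l.1 i := by
    intro i
    have : (Finset.univ.filter fun j => j ≤ i) =
        insert i (Finset.univ.filter fun j => j < i) := by
      ext j
      simp [le_iff_eq_or_lt]
    rw [this, Finset.sum_insert (by simp), add_comm]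
  have hpred : (Finset.univ.filter fun j => j < h') = Finset.univ.filter fun j => j ≤ h := by
    ext j
    simp only [Finset.mem_filter, Finset.mem_univ, true_and, Fin.lt_def, Fin.le_def]
    omega
  have hpl : col l p = h' := mem_block_iff.mp ⟨hp.ge, by rw [hle]; omega⟩
  refine ⟨p, col_monotone l, col_monotone a, hne, hpl, funext fun x => ?_⟩
  by_cases hx : x = p
  · subst hx
    rw [Function.update_self]
    refine mem_block_iff.mp ⟨?_, ?_⟩
    · have h2 := hsum (Finset.univ.filter fun j => j < h)
      have h3 := hle h
      simp only [Finset.mem_filter, Finset.mem_univ, true_and, Fin.lt_def, lt_irrefl, if_false,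
        hh] at h2
      rw [if_neg (by omega)] at h2
      rw [hpred] at hp
      simp only [Fin.lt_def] at *
      omega
    · have h2 := hsum (Finset.univ.filter fun j => j ≤ h)
      simp only [Finset.mem_filter, Finset.mem_univ, true_and, le_refl, if_true] at h2
      rw [if_neg (by rw [Fin.le_def]; omega)] at h2
      rw [hpred] at hp
      omega
  · rw [Function.update_of_ne hx]
    obtain ⟨h2, h3⟩ := mem_block_iff.mpr (rfl : col l x = col l x)
    have hx' : (x : ℕ) ≠ p := fun h => hx (Fin.ext h)
    refine mem_block_iff.mp ⟨?_, ?_⟩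
    · have h4 := hsum (Finset.univ.filter fun j => j < col l x)
      simp only [Finset.mem_filter, Finset.mem_univ, true_and] at h4
      by_cases hc : col l x = h'
      · rw [hc] at h2 h4 ⊢
        rw [if_neg (lt_irrefl _), if_pos (by rw [Fin.lt_def]; omega)] at h4
        omega
      · rw [Fin.ext_iff] at hc
        have h5 : h < col l x ↔ h' < col l x := by rw [Fin.lt_def, Fin.lt_def]; omega
        simp only [h5] at h4
        omega
    · have h4 := hsum (Finset.univ.filter fun j => j ≤ col l x)
      simp only [Finset.mem_filter, Finset.mem_univ, true_and] at h4
      by_cases hc : h' ≤ col l x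
      · rw [if_pos hc, if_pos (by rw [Fin.le_def] at *; omega)] at h4
        omega
      · rw [if_neg hc] at h4
        omega

theorem cnt_self_col (l : Comp N r) : cnt (col l) (col l) = Matrix.diagonal l.1 := by
  ext i j
  rw [Matrix.diagonal_apply, ← card_col l i]
  simp only [cnt, Matrix.of_apply]
  split_ifs with h
  · subst h
    simp only [and_self]
  · rw [Finset.card_eq_zero, Finset.filter_eq_empty_iff]
    rintro x - ⟨h1, h2⟩
    exact h (h1.symm.trans h2)

theorem Recolour.cnt_col {l a : Comp N r} {p : Fin r} {H H' : Fin N}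
    (hla : Recolour (col l) (col a) p H H') :
    cnt (col a) (col l) + Matrix.single H' H' 1 = Matrix.diagonal l.1 + Matrix.single H H' 1 := by
  have := cnt_update (col l) (col l) p H
  rwa [← hla.eq_update, hla.apply_self, cnt_self_col] at this

/-- Take a point `y` counted in the entry `(H', k)`. A transposition in the parabolic subgroup of
`l` arranges that `y` is sent to `p`, and recolouring `p` then moves exactly this point to the entry
`(H, k)`. -/
theorem Recolour.exists_shift_eq {l a b : Comp N r} {p : Fin r} {H H' : Fin N}
    (hla : Recolour (col l) (col a) p H H') {d : Perm (Fin r)} {k : Fin N}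
    (hk : 1 ≤ cosetMatrix l d b H' k) :
    ∃ w, shift (cosetMatrix l d b) H H' k = cosetMatrix a w b := by
  simp only [cosetMatrix_eq_cnt] at hk ⊢
  obtain ⟨y, hy⟩ : (Finset.univ.filter fun y => (col l ∘ d) y = H' ∧ col b y = k).Nonempty :=
    Finset.card_pos.mp hk
  simp only [Function.comp_apply, Finset.mem_filter, Finset.mem_univ, true_and] at hy
  have hs : swap (d y) p ∈ stab (col l) := swap_mem_stab (hy.1.trans hla.apply_self.symm)
  refine ⟨swap (d y) p * d, ?_⟩
  have h1 := cnt_update (col l ∘ (swap (d y) p * d)) (col b) y H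
  have h2 : Function.update (col l ∘ (swap (d y) p * d)) y H = col a ∘ (swap (d y) p * d) := by
    funext x
    by_cases hx : x = y
    · rw [hx, Function.update_self]
      simp [hla.apply_self']
    · rw [Function.update_of_ne hx, Function.comp_apply, Function.comp_apply, hla.apply_ne]
      intro h
      rw [Perm.mul_apply] at h
      exact hx (d.injective ((swap (d y) p).injective (h.trans (swap_apply_left _ _).symm)))
  have h3 := cnt_mul_mul (w := d) hs (one_mem (stab (col b)))
  rw [mul_one] at h3
  rw [h2, h3, hy.2, Function.comp_apply, Perm.mul_apply, swap_apply_left, hla.apply_self] at h1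
  exact ((eq_shift_iff hla.ne).mp h1).2.symm

/-- The condition on column sums determines the diagonal of `D`: it is that of `l`, less one at
`H'`. -/
theorem IsElementary.add_single {A D : Matrix (Fin N) (Fin N) ℕ} {l : Fin N → ℕ} {H H' : Fin N}
    (hE : IsElementary A D H H') (hAl : ∀ i, ∑ j, A i j = l i) :
    D + Matrix.single H' H' 1 = Matrix.diagonal l + Matrix.single H H' 1 := by
  obtain ⟨⟨c, rfl⟩, h2⟩ := hE
  have hl : ∀ i, l i = c i + if i = H' then 1 else 0 := by
    intro i
    rw [← hAl, ← h2]
    simp [Finset.sum_add_distrib, Matrix.diagonal_apply, Matrix.single_apply, ite_and, eq_comm]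
  rw [add_right_comm]
  congr 1
  ext i j
  rw [Matrix.add_apply, Matrix.diagonal_apply, Matrix.diagonal_apply, Matrix.single_apply, hl]
  by_cases h : i = j
  · subst h
    simp [eq_comm]
  · have : ¬ (H' = i ∧ H' = j) := fun hc => h (hc.1.symm.trans hc.2)
    simp [h, this]

theorem sum_single_apply (H k i : Fin N) :
    ∑ j, (Matrix.single H k 1 : Matrix (Fin N) (Fin N) ℕ) i j = if i = H then 1 else 0 := by
  simp [Matrix.single_apply, ite_and, eq_comm]

theorem IsElementary.row_add {A D : Matrix (Fin N) (Fin N) ℕ} {l a : Fin N → ℕ} {H H' : Fin N}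
    (hE : IsElementary A D H H') (hAl : ∀ i, ∑ j, A i j = l i) (hDa : ∀ i, ∑ j, D i j = a i)
    (i : Fin N) : a i + (if i = H' then 1 else 0) = l i + if i = H then 1 else 0 := by
  have h : ∑ j, (D + Matrix.single H' H' 1 : Matrix (Fin N) (Fin N) ℕ) i j =
      ∑ j, (Matrix.diagonal l + Matrix.single H H' 1 : Matrix (Fin N) (Fin N) ℕ) i j := by
    rw [hE.add_single hAl]
  simp only [Matrix.add_apply, Finset.sum_add_distrib, sum_single_apply, hDa] at h
  simpa [Matrix.diagonal_apply] using h

theorem shift_row_sum {A : Matrix (Fin N) (Fin N) ℕ} {l a : Comp N r} {H H' k : Fin N}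
    (hne : H ≠ H')
    (ha : ∀ i, a.1 i + (if i = H' then 1 else 0) = l.1 i + if i = H then 1 else 0)
    (hAl : ∀ i, ∑ j, A i j = l.1 i) (hk : 1 ≤ A H' k) (i : Fin N) :
    ∑ j, shift A H H' k i j = a.1 i := by
  have h1 : ∑ j, (shift A H H' k + Matrix.single H' k 1 : Matrix (Fin N) (Fin N) ℕ) i j =
      ∑ j, (A + Matrix.single H k 1 : Matrix (Fin N) (Fin N) ℕ) i j := by rw [shift_add_single hne hk]
  simp only [Matrix.add_apply, Finset.sum_add_distrib, hAl] at h1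
  rw [sum_single_apply, sum_single_apply, ← ha i] at h1
  exact Nat.add_right_cancel h1

theorem shift_col_sum {A : Matrix (Fin N) (Fin N) ℕ} {H H' k : Fin N}
    (hne : H ≠ H') (hk : 1 ≤ A H' k) (j : Fin N) :
    ∑ i, shift A H H' k i j = ∑ i, A i j := by
  have h1 : ∑ i, (shift A H H' k + Matrix.single H' k 1 : Matrix (Fin N) (Fin N) ℕ) i j =
      ∑ i, (A + Matrix.single H k 1 : Matrix (Fin N) (Fin N) ℕ) i j := by rw [shift_add_single hne hk]
  simp only [Matrix.add_apply, Finset.sum_add_distrib] at h1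
  have h2 : ∀ H : Fin N, ∑ i, (Matrix.single H k 1 : Matrix (Fin N) (Fin N) ℕ) i j =
      if k = j then 1 else 0 := by
    intro H
    simp [Matrix.single_apply, ite_and]
  rw [h2, h2] at h1
  exact Nat.add_right_cancel h1

/-- The existence of a recolouring for both kinds of adjacent indices. -/
theorem exists_recolour_of_adjacent {l a : Comp N r} {H H' : Fin N}
    (hh : (H' : ℕ) = H + 1 ∨ (H : ℕ) = H' + 1)
    (ha : ∀ i, a.1 i + (if i = H' then 1 else 0) = l.1 i + if i = H then 1 else 0) :
    ∃ p, Recolour (col l) (col a) p H H' := by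
  rcases hh with hh | hh
  · exact exists_recolour hh ha
  · obtain ⟨p, hp⟩ := exists_recolour hh fun i => (ha i).symm
    exact ⟨p, hp.symm⟩

theorem shift_mem_superMatrices {m : ℕ} {A : Matrix (Fin (m + 0)) (Fin (m + 0)) ℕ}
    (hA : A ∈ superMatrices m 0 r) {H H' k : Fin (m + 0)}
    (hh : (H' : ℕ) = H + 1 ∨ (H : ℕ) = H' + 1) (hk : 1 ≤ A H' k) :
    shift A H H' k ∈ superMatrices m 0 r := by
  obtain ⟨l, b, d, -, rfl⟩ := hA
  have hne : H ≠ H' := by rintro rfl; omega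
  have h1 : 1 ≤ l.1 H' := by
    rw [← cosetMatrix_row_sum l b d H']
    exact hk.trans (Finset.single_le_sum (f := cosetMatrix l d b H') (fun _ _ => Nat.zero_le _)
      (Finset.mem_univ k))
  -- These are the row sums of the shifted matrix; the truncated subtraction is harmless because
  -- `h1` gives a point in row `H'`.
  let c : Fin (m + 0) → ℕ := fun i =>
    l.1 i + (if i = H then 1 else 0) - if i = H' then 1 else 0
  have hc : ∀ i, c i + (if i = H' then 1 else 0) = l.1 i + if i = H then 1 else 0 := by
    intro i
    simp only [c]
    refine Nat.sub_add_cancel ?_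
    split_ifs with h2 <;> first | (subst h2; omega) | omega
  have hcs : ∑ i, c i = r := by
    have h2 := Finset.sum_congr (rfl : Finset.univ = Finset.univ) fun i _ => hc i
    simp only [Finset.sum_add_distrib, Finset.sum_ite_eq', Finset.mem_univ, if_true, l.2] at h2
    omega
  obtain ⟨p, hp⟩ := exists_recolour_of_adjacent (l := l) (a := ⟨c, hcs⟩) hh hc
  obtain ⟨w, hw⟩ := hp.exists_shift_eq hk
  rw [hw]
  exact cosetMatrix_mem_superMatrices _ b w

/-- Both multiplication formulas reduce to the sum in `ht`, taken over a block whose points carry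
weakly increasing column labels `K`. The two kinds of matrices differ only in the end of the block
at which `p` lies. -/
theorem phi_mul_phi_of_isElementary {R : Type*} [CommRing R] (q : Rˣ) {m : ℕ}
    {A D : Matrix (Fin (m + 0)) (Fin (m + 0)) ℕ} (hA : A ∈ superMatrices m 0 r)
    (hD : D ∈ superMatrices m 0 r) {H H' : Fin (m + 0)}
    (hh : (H' : ℕ) = H + 1 ∨ (H : ℕ) = H' + 1) (hE : IsElementary A D H H')
    (t : Fin (m + 0) → R)
    (ht : ∀ (f f' K : Fin r → Fin (m + 0)) (p : Fin r) (k : Fin (m + 0)),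
      Recolour f f' p H H' → MonotoneOn K {i | f' i = H} →
      (∀ j, (Finset.univ.filter fun i => f' i = H ∧ K i = j).card =
        A H j + if j = k then 1 else 0) →
      ∑ i with f' i = H ∧ K i = k, (q : R) ^ ((p - i : ℕ) + (i - p : ℕ)) = t k) :
    phi q m 0 r D * phi q m 0 r A =
      ∑ k with 1 ≤ A H' k, t k • phi q m 0 r (shift A H H' k) := by
  obtain ⟨l, b, hAl, hAb⟩ := exists_comp_of_mem hA
  obtain ⟨a, l', hDa, hDl'⟩ := exists_comp_of_mem hD
  have hDl : ∀ j, ∑ i, D i j = l.1 j := fun j => by rw [hE.2, hAl]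
  have ha := hE.row_add hAl hDa
  obtain ⟨p, hp⟩ := exists_recolour_of_adjacent hh ha
  have hDc : D = cnt (col a) (col l) := add_right_cancel ((hE.add_single hAl).trans hp.cnt_col.symm)
  refine phi_mul_phi q hD hDa hDl hA hAl hAb _ _ t
    (fun k hk => shift_mem_superMatrices hA hh (by simpa using hk))
    (fun k hk => shift_row_sum hp.ne ha hAl (by simpa using hk))
    (fun k hk j => by rw [shift_col_sum hp.ne (by simpa using hk), hAb]) ?_
  rw [hDc]
  refine hp.sumT_mul_sumT q ?_ t fun w hw k hB => ?_
  · have := sumT_cosetOf_mul_mem q hA hAl hAb 1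
    rw [mul_one, mem_xyIdeal_iff] at this
    obtain ⟨x, hx⟩ := this
    exact ⟨x, by rw [hx, xy_eq_sumT]⟩
  -- The label of `i` is its column under `w`. Labels increase along the block because `w⁻¹` does,
  -- and they are counted by row `H` of the matrix of `w`, which is that of `A` with one more entry
  -- in column `k`.
  · refine ht (col l) (col a) (fun i => col b (w⁻¹ i)) p k hp ?_ fun j => ?_
    · intro x hx y hy hxy
      rcases hxy.eq_or_lt with rfl | hlt
      · exact le_rfl
      · exact col_monotone b (hw _ _ hlt (Eq.trans hx (Eq.symm hy))).le
    · have h1 := congrFun (congrFun hB H) j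
      simp only [Matrix.add_apply, Matrix.single_apply, hp.ne.symm, false_and, if_false, add_zero,
        true_and] at h1
      simp only [eq_comm (a := j)]
      rw [← h1]
      simp only [cnt, Matrix.of_apply]
      refine (Finset.card_equiv w fun y => ?_).symm
      simp

/-- Here `p` is the last point of the enlarged block `h`, so its distance from `i` is the number of
points of the block after `i`. -/
theorem phi_mul_phi_plus {R : Type*} [CommRing R] (q : Rˣ) {m : ℕ}
    {A D : Matrix (Fin (m + 0)) (Fin (m + 0)) ℕ} (hA : A ∈ superMatrices m 0 r)
    (hD : D ∈ superMatrices m 0 r) {h h' : Fin (m + 0)} (hh : (h' : ℕ) = h + 1)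
    (hE : IsElementary A D h h') :
    phi q m 0 r D * phi q m 0 r A =
      ∑ k with 1 ≤ A h' k, ((q : R) ^ (∑ j with k < j, A h j) * gauss (A h k + 1) (q : R)) •
        phi q m 0 r (shift A h h' k) := by
  refine phi_mul_phi_of_isElementary q hA hD (Or.inl hh) hE _ ?_
  intro f f' K p k hff hK hcard
  have h1 := sum_pow_card_filter_lt_fiber (q : R) (Finset.univ.filter fun i => f' i = h) K
    (by simpa using hK) k
  simp only [Finset.filter_filter, hcard, if_true] at h1
  have h2 : ∑ j with k < j, (A h j + if j = k then 1 else 0) = ∑ j with k < j, A h j := by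
    refine Finset.sum_congr rfl fun j hj => ?_
    rw [if_neg (Finset.mem_filter.mp hj).2.ne', add_zero]
  rw [h2] at h1
  rw [← h1]
  refine Finset.sum_congr rfl fun i hi => ?_
  congr 1
  simp only [Finset.mem_filter, Finset.mem_univ, true_and] at hi
  have hmax : ∀ x, f' x = h → x ≤ p := by
    intro x hx
    by_contra hlt
    rw [not_le] at hlt
    have h3 := hff.mono hlt.le
    rw [hff.apply_self, ← hff.apply_ne hlt.ne', hx, Fin.le_def] at h3
    omega
  have h3 : (Finset.univ.filter fun j => f' j = h ∧ i < j) = Finset.Ioc i p := by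
    ext j
    simp only [Finset.mem_filter, Finset.mem_univ, true_and, Finset.mem_Ioc]
    refine ⟨fun hj => ⟨hj.2, hmax j hj.1⟩, fun hj => ⟨?_, hj.1⟩⟩
    have h4 := hff.mono' hj.1.le
    have h5 := hff.mono' hj.2
    rw [hi.1] at h4
    rw [hff.apply_self'] at h5
    exact le_antisymm h5 h4
  have h4 := Fin.le_def.mp (hmax i hi.1)
  rw [h3, Fin.card_Ioc]
  omega

/-- Here `p` is the first point of the enlarged block `h'`, so its distance from `i` is the number
of points of the block before `i`. -/
theorem phi_mul_phi_minus {R : Type*} [CommRing R] (q : Rˣ) {m : ℕ}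
    {A D : Matrix (Fin (m + 0)) (Fin (m + 0)) ℕ} (hA : A ∈ superMatrices m 0 r)
    (hD : D ∈ superMatrices m 0 r) {h h' : Fin (m + 0)} (hh : (h' : ℕ) = h + 1)
    (hE : IsElementary A D h' h) :
    phi q m 0 r D * phi q m 0 r A =
      ∑ k with 1 ≤ A h k, ((q : R) ^ (∑ j with j < k, A h' j) * gauss (A h' k + 1) (q : R)) •
        phi q m 0 r (shift A h' h k) := by
  refine phi_mul_phi_of_isElementary q hA hD (Or.inr hh) hE _ ?_
  intro f f' K p k hff hK hcard
  have h1 := sum_pow_card_filter_gt_fiber (q : R) (Finset.univ.filter fun i => f' i = h') K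
    (by simpa using hK) k
  simp only [Finset.filter_filter, hcard, if_true] at h1
  have h2 : ∑ j with j < k, (A h' j + if j = k then 1 else 0) = ∑ j with j < k, A h' j := by
    refine Finset.sum_congr rfl fun j hj => ?_
    rw [if_neg (Finset.mem_filter.mp hj).2.ne, add_zero]
  rw [h2] at h1
  rw [← h1]
  refine Finset.sum_congr rfl fun i hi => ?_
  congr 1
  simp only [Finset.mem_filter, Finset.mem_univ, true_and] at hi
  have hmin : ∀ x, f' x = h' → p ≤ x := by
    intro x hx
    by_contra hlt
    rw [not_le] at hlt
    have h3 := hff.mono hlt.le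
    rw [hff.apply_self, ← hff.apply_ne hlt.ne, hx, Fin.le_def] at h3
    omega
  have h3 : (Finset.univ.filter fun j => f' j = h' ∧ j < i) = Finset.Ico p i := by
    ext j
    simp only [Finset.mem_filter, Finset.mem_univ, true_and, Finset.mem_Ico]
    refine ⟨fun hj => ⟨hmin j hj.1, hj.2⟩, fun hj => ⟨?_, hj.2⟩⟩
    have h4 := hff.mono' hj.1
    have h5 := hff.mono' hj.2.le
    rw [hi.1] at h5
    rw [hff.apply_self'] at h4
    exact le_antisymm h5 h4
  have h4 := Fin.le_def.mp (hmin i hi.1)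
  rw [h3, Fin.card_Ico]
  omega

end Adjacent

/-! ### Comparison of the coefficients at `n = 0` -/

section Coefficients

theorem aeval_gauss {S : Type*} [Semiring S] [Algebra ℤ S] (x : S) (k : ℕ) :
    Polynomial.aeval x (gauss k (Polynomial.X : Polynomial ℤ)) = gauss k x := by
  simp [gauss]

theorem superCoeffPlus_eq {m : ℕ} (A : Matrix (Fin (m + 0)) (Fin (m + 0)) ℕ)
    (h h' k : Fin (m + 0)) : superCoeffPlus m 0 A h h' k =
      (qZ : LaurentPolynomial ℤ) ^ (∑ j with k < j, A h j) * gauss (A h k + 1) (qZ : LaurentPolynomial ℤ) := by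
  have h1 : (h : ℕ) < m := h.2
  have h2 : (h' : ℕ) < m := h'.2
  rw [superCoeffPlus, qDot, qDdot, qIdx, if_pos h2, if_pos h1, if_pos h1, one_pow, one_mul]

theorem superCoeffMinus_eq {m : ℕ} (A : Matrix (Fin (m + 0)) (Fin (m + 0)) ℕ)
    (h h' k : Fin (m + 0)) : superCoeffMinus m 0 A h h' k =
      (qZ : LaurentPolynomial ℤ) ^ (∑ j with j < k, A h' j) * gauss (A h' k + 1) (qZ : LaurentPolynomial ℤ) := by
  have h1 : (h : ℕ) < m := h.2
  have h2 : (h' : ℕ) < m := h'.2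
  rw [superCoeffMinus, qDot, qDdot, qIdx, if_pos h1, if_pos h2, if_pos h2, one_pow, one_mul]

theorem superCoeffPlus_eq_aeval {m : ℕ} (A : Matrix (Fin (m + 0)) (Fin (m + 0)) ℕ)
    (h h' k : Fin (m + 0)) : superCoeffPlus m 0 A h h' k =
      Polynomial.aeval (qZ : LaurentPolynomial ℤ) (blmCoeffPlus A h k) := by
  rw [superCoeffPlus_eq, blmCoeffPlus, map_mul, map_pow, Polynomial.aeval_X, aeval_gauss]

theorem superCoeffMinus_eq_aeval {m : ℕ} (A : Matrix (Fin (m + 0)) (Fin (m + 0)) ℕ)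
    (h h' k : Fin (m + 0)) : superCoeffMinus m 0 A h h' k =
      Polynomial.aeval (qZ : LaurentPolynomial ℤ) (blmCoeffMinus A h' k) := by
  rw [superCoeffMinus_eq, blmCoeffMinus, map_mul, map_pow, Polynomial.aeval_X, aeval_gauss]

end Coefficients

open Module

/-! ### Counting covers and hyperplanes over a finite field -/

section Subspaces

variable {K V : Type*} [Field K] [AddCommGroup V] [Module K V]

theorem finrank_sup_span_singleton [FiniteDimensional K V] {A : Submodule K V} {v : V} (hv : v ∉ A) :
    finrank K ↥(K ∙ v ⊔ A) = finrank K A + 1 := by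
  have h0 : v ≠ 0 := fun h => hv (h ▸ A.zero_mem)
  have h1 := Submodule.finrank_sup_add_finrank_inf_eq (K ∙ v) A
  have h2 : K ∙ v ⊓ A = ⊥ := by
    rw [eq_bot_iff]
    rintro x ⟨hx, hxA⟩
    obtain ⟨c, rfl⟩ := Submodule.mem_span_singleton.mp hx
    by_cases hc : c = 0
    · simp [hc]
    · exact absurd ((A.smul_mem_iff hc).mp hxA) hv
  rw [h2, finrank_bot, finrank_span_singleton h0] at h1
  omega

theorem eq_sup_span_of_covBy {A L : Submodule K V} (h : A ⋖ L) {v : V} (hvL : v ∈ L)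
    (hv : v ∉ A) : K ∙ v ⊔ A = L := by
  have h1 : K ∙ v ⊔ A ≤ L := sup_le ((Submodule.span_singleton_le_iff_mem v L).mpr hvL) h.le
  refine (h.eq_or_eq le_sup_right h1).resolve_left fun h2 => hv ?_
  rw [← h2]
  exact Submodule.mem_sup_left (Submodule.mem_span_singleton_self v)

variable [FiniteDimensional K V]

theorem finrank_of_covBy {A L : Submodule K V} (h : A ⋖ L) : finrank K L = finrank K A + 1 := by
  obtain ⟨v, hvL, hv⟩ := SetLike.exists_of_lt h.lt
  rw [← eq_sup_span_of_covBy h hvL hv, finrank_sup_span_singleton hv]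

theorem covBy_of_finrank {A L : Submodule K V} (h : A ≤ L) (hr : finrank K L = finrank K A + 1) :
    A ⋖ L := by
  obtain ⟨v, hvL, hv⟩ := SetLike.exists_of_lt (lt_of_le_of_ne h fun he => by rw [he] at hr; omega)
  have h1 : K ∙ v ⊔ A ≤ L := sup_le ((Submodule.span_singleton_le_iff_mem v L).mpr hvL) h
  rw [← Submodule.eq_of_le_of_finrank_eq h1 (by rw [finrank_sup_span_singleton hv, hr])]
  exact Submodule.covBy_span_singleton_sup hv

/-- This is `x ^ n (x ^ k - 1) = x ^ n (x - 1) [[k]]_x`, rearranged to avoid subtraction. -/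
theorem pow_add_eq_gauss (x n k : ℕ) : x ^ (n + k) + x ^ n * gauss k x =
    x ^ n + x ^ n * gauss k x * x := by
  induction k with
  | zero => simp [gauss]
  | succ k ih =>
    have : gauss (k + 1) x = gauss k x + x ^ k := by rw [gauss, Finset.sum_range_succ, ← gauss]
    rw [this]
    ring_nf at ih ⊢
    omega

variable [Finite K]

/-- The number of covers `L` of `A` that are contained in `U₂` but not in `U₁`. -/
theorem card_covers {A U₁ U₂ : Submodule K V} (h1 : A ≤ U₁) (h2 : U₁ ≤ U₂) :
    Nat.card {L : Submodule K V // A ⋖ L ∧ L ≤ U₂ ∧ ¬ L ≤ U₁} =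
      Nat.card K ^ (finrank K U₁ - finrank K A) *
        gauss (finrank K U₂ - finrank K U₁) (Nat.card K) := by
  classical
  have : Finite V := Module.finite_of_finite K
  let _ := Fintype.ofFinite V
  let _ := Fintype.ofFinite (Submodule K V)
  have hcard : ∀ U : Submodule K V,
      (Finset.univ.filter fun v => v ∈ U).card = Nat.card K ^ finrank K U := by
    intro U
    rw [← Module.natCard_eq_pow_finrank (K := K) (V := U), Nat.card_eq_fintype_card,
      Fintype.card_subtype]
  have hdiff : ∀ U U' : Submodule K V, U ≤ U' →
      (Finset.univ.filter fun v => v ∈ U' ∧ v ∉ U).card + Nat.card K ^ finrank K U =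
        Nat.card K ^ finrank K U' := by
    intro U U' h
    rw [← hcard, ← hcard, ← Finset.card_union_of_disjoint]
    · congr 1
      ext v
      simp only [Finset.mem_union, Finset.mem_filter, Finset.mem_univ, true_and]
      exact ⟨fun hv => hv.elim (fun hv => hv.1) fun hv => h hv, fun hv => by tauto⟩
    · rw [Finset.disjoint_left]
      simp
  let S := Finset.univ.filter fun L : Submodule K V => A ⋖ L ∧ L ≤ U₂ ∧ ¬ L ≤ U₁
  have hS : Nat.card {L : Submodule K V // A ⋖ L ∧ L ≤ U₂ ∧ ¬ L ≤ U₁} = S.card := by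
    rw [Nat.card_eq_fintype_card, Fintype.card_subtype]
  -- The vectors of `U₂` outside `U₁` are counted by the cover `K v + A` that they generate. The
  -- fibre over `L` consists of the vectors of `L` outside `A`, since `L` meets `U₁` in `A` only; so
  -- all fibres have the same size.
  have hfib := Finset.card_eq_sum_card_fiberwise (f := fun v : V => K ∙ v ⊔ A)
    (s := Finset.univ.filter fun v => v ∈ U₂ ∧ v ∉ U₁) (t := S) (by
      intro v hv
      simp only [Finset.coe_filter, Finset.mem_univ, true_and, Set.mem_ofPred_eq] at hv
      simp only [S, Finset.coe_filter, Finset.mem_univ, true_and, Set.mem_ofPred_eq]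
      refine ⟨Submodule.covBy_span_singleton_sup fun h => hv.2 (h1 h), ?_, fun h => hv.2 ?_⟩
      · exact sup_le ((Submodule.span_singleton_le_iff_mem v _).mpr hv.1) (h1.trans h2)
      · exact h (Submodule.mem_sup_left (Submodule.mem_span_singleton_self v)))
  have hone : ∀ L ∈ S, ((Finset.univ.filter fun v => v ∈ U₂ ∧ v ∉ U₁).filter
      fun v => K ∙ v ⊔ A = L).card + Nat.card K ^ finrank K A = Nat.card K ^ (finrank K A + 1) := by
    intro L hL
    simp only [S, Finset.mem_filter, Finset.mem_univ, true_and] at hL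
    obtain ⟨hL1, hL2, hL3⟩ := hL
    rw [← finrank_of_covBy hL1, ← hdiff A L hL1.le, Finset.filter_filter]
    congr 2
    ext v
    simp only [Finset.mem_filter, Finset.mem_univ, true_and]
    constructor
    · rintro ⟨⟨h3, h4⟩, rfl⟩
      exact ⟨Submodule.mem_sup_left (Submodule.mem_span_singleton_self v), fun h => h4 (h1 h)⟩
    · rintro ⟨h3, h4⟩
      have h5 := eq_sup_span_of_covBy hL1 h3 h4
      refine ⟨⟨hL2 h3, fun h => hL3 ?_⟩, h5⟩
      rw [← h5]
      exact sup_le ((Submodule.span_singleton_le_iff_mem v _).mpr h) h1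
  have hq : 1 < Nat.card K := Finite.one_lt_card
  have hconst : ∀ L ∈ S, ((Finset.univ.filter fun v => v ∈ U₂ ∧ v ∉ U₁).filter
      fun v => K ∙ v ⊔ A = L).card = Nat.card K ^ finrank K A * (Nat.card K - 1) := by
    intro L hL
    have := hone L hL
    rw [Nat.mul_sub, ← pow_succ, mul_one]
    omega
  rw [Finset.sum_congr rfl hconst, Finset.sum_const, smul_eq_mul] at hfib
  have h3 := hdiff U₁ U₂ h2
  rw [hfib] at h3
  rw [hS]
  obtain ⟨a, ha⟩ := Nat.exists_eq_add_of_le (Submodule.finrank_mono h1)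
  obtain ⟨b, hb⟩ := Nat.exists_eq_add_of_le (Submodule.finrank_mono h2)
  have h4 := pow_add_eq_gauss (Nat.card K) (finrank K U₁) b
  rw [← hb] at h4
  rw [hb, ha, Nat.add_sub_cancel_left, Nat.add_sub_cancel_left]
  rw [ha] at h3 h4 hb
  -- Writing `|K| = t + 2` turns the common factor `|K| - 1` into the positive number `t + 1`, which
  -- can be cancelled.
  obtain ⟨t, ht⟩ := Nat.exists_eq_add_of_le hq
  rw [show Nat.card K - 1 = t + 1 by omega] at h3
  have hpos : 0 < Nat.card K ^ finrank K A * (t + 1) := by positivity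
  refine Nat.eq_of_mul_eq_mul_right hpos ?_
  rw [pow_add] at h3 h4
  rw [ht] at h3 h4 ⊢
  nlinarith

/-- The number of hyperplanes `L` of `W` that contain `U₁` but not `U₂`. -/
theorem card_cocovers {U₁ U₂ W : Submodule K V} (h1 : U₁ ≤ U₂) (h2 : U₂ ≤ W) :
    Nat.card {L : Submodule K V // L ⋖ W ∧ U₁ ≤ L ∧ ¬ U₂ ≤ L} =
      Nat.card K ^ (finrank K W - finrank K U₂) *
        gauss (finrank K U₂ - finrank K U₁) (Nat.card K) := by
  -- Annihilators reverse inclusion, so hyperplanes of `W` correspond to covers of the annihilator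
  -- of `W` in the dual space, and `card_covers` applies there.
  let e := (Subspace.orderIsoFiniteDimensional (K := K) (V := V))
  have he : ∀ U U' : Submodule K V, U.dualAnnihilator ≤ U'.dualAnnihilator ↔ U' ≤ U := fun U U' =>
    e.le_iff_le (x := U') (y := U)
  have hc := card_covers (A := W.dualAnnihilator) (U₁ := U₂.dualAnnihilator)
    (U₂ := U₁.dualAnnihilator) ((he _ _).mpr h2) ((he _ _).mpr h1)
  have hr := fun U : Submodule K V => Subspace.finrank_add_finrank_dualAnnihilator_eq U
  have hU1 := hr U₁
  have hU2 := hr U₂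
  have hW := hr W
  have hm1 := Submodule.finrank_mono h1
  have hm2 := Submodule.finrank_mono h2
  rw [show finrank K U₂.dualAnnihilator - finrank K W.dualAnnihilator =
      finrank K W - finrank K U₂ by omega,
    show finrank K U₁.dualAnnihilator - finrank K U₂.dualAnnihilator =
      finrank K U₂ - finrank K U₁ by omega] at hc
  rw [← hc]
  refine Nat.card_congr (e.toEquiv.subtypeEquiv fun L => ?_)
  refine and_congr ?_ (and_congr (he _ _).symm (not_congr (he _ _).symm))
  rw [← apply_covBy_apply_iff e]
  exact ofDual_covBy_ofDual_iff.symm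

end Subspaces

/-! ### Relative position of two flags -/

section Flags

variable {K V : Type*} [Field K] [AddCommGroup V] [Module K V] {N : ℕ}

/-- The members of a flag. -/
def Flag.sub (F : Flag K V N) (I : Fin (N + 1)) : Submodule K V := F.1 I

theorem Flag.mono (F : Flag K V N) : Monotone F.sub := F.2.1

theorem Flag.zero (F : Flag K V N) : F.sub 0 = ⊥ := F.2.2.1

theorem Flag.last (F : Flag K V N) : F.sub (Fin.last N) = ⊤ := F.2.2.2

theorem relPos_apply (F G : Flag K V N) (i j : Fin N) : relPos F G i j =
    finrank K ↥(F.sub i.castSucc ⊔ F.sub i.succ ⊓ G.sub j.succ) -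
      finrank K ↥(F.sub i.castSucc ⊔ F.sub i.succ ⊓ G.sub j.castSucc) := rfl

theorem filter_castSucc_lt_succ (k : Fin N) : (Finset.univ.filter fun j : Fin N =>
    j.castSucc < k.succ) = insert k (Finset.univ.filter fun j => j.castSucc < k.castSucc) := by
  ext j
  simp only [Finset.mem_filter, Finset.mem_univ, true_and, Finset.mem_insert, Fin.lt_def,
    Fin.ext_iff, Fin.val_castSucc, Fin.val_succ]
  omega

theorem relPos_mono (F G : Flag K V N) (i : Fin N) {j j' : Fin (N + 1)} (h : j ≤ j') :
    F.sub i.castSucc ⊔ F.sub i.succ ⊓ G.sub j ≤ F.sub i.castSucc ⊔ F.sub i.succ ⊓ G.sub j' :=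
  sup_le_sup_left (inf_le_inf_left _ (G.mono h)) _

/-- The flags `F` and `F'` agree outside `J`, and `F'` has a hyperplane of `F` at `J`. -/
structure Covers (F F' : Flag K V N) (J : Fin (N + 1)) : Prop where
  eq_of_ne : ∀ I, I ≠ J → F.sub I = F'.sub I
  covBy : F'.sub J ⋖ F.sub J

/-- The intersections of `F_J` with the members of `G` grow from zero, which lies in `F'_J`, to
`F_J`, which does not; somewhere they leave the hyperplane. -/
theorem Covers.exists_jump {F F' : Flag K V N} {J : Fin (N + 1)} (h : Covers F F' J)
    (G : Flag K V N) :
    ∃ k : Fin N, F.sub J ⊓ G.sub k.castSucc ≤ F'.sub J ∧ ¬ F.sub J ⊓ G.sub k.succ ≤ F'.sub J := by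
  by_contra! hc
  have key : ∀ I, F.sub J ⊓ G.sub I ≤ F'.sub J := by
    intro I
    induction I using Fin.induction with
    | zero => simp [G.zero]
    | succ k ih => exact hc k ih
  have := key (Fin.last N)
  rw [G.last, inf_top_eq] at this
  exact absurd this h.covBy.lt.not_ge

variable [FiniteDimensional K V]

/-- Partial row sums of `relPos`. -/
theorem sum_relPos (F G : Flag K V N) (i : Fin N) (J : Fin (N + 1)) :
    ∑ j with j.castSucc < J, relPos F G i j + finrank K (F.sub i.castSucc) =
      finrank K ↥(F.sub i.castSucc ⊔ F.sub i.succ ⊓ G.sub J) := by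
  induction J using Fin.induction with
  | zero =>
    rw [G.zero, inf_bot_eq, sup_bot_eq]
    simp
  | succ k ih =>
    rw [filter_castSucc_lt_succ, Finset.sum_insert (by simp), add_assoc, ih, relPos_apply]
    exact Nat.sub_add_cancel (Submodule.finrank_mono (relPos_mono F G i
      (Fin.castSucc_lt_succ).le))

theorem sum_relPos_inf (F G : Flag K V N) (i : Fin N) (J : Fin (N + 1)) :
    ∑ j with j.castSucc < J, relPos F G i j + finrank K ↥(F.sub i.castSucc ⊓ G.sub J) =
      finrank K ↥(F.sub i.succ ⊓ G.sub J) := by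
  have h1 := sum_relPos F G i J
  have h2 := Submodule.finrank_sup_add_finrank_inf_eq (F.sub i.castSucc) (F.sub i.succ ⊓ G.sub J)
  rw [← inf_assoc, inf_eq_left.mpr (F.mono (Fin.castSucc_lt_succ (i := i)).le)] at h2
  omega

/-- The dimensions of the intersections of the members of two flags. -/
theorem sum_sum_relPos (F G : Flag K V N) (I J : Fin (N + 1)) :
    ∑ i with i.castSucc < I, ∑ j with j.castSucc < J, relPos F G i j =
      finrank K ↥(F.sub I ⊓ G.sub J) := by
  induction I using Fin.induction with
  | zero =>
    rw [F.zero, bot_inf_eq, finrank_bot]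
    simp
  | succ k ih =>
    rw [filter_castSucc_lt_succ, Finset.sum_insert (by simp), ih, sum_relPos_inf]

/-- `relPos` is the second difference of the dimensions of the intersections. This form is symmetric
in the two flags, which the definition is not. -/
theorem relPos_add (F G : Flag K V N) (i j : Fin N) :
    relPos F G i j + finrank K ↥(F.sub i.succ ⊓ G.sub j.castSucc) +
      finrank K ↥(F.sub i.castSucc ⊓ G.sub j.succ) =
    finrank K ↥(F.sub i.succ ⊓ G.sub j.succ) + finrank K ↥(F.sub i.castSucc ⊓ G.sub j.castSucc) := by
  have h1 := sum_relPos_inf F G i j.succ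
  have h2 := sum_relPos_inf F G i j.castSucc
  rw [filter_castSucc_lt_succ, Finset.sum_insert (by simp)] at h1
  omega

theorem relPos_transpose (F G : Flag K V N) (i j : Fin N) : relPos F G i j = relPos G F j i := by
  have h1 := relPos_add F G i j
  have h2 := relPos_add G F j i
  rw [inf_comm (G.sub j.succ) (F.sub i.castSucc), inf_comm (G.sub j.castSucc) (F.sub i.succ),
    inf_comm (G.sub j.succ) (F.sub i.succ), inf_comm (G.sub j.castSucc) (F.sub i.castSucc)] at h2
  omega

theorem relPos_row_sum (F G : Flag K V N) (i : Fin N) :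
    ∑ j, relPos F G i j + finrank K (F.sub i.castSucc) = finrank K (F.sub i.succ) := by
  have h := sum_relPos_inf F G i (Fin.last N)
  rw [G.last, inf_top_eq, inf_top_eq] at h
  simpa [Fin.castSucc_lt_last] using h

theorem relPos_self (F : Flag K V N) (l : Fin N → ℕ)
    (hl : ∀ i, l i + finrank K (F.sub i.castSucc) = finrank K (F.sub i.succ)) :
    relPos F F = Matrix.diagonal l := by
  have hmin : ∀ I J : Fin (N + 1), I ≤ J → F.sub I ⊓ F.sub J = F.sub I := fun I J h =>
    inf_eq_left.mpr (F.mono h)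
  have hmin' : ∀ I J : Fin (N + 1), I ≤ J → F.sub J ⊓ F.sub I = F.sub I := fun I J h =>
    inf_eq_right.mpr (F.mono h)
  ext i j
  have h := relPos_add F F i j
  have hi := hl i
  rw [Matrix.diagonal_apply]
  rcases lt_trichotomy i j with hij | rfl | hij
  · rw [if_neg hij.ne]
    rw [hmin i.succ j.castSucc hij,
      hmin i.castSucc j.succ (by rw [Fin.lt_def] at hij; rw [Fin.le_def, Fin.val_castSucc, Fin.val_succ]; omega),
      hmin i.succ j.succ (by rw [Fin.le_def, Fin.val_succ, Fin.val_succ]; exact Nat.succ_le_succ hij.le),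
      hmin i.castSucc j.castSucc (show i ≤ j from hij.le)] at h
    omega
  · rw [if_pos rfl]
    rw [inf_idem, inf_idem, hmin _ _ (Fin.castSucc_lt_succ (i := i)).le,
      hmin' _ _ (Fin.castSucc_lt_succ (i := i)).le] at h
    omega
  · rw [if_neg hij.ne']
    rw [hmin' j.succ i.castSucc hij,
      hmin' j.castSucc i.succ (by rw [Fin.lt_def] at hij; rw [Fin.le_def, Fin.val_castSucc, Fin.val_succ]; omega),
      hmin' j.succ i.succ (by rw [Fin.le_def, Fin.val_succ, Fin.val_succ]; exact Nat.succ_le_succ hij.le),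
      hmin' j.castSucc i.castSucc (show j ≤ i from hij.le)] at h
    omega

/-- Replacing `F_J` by the hyperplane `F'_J` lowers the dimension of its intersection with `G_j` by
one exactly for `j` beyond the jump `k`. Taking second differences, one unit passes from the entry
`(H, k)` to the entry `(H', k)`. -/
theorem Covers.relPos_add_single {F F' : Flag K V N} {H H' : Fin N} (hH : H.succ = H'.castSucc)
    (h : Covers F F' H.succ) (G : Flag K V N) {k : Fin N}
    (hk : F.sub H.succ ⊓ G.sub k.castSucc ≤ F'.sub H.succ)
    (hk' : ¬ F.sub H.succ ⊓ G.sub k.succ ≤ F'.sub H.succ) :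
    relPos F G + Matrix.single H' k 1 = relPos F' G + Matrix.single H k 1 := by
  have hJ : ∀ j, finrank K ↥(F.sub H.succ ⊓ G.sub j) =
      finrank K ↥(F'.sub H.succ ⊓ G.sub j) + if k.castSucc < j then 1 else 0 := by
    intro j
    have hle := h.covBy.le
    split_ifs with hj
    · have h1 : ¬ F.sub H.succ ⊓ G.sub j ≤ F'.sub H.succ := fun hc => hk'
        ((inf_le_inf_left _ (G.mono (Fin.castSucc_lt_iff_succ_le.mp hj))).trans hc)
      have h2 : F'.sub H.succ ⊔ F.sub H.succ ⊓ G.sub j = F.sub H.succ :=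
        (h.covBy.eq_or_eq le_sup_left (sup_le hle inf_le_left)).resolve_left
          fun hc => h1 (sup_eq_left.mp hc)
      have h3 := Submodule.finrank_sup_add_finrank_inf_eq (F'.sub H.succ) (F.sub H.succ ⊓ G.sub j)
      rw [h2, ← inf_assoc, inf_eq_left.mpr hle, finrank_of_covBy h.covBy] at h3
      omega
    · rw [add_zero]
      suffices he : F.sub H.succ ⊓ G.sub j = F'.sub H.succ ⊓ G.sub j by rw [he]
      refine le_antisymm (le_inf ?_ inf_le_right) (inf_le_inf_right _ hle)
      exact (inf_le_inf_left _ (G.mono (not_lt.mp hj))).trans hk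
  ext i j
  have h1 := relPos_add F G i j
  have h2 := relPos_add F' G i j
  have hs := hJ j.succ
  have hc := hJ j.castSucc
  simp only [Matrix.add_apply, Matrix.single_apply]
  have hkj : k.castSucc < j.succ ↔ k < j ∨ k = j := by
    rw [← le_iff_lt_or_eq, Fin.lt_def, Fin.le_def, Fin.val_castSucc, Fin.val_succ]
    omega
  have hkj' : k.castSucc < j.castSucc ↔ k < j := Iff.rfl
  have hHH : H ≠ H' := by
    rintro rfl
    exact (Fin.castSucc_lt_succ (i := H)).ne' hH
  simp only [hkj] at hs
  simp only [hkj'] at hc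
  by_cases hi : H = i
  · subst hi
    rw [← h.eq_of_ne _ (Fin.castSucc_lt_succ (i := H)).ne] at h2
    simp only [hHH.symm, false_and, if_false, true_and]
    rcases lt_trichotomy k j with h3 | h3 | h3
    · simp only [h3, h3.ne, true_or, if_true, if_false] at *
      omega
    · simp only [h3, lt_irrefl, or_true, if_true, if_false] at *
      omega
    · simp only [h3.not_gt, h3.ne', or_false, if_false] at *
      omega
  · by_cases hi' : H' = i
    · subst hi'
      rw [← hH] at h1 h2
      rw [← h.eq_of_ne H'.succ (by rw [hH]; exact (Fin.castSucc_lt_succ (i := H')).ne')] at h2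
      simp only [hHH, false_and, if_false, true_and]
      rcases lt_trichotomy k j with h3 | h3 | h3
      · simp only [h3, h3.ne, true_or, if_true, if_false] at *
        omega
      · simp only [h3, lt_irrefl, or_true, if_true, if_false] at *
        omega
      · simp only [h3.not_gt, h3.ne', or_false, if_false] at *
        omega
    · have e1 : i.succ ≠ H.succ := fun h => hi (Fin.succ_injective _ h).symm
      have e2 : i.castSucc ≠ H.succ := fun h => hi'
        (Fin.castSucc_injective _ (h.trans hH)).symm
      rw [← h.eq_of_ne _ e1, ← h.eq_of_ne _ e2] at h2
      simp only [hi, hi', false_and, if_false]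
      omega

/-- Partial sums of the matrix give the dimensions of `F_I`, `F'_I` and their intersection. The last
two agree, so `F'_I ≤ F_I`, and the first exceeds them, by one, only at `I = H.succ`. -/
theorem covers_of_relPos {F F' : Flag K V N} {H H' : Fin N} (hH : H.succ = H'.castSucc)
    {c : Fin N → ℕ} (h : relPos F F' = Matrix.diagonal c + Matrix.single H H' 1) :
    Covers F F' H.succ := by
  have hs : ∀ s t : Finset (Fin N), ∑ i ∈ s, ∑ j ∈ t, relPos F F' i j =
      ∑ i ∈ s, (if i ∈ t then c i else 0) + if H ∈ s ∧ H' ∈ t then 1 else 0 := by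
    intro s t
    simp only [h, Matrix.add_apply, Matrix.diagonal_apply, Matrix.single_apply,
      Finset.sum_add_distrib, Finset.sum_ite_eq, ite_and]
    congr 1
    by_cases h1 : H ∈ s <;> by_cases h2 : H' ∈ t <;> simp [h1, h2]
  have hHH : ∀ I : Fin (N + 1), H'.castSucc < I → H.castSucc < I := fun I hI =>
    (Fin.castSucc_lt_succ.trans_eq hH).trans hI
  have h1 : ∀ I : Fin (N + 1), finrank K ↥(F.sub I ⊓ F'.sub I) =
      ∑ i with i.castSucc < I, c i + if H'.castSucc < I then 1 else 0 := by
    intro I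
    rw [← sum_sum_relPos, hs]
    simp only [Finset.mem_filter, Finset.mem_univ, true_and]
    congr 1
    · refine Finset.sum_congr rfl fun i hi => ?_
      rw [if_pos (by simpa using hi)]
    · simp only [and_iff_right_of_imp (hHH I)]
  have h2 : ∀ I : Fin (N + 1), finrank K (F.sub I) =
      ∑ i with i.castSucc < I, c i + if H.castSucc < I then 1 else 0 := by
    intro I
    rw [← inf_top_eq (F.sub I), ← F'.last, ← sum_sum_relPos, hs]
    simp [Fin.castSucc_lt_last]
  have h3 : ∀ I : Fin (N + 1), finrank K (F'.sub I) =
      ∑ i with i.castSucc < I, c i + if H'.castSucc < I then 1 else 0 := by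
    intro I
    rw [← top_inf_eq (F'.sub I), ← F.last, ← sum_sum_relPos, hs]
    simp [Fin.castSucc_lt_last, Finset.sum_filter]
  have hle : ∀ I, F'.sub I ≤ F.sub I := by
    intro I
    have := Submodule.eq_of_le_of_finrank_eq (inf_le_right : F.sub I ⊓ F'.sub I ≤ F'.sub I)
      (by rw [h1, h3])
    exact inf_eq_right.mp this
  refine ⟨fun I hI => ?_, covBy_of_finrank (hle _) ?_⟩
  · refine (Submodule.eq_of_le_of_finrank_eq (hle I) ?_).symm
    rw [h2, h3]
    have : H'.castSucc < I ↔ H.castSucc < I := by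
      rw [← hH, Fin.castSucc_lt_iff_succ_le]
      exact ⟨fun h => h.le, fun h => lt_of_le_of_ne h hI.symm⟩
    simp only [this]
  · rw [h2, h3, if_pos Fin.castSucc_lt_succ, if_neg (by rw [hH]; exact lt_irrefl _)]

end Flags

open Module

/-! ### Convolution of orbit functions -/

section Convolution

variable {K V : Type*} [Field K] [AddCommGroup V] [Module K V] {N : ℕ}

theorem Flag.ext {F G : Flag K V N} (h : ∀ I, F.sub I = G.sub I) : F = G :=
  Subtype.ext (funext h)

/-- Replace one member of a flag. -/
def Flag.update (F : Flag K V N) {H H' : Fin N} (hH : H.succ = H'.castSucc) (L : Submodule K V)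
    (h1 : F.sub H.castSucc ≤ L) (h2 : L ≤ F.sub H'.succ) : Flag K V N :=
  ⟨Function.update F.sub H.succ L, by
    refine ⟨fun a b hab => ?_, ?_, ?_⟩
    · rcases eq_or_ne a H.succ with rfl | ha <;> rcases eq_or_ne b H.succ with rfl | hb
      · exact le_rfl
      · rw [Function.update_self, Function.update_of_ne hb]
        refine h2.trans (F.mono ?_)
        rw [← Fin.castSucc_lt_iff_succ_le, ← hH]
        exact lt_of_le_of_ne hab hb.symm
      · rw [Function.update_self, Function.update_of_ne ha]
        refine (F.mono ?_).trans h1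
        rw [Fin.le_castSucc_iff]
        exact lt_of_le_of_ne hab ha
      · rw [Function.update_of_ne ha, Function.update_of_ne hb]
        exact F.mono hab
    · rw [Function.update_of_ne (Fin.succ_ne_zero H).symm]
      exact F.zero
    · rw [hH, Function.update_of_ne (Fin.castSucc_lt_last H').ne']
      exact F.last⟩

theorem Flag.update_sub_self (F : Flag K V N) {H H' : Fin N} (hH : H.succ = H'.castSucc)
    (L : Submodule K V) (h1 : F.sub H.castSucc ≤ L) (h2 : L ≤ F.sub H'.succ) :
    (F.update hH L h1 h2).sub H.succ = L := Function.update_self _ _ _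

theorem Flag.update_sub_of_ne (F : Flag K V N) {H H' : Fin N} (hH : H.succ = H'.castSucc)
    (L : Submodule K V) (h1 : F.sub H.castSucc ≤ L) (h2 : L ≤ F.sub H'.succ) {I : Fin (N + 1)}
    (hI : I ≠ H.succ) : (F.update hH L h1 h2).sub I = F.sub I := Function.update_of_ne hI _ _

variable {A D : Matrix (Fin N) (Fin N) ℕ} {H H' : Fin N}

/-- Row `H` of `B` exceeds that of `A` in column `k` only, so at most one term of the product
formula is nonzero at a given pair of flags. -/
theorem eq_of_add_single_eq {B : Matrix (Fin N) (Fin N) ℕ} {k k' : Fin N} (hne : H ≠ H')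
    (hk : B + Matrix.single H' k 1 = A + Matrix.single H k 1)
    (hk' : B + Matrix.single H' k' 1 = A + Matrix.single H k' 1) : k' = k := by
  have h1 := congrFun (congrFun hk H) k
  have h2 := congrFun (congrFun hk' H) k
  simp only [Matrix.add_apply, Matrix.single_apply, hne.symm, false_and, if_false, true_and,
    if_true] at h1 h2
  by_contra hc
  rw [if_neg hc] at h2
  omega

theorem apply_of_add_single_eq {B : Matrix (Fin N) (Fin N) ℕ} {k : Fin N} (hne : H ≠ H')
    (hk : B + Matrix.single H' k 1 = A + Matrix.single H k 1) (j : Fin N) :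
    B H j = A H j + if k = j then 1 else 0 := by
  have h1 := congrFun (congrFun hk H) j
  simpa only [Matrix.add_apply, Matrix.single_apply, hne.symm, false_and, if_false, true_and,
    add_zero] using h1

variable [FiniteDimensional K V]

theorem covers_transpose_of_relPos (hH : H'.succ = H.castSucc) {F F' : Flag K V N}
    (hE : IsElementary A D H H') (h : relPos F F' = D) : Covers F' F H'.succ := by
  obtain ⟨⟨c, hc⟩, -⟩ := hE
  refine covers_of_relPos (c := c) hH ?_
  ext i j
  rw [relPos_transpose, h, hc, Matrix.add_apply, Matrix.add_apply, Matrix.diagonal_apply,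
    Matrix.diagonal_apply, Matrix.single_apply, Matrix.single_apply]
  congr 1
  · by_cases hij : i = j
    · rw [if_pos hij, if_pos hij.symm, hij]
    · rw [if_neg hij, if_neg (Ne.symm hij)]
  · simp only [and_comm]

/-- Apply `Covers.relPos_add_single` with `F'` as the third flag. The relative position of `F'` to
itself is diagonal with the row sums of `A`, and `IsElementary.add_single` identifies the result as
`D`. -/
theorem relPos_eq_of_covers (hH : H.succ = H'.castSucc) (hE : IsElementary A D H H')
    {F F' G : Flag K V N} (hA : relPos F' G = A) (h : Covers F F' H.succ) : relPos F F' = D := by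
  have h1 := h.relPos_add_single hH F' (k := H') (by rw [← hH]; exact inf_le_right) (by
    rw [← h.eq_of_ne H'.succ (by rw [hH]; exact Fin.castSucc_lt_succ.ne'),
      inf_eq_left.mpr (F.mono (by rw [hH]; exact Fin.castSucc_lt_succ.le))]
    exact h.covBy.lt.not_ge)
  rw [relPos_self F' _ (fun i => relPos_row_sum F' G i), hA, ← hE.add_single fun _ => rfl] at h1
  exact add_right_cancel h1

theorem relPos_eq_of_covers_transpose (hH : H'.succ = H.castSucc) (hE : IsElementary A D H H')
    {F F' G : Flag K V N} (hA : relPos F' G = A) (h : Covers F' F H'.succ) :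
    relPos F F' = D := by
  have h1 := h.relPos_add_single hH F' (k := H') (by
      exact inf_le_right.trans (by
        rw [h.eq_of_ne H'.castSucc Fin.castSucc_lt_succ.ne]
        exact F.mono Fin.castSucc_lt_succ.le)) (by
    rw [inf_idem]
    exact h.covBy.lt.not_ge)
  rw [relPos_self F' _ (fun i => relPos_row_sum F' G i), hA, ← hE.add_single fun _ => rfl] at h1
  exact (add_right_cancel h1).symm

theorem exists_of_relPos_plus (hH : H.succ = H'.castSucc) (hE : IsElementary A D H H')
    {F F' G : Flag K V N} (hD : relPos F F' = D) (hA : relPos F' G = A) :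
    ∃ k, relPos F G + Matrix.single H' k 1 = A + Matrix.single H k 1 := by
  obtain ⟨⟨c, hc⟩, -⟩ := hE
  have h := covers_of_relPos hH (hD.trans hc)
  obtain ⟨k, h1, h2⟩ := h.exists_jump G
  exact ⟨k, hA ▸ h.relPos_add_single hH G h1 h2⟩

theorem exists_of_relPos_minus (hH : H'.succ = H.castSucc) (hE : IsElementary A D H H')
    {F F' G : Flag K V N} (hD : relPos F F' = D) (hA : relPos F' G = A) :
    ∃ k, relPos F G + Matrix.single H' k 1 = A + Matrix.single H k 1 := by
  have h := covers_transpose_of_relPos hH hE hD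
  obtain ⟨k, h1, h2⟩ := h.exists_jump G
  exact ⟨k, hA ▸ (h.relPos_add_single hH G h1 h2).symm⟩

theorem sum_eq_add_sum_lt_add_sum_gt (v : Fin N → ℕ) (k : Fin N) :
    ∑ j, v j = ∑ j with j < k, v j + v k + ∑ j with k < j, v j := by
  rw [← Finset.sum_filter_add_sum_filter_not Finset.univ (fun j => j < k), add_assoc]
  congr 1
  have : (Finset.univ.filter fun j => ¬ j < k) = insert k (Finset.univ.filter fun j => k < j) := by
    ext j
    simp [le_iff_eq_or_lt, eq_comm]
  rw [this, Finset.sum_insert (by simp)]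

variable [Finite K]

/-- The flag `F'` is determined by the hyperplane `F'_J` of `F_J`, with `J = H.succ`. It must
contain `F_{J-1}` and jump along `G` exactly at `k`, which makes the fibre a set of hyperplanes
counted by `card_cocovers`. The exponents are sums of entries in row `H` of `relPos F G`, which
agrees with row `H` of `A` apart from one more in column `k`. -/
theorem card_relPos_plus (hH : H.succ = H'.castSucc) (hE : IsElementary A D H H')
    {F G : Flag K V N} {k : Fin N}
    (hk : relPos F G + Matrix.single H' k 1 = A + Matrix.single H k 1) :
    Nat.card {F' : Flag K V N // relPos F F' = D ∧ relPos F' G = A} =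
      Nat.card K ^ (∑ j with k < j, A H j) * gauss (A H k + 1) (Nat.card K) := by
  have hne : H ≠ H' := by
    rintro rfl
    exact (Fin.castSucc_lt_succ (i := H)).ne' hH
  have hB := apply_of_add_single_eq hne hk
  have hrow := relPos_mono F G H (Fin.castSucc_lt_succ (i := k)).le
  have hlast : F.sub H.castSucc ≤ F.sub H.succ := F.mono Fin.castSucc_lt_succ.le
  have hc := card_cocovers hrow (sup_le hlast (inf_le_left (b := G.sub k.succ)))
  have e1 := sum_relPos F G H k.succ
  have e2 := sum_relPos F G H k.castSucc
  have e3 := relPos_row_sum F G H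
  rw [filter_castSucc_lt_succ, Finset.sum_insert (by simp)] at e1
  rw [sum_eq_add_sum_lt_add_sum_gt _ k] at e3
  have e4 : ∑ j with k < j, relPos F G H j = ∑ j with k < j, A H j := by
    refine Finset.sum_congr rfl fun j hj => ?_
    rw [hB, if_neg (Finset.mem_filter.mp hj).2.ne, add_zero]
  have e5 := hB k
  rw [if_pos rfl] at e5
  change ∑ j with j < k, relPos F G H j + _ = _ at e2
  change _ + ∑ j with j < k, relPos F G H j + _ = _ at e1
  rw [show finrank K (F.sub H.succ) - finrank K
      ↥(F.sub H.castSucc ⊔ F.sub H.succ ⊓ G.sub k.succ) = ∑ j with k < j, A H j by omega,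
    show finrank K ↥(F.sub H.castSucc ⊔ F.sub H.succ ⊓ G.sub k.succ) -
      finrank K ↥(F.sub H.castSucc ⊔ F.sub H.succ ⊓ G.sub k.castSucc) = A H k + 1 by omega] at hc
  rw [← hc]
  have hfwd : ∀ F' : Flag K V N, relPos F F' = D ∧ relPos F' G = A → Covers F F' H.succ ∧
      F.sub H.castSucc ⊔ F.sub H.succ ⊓ G.sub k.castSucc ≤ F'.sub H.succ ∧
      ¬ F.sub H.castSucc ⊔ F.sub H.succ ⊓ G.sub k.succ ≤ F'.sub H.succ := by
    rintro F' ⟨hD, hA⟩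
    obtain ⟨c, hc⟩ := hE.1
    have h := covers_of_relPos hH (hD.trans hc)
    obtain ⟨k', h1, h2⟩ := h.exists_jump G
    have h3 := h.relPos_add_single hH G h1 h2
    rw [hA] at h3
    obtain rfl := eq_of_add_single_eq hne hk h3
    refine ⟨h, sup_le ?_ h1, fun hc => h2 (le_sup_right.trans hc)⟩
    rw [h.eq_of_ne _ Fin.castSucc_lt_succ.ne]
    exact F'.mono Fin.castSucc_lt_succ.le
  -- Away from `H.succ` the flag `F'` equals `F`, which gives injectivity; conversely, putting any
  -- admissible hyperplane into `F` at this index gives the right relative positions.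
  refine Nat.card_congr (Equiv.ofBijective (fun F' => ⟨F'.1.sub H.succ,
    (hfwd _ F'.2).1.covBy, (hfwd _ F'.2).2⟩) ⟨?_, ?_⟩)
  · rintro ⟨F₁, h1⟩ ⟨F₂, h2⟩ h
    refine Subtype.ext (Flag.ext fun I => ?_)
    rcases eq_or_ne I H.succ with rfl | hI
    · exact congrArg Subtype.val h
    · exact ((hfwd _ h1).1.eq_of_ne I hI).symm.trans ((hfwd _ h2).1.eq_of_ne I hI)
  · rintro ⟨L, hL1, hL2, hL3⟩
    have hL4 := le_sup_left.trans hL2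
    have hL5 : L ≤ F.sub H'.succ :=
      hL1.le.trans (F.mono (by rw [hH]; exact Fin.castSucc_lt_succ.le))
    have hs := F.update_sub_self hH L hL4 hL5
    have hcov : Covers F (F.update hH L hL4 hL5) H.succ :=
      ⟨fun I hI => (F.update_sub_of_ne hH L hL4 hL5 hI).symm, by rwa [hs]⟩
    have h1 := hcov.relPos_add_single hH G (k := k) (by
      rw [hs]
      exact le_sup_right.trans hL2) (by
      rw [hs]
      exact fun h => hL3 (sup_le hL4 h))
    have hA : relPos (F.update hH L hL4 hL5) G = A := add_right_cancel (h1.symm.trans hk)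
    exact ⟨⟨_, relPos_eq_of_covers hH hE hA hcov, hA⟩, Subtype.ext hs⟩

/-- Here `F'` has a larger member than `F` at the common index: the choices are covers of `F.sub
H.castSucc` inside `F.sub H.succ`, counted by `card_covers`. -/
theorem card_relPos_minus (hH : H'.succ = H.castSucc) (hE : IsElementary A D H H')
    {F G : Flag K V N} {k : Fin N}
    (hk : relPos F G + Matrix.single H' k 1 = A + Matrix.single H k 1) :
    Nat.card {F' : Flag K V N // relPos F F' = D ∧ relPos F' G = A} =
      Nat.card K ^ (∑ j with j < k, A H j) * gauss (A H k + 1) (Nat.card K) := by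
  have hne : H ≠ H' := by
    rintro rfl
    exact (Fin.castSucc_lt_succ (i := H)).ne' hH
  have hB := apply_of_add_single_eq hne hk
  have hrow := relPos_mono F G H (Fin.castSucc_lt_succ (i := k)).le
  have hc := card_covers (le_sup_left (a := F.sub H.castSucc)
    (b := F.sub H.succ ⊓ G.sub k.castSucc)) hrow
  have e1 := sum_relPos F G H k.succ
  have e2 := sum_relPos F G H k.castSucc
  rw [filter_castSucc_lt_succ, Finset.sum_insert (by simp)] at e1
  have e4 : ∑ j with j < k, relPos F G H j = ∑ j with j < k, A H j := by
    refine Finset.sum_congr rfl fun j hj => ?_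
    rw [hB, if_neg (Finset.mem_filter.mp hj).2.ne', add_zero]
  have e5 := hB k
  rw [if_pos rfl] at e5
  change ∑ j with j < k, relPos F G H j + _ = _ at e2
  change _ + ∑ j with j < k, relPos F G H j + _ = _ at e1
  rw [show finrank K ↥(F.sub H.castSucc ⊔ F.sub H.succ ⊓ G.sub k.castSucc) -
      finrank K (F.sub H.castSucc) = ∑ j with j < k, A H j by omega,
    show finrank K ↥(F.sub H.castSucc ⊔ F.sub H.succ ⊓ G.sub k.succ) -
      finrank K ↥(F.sub H.castSucc ⊔ F.sub H.succ ⊓ G.sub k.castSucc) = A H k + 1 by omega] at hc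
  rw [← hc]
  -- The jump condition concerns `L ⊓ G_j`, while the count is of `L` inside a fixed subspace. The
  -- modular law and the cover property translate one into the other, with a negation, so the
  -- conditions at `k.castSucc` and `k.succ` exchange roles.
  have hmod : ∀ (L : Submodule K V), F.sub H.castSucc ⋖ L → L ≤ F.sub H.succ → ∀ j,
      (L ⊓ G.sub j ≤ F.sub H'.succ ↔
        ¬ L ≤ F.sub H.castSucc ⊔ F.sub H.succ ⊓ G.sub j) := by
    intro L hL1 hL2 j
    rw [hH]
    constructor
    · intro h1 h2
      have h3 : (F.sub H.castSucc ⊔ F.sub H.succ ⊓ G.sub j) ⊓ L ≤ F.sub H.castSucc := by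
        rw [sup_inf_assoc_of_le _ hL1.le]
        refine sup_le le_rfl (le_trans ?_ h1)
        exact le_inf inf_le_right (inf_le_left.trans inf_le_right)
      rw [inf_eq_right.mpr h2] at h3
      exact hL1.lt.not_ge h3
    · intro h1
      by_contra h2
      refine h1 ?_
      have h3 := (hL1.eq_or_eq le_sup_left (sup_le hL1.le inf_le_left)).resolve_left
        fun hc => h2 (sup_eq_left.mp hc)
      rw [← h3]
      exact sup_le_sup_left (inf_le_inf_right _ hL2) _
  have hfwd : ∀ F' : Flag K V N, relPos F F' = D ∧ relPos F' G = A → Covers F' F H'.succ ∧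
      F'.sub H'.succ ≤ F.sub H.castSucc ⊔ F.sub H.succ ⊓ G.sub k.succ ∧
      ¬ F'.sub H'.succ ≤ F.sub H.castSucc ⊔ F.sub H.succ ⊓ G.sub k.castSucc := by
    rintro F' ⟨hD, hA⟩
    have h := covers_transpose_of_relPos hH hE hD
    obtain ⟨k', h1, h2⟩ := h.exists_jump G
    have h3 := h.relPos_add_single hH G h1 h2
    rw [hA] at h3
    obtain rfl := eq_of_add_single_eq hne hk h3.symm
    have h4 : F'.sub H'.succ ≤ F.sub H.succ := by
      rw [← h.eq_of_ne H.succ (by rw [hH]; exact Fin.castSucc_lt_succ.ne'), hH]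
      exact F'.mono Fin.castSucc_lt_succ.le
    have h5 := h.covBy
    nth_rw 1 [hH] at h5
    have h6 := hmod _ h5 h4
    exact ⟨h, not_not.mp fun hc => h2 ((h6 _).mpr hc), (h6 _).mp h1⟩
  refine Nat.card_congr (Equiv.ofBijective (fun F' => ⟨F'.1.sub H'.succ,
    by rw [← hH]; exact (hfwd _ F'.2).1.covBy, (hfwd _ F'.2).2⟩) ⟨?_, ?_⟩)
  · rintro ⟨F₁, h1⟩ ⟨F₂, h2⟩ h
    refine Subtype.ext (Flag.ext fun I => ?_)
    rcases eq_or_ne I H'.succ with rfl | hI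
    · exact congrArg Subtype.val h
    · exact ((hfwd _ h1).1.eq_of_ne I hI).trans ((hfwd _ h2).1.eq_of_ne I hI).symm
  · rintro ⟨L, hL1, hL2, hL3⟩
    have hL4 : F.sub H'.castSucc ≤ L := by
      refine le_trans (F.mono ?_) hL1.le
      rw [← hH]
      exact Fin.castSucc_lt_succ.le
    have hL5 : L ≤ F.sub H.succ :=
      hL2.trans (sup_le (F.mono Fin.castSucc_lt_succ.le) inf_le_left)
    have hs := F.update_sub_self hH L hL4 hL5
    have hcov : Covers (F.update hH L hL4 hL5) F H'.succ :=
      ⟨fun I hI => F.update_sub_of_ne hH L hL4 hL5 hI, by rw [hs, hH]; exact hL1⟩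
    have h1 := hcov.relPos_add_single hH G (k := k) (by
      rw [hs]
      exact (hmod L hL1 hL5 _).mpr hL3) (by
      rw [hs]
      exact fun h => (hmod L hL1 hL5 _).mp h hL2)
    have hA : relPos (F.update hH L hL4 hL5) G = A := add_right_cancel (h1.trans hk)
    exact ⟨⟨_, relPos_eq_of_covers_transpose hH hE hA hcov, hA⟩, Subtype.ext hs⟩

theorem conv_orbitFun_apply (F G : Flag K V N) :
    conv (orbitFun K V D) (orbitFun K V A) F G =
      (Nat.card {F' : Flag K V N // relPos F F' = D ∧ relPos F' G = A} : ℤ) := by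
  classical
  have : Finite V := Module.finite_of_finite K
  have : Finite (Flag K V N) := Subtype.finite
  let _ := Fintype.ofFinite (Flag K V N)
  rw [conv, finsum_eq_sum_of_fintype, Nat.card_eq_fintype_card, Fintype.card_subtype,
    Finset.card_filter, Nat.cast_sum]
  refine Finset.sum_congr rfl fun F' _ => ?_
  simp only [orbitFun]
  by_cases h1 : relPos F F' = D <;> by_cases h2 : relPos F' G = A <;> simp [h1, h2]

/-- At a pair `(F, G)` the convolution counts intermediate flags. By `hex` there are none unless
`relPos F G` is a shift of `A`, and then the shift is unique and `hcard` gives the coefficient. -/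
theorem conv_orbitFun (hne : H ≠ H') (t : Fin N → ℤ)
    (hex : ∀ F F' G : Flag K V N, relPos F F' = D → relPos F' G = A →
      ∃ k, relPos F G + Matrix.single H' k 1 = A + Matrix.single H k 1)
    (hcard : ∀ (F G : Flag K V N) (k : Fin N),
      relPos F G + Matrix.single H' k 1 = A + Matrix.single H k 1 →
      (Nat.card {F' : Flag K V N // relPos F F' = D ∧ relPos F' G = A} : ℤ) = t k) :
    conv (orbitFun K V D) (orbitFun K V A) =
      ∑ k with 1 ≤ A H' k, t k • orbitFun K V (shift A H H' k) := by
  classical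
  funext F G
  have hR : (∑ k with 1 ≤ A H' k, t k • orbitFun K V (shift A H H' k)) F G =
      ∑ k, if relPos F G + Matrix.single H' k 1 = A + Matrix.single H k 1 then t k else 0 := by
    rw [Finset.sum_apply, Finset.sum_apply, Finset.sum_filter]
    refine Finset.sum_congr rfl fun k _ => ?_
    rw [Pi.smul_apply, Pi.smul_apply, orbitFun]
    simp only [eq_shift_iff hne]
    by_cases h1 : 1 ≤ A H' k <;> by_cases h2 : relPos F G = shift A H H' k <;> simp [h1, h2]
  rw [hR, conv_orbitFun_apply]
  by_cases h : ∃ k, relPos F G + Matrix.single H' k 1 = A + Matrix.single H k 1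
  · obtain ⟨k, hk⟩ := h
    rw [hcard F G k hk, Finset.sum_eq_single k, if_pos hk]
    · exact fun k' _ hk' => if_neg fun hc => hk' (eq_of_add_single_eq hne hk hc)
    · simp
  · rw [Finset.sum_eq_zero fun k _ => if_neg fun hc => h ⟨k, hc⟩, Nat.cast_eq_zero]
    have : IsEmpty {F' : Flag K V N // relPos F F' = D ∧ relPos F' G = A} :=
      ⟨fun F' => h (hex F F' G F'.2.1 F'.2.2)⟩
    exact Nat.card_of_isEmpty

theorem eval_gauss (k x : ℕ) : (gauss k (Polynomial.X : Polynomial ℤ)).eval (x : ℤ) =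
    ((gauss k x : ℕ) : ℤ) := by
  simp [gauss, Polynomial.eval_finsetSum]

theorem conv_orbitFun_plus {h h' : Fin N} (hh : (h' : ℕ) = h + 1) (hE : IsElementary A D h h') :
    conv (orbitFun K V D) (orbitFun K V A) =
      ∑ k with 1 ≤ A h' k, (blmCoeffPlus A h k).eval (Nat.card K : ℤ) •
        orbitFun K V (shift A h h' k) := by
  have hH : h.succ = h'.castSucc := Fin.ext hh.symm
  refine conv_orbitFun (by rintro rfl; omega) _ (fun F F' G => exists_of_relPos_plus hH hE)
    fun F G k hk => ?_
  rw [card_relPos_plus hH hE hk, blmCoeffPlus, Polynomial.eval_mul, Polynomial.eval_pow,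
    Polynomial.eval_X, eval_gauss, Nat.cast_mul, Nat.cast_pow]

theorem conv_orbitFun_minus {h h' : Fin N} (hh : (h' : ℕ) = h + 1) (hE : IsElementary A D h' h) :
    conv (orbitFun K V D) (orbitFun K V A) =
      ∑ k with 1 ≤ A h k, (blmCoeffMinus A h' k).eval (Nat.card K : ℤ) •
        orbitFun K V (shift A h' h k) := by
  have hH : h.succ = h'.castSucc := Fin.ext hh.symm
  refine conv_orbitFun (by rintro rfl; omega) _ (fun F F' G => exists_of_relPos_minus hH hE)
    fun F G k hk => ?_
  rw [card_relPos_minus hH hE hk, blmCoeffMinus, Polynomial.eval_mul, Polynomial.eval_pow,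
    Polynomial.eval_X, eval_gauss, Nat.cast_mul, Nat.cast_pow]

end Convolution

end QSchur

theorem mainTheorem5 (m r : ℕ) :
    (∀ A ∈ QSchur.superMatrices m 0 r, ∃! f : QSchur.SchurAlg QSchur.qZ m 0 r,
      QSchur.IsPhi QSchur.qZ A f) ∧
    ∀ A ∈ QSchur.superMatrices m 0 r, ∀ h h' : Fin (m + 0), (h' : ℕ) = h + 1 →
      -- the formulas for the product with the matrix whose off-diagonal part is `E_{h,h+1}`
      ((∀ k, 1 ≤ A h' k → QSchur.shift A h h' k ∈ QSchur.superMatrices m 0 r ∧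
          QSchur.superCoeffPlus m 0 A h h' k =
            Polynomial.aeval (QSchur.qZ : LaurentPolynomial ℤ) (QSchur.blmCoeffPlus A h k)) ∧
        ∀ D ∈ QSchur.superMatrices m 0 r, QSchur.IsElementary A D h h' →
          QSchur.phi QSchur.qZ m 0 r D * QSchur.phi QSchur.qZ m 0 r A =
            ∑ k with 1 ≤ A h' k, QSchur.superCoeffPlus m 0 A h h' k •
              QSchur.phi QSchur.qZ m 0 r (QSchur.shift A h h' k) ∧
          ∀ (K V : Type*) [Field K] [Finite K] [AddCommGroup V] [Module K V]
            [FiniteDimensional K V], Module.finrank K V = r →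
            QSchur.conv (QSchur.orbitFun K V D) (QSchur.orbitFun K V A) =
              ∑ k with 1 ≤ A h' k, (QSchur.blmCoeffPlus A h k).eval (Nat.card K : ℤ) •
                QSchur.orbitFun K V (QSchur.shift A h h' k)) ∧
      -- the formulas for the product with the matrix whose off-diagonal part is `E_{h+1,h}`
      ((∀ k, 1 ≤ A h k → QSchur.shift A h' h k ∈ QSchur.superMatrices m 0 r ∧
          QSchur.superCoeffMinus m 0 A h h' k =
            Polynomial.aeval (QSchur.qZ : LaurentPolynomial ℤ) (QSchur.blmCoeffMinus A h' k)) ∧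
        ∀ D ∈ QSchur.superMatrices m 0 r, QSchur.IsElementary A D h' h →
          QSchur.phi QSchur.qZ m 0 r D * QSchur.phi QSchur.qZ m 0 r A =
            ∑ k with 1 ≤ A h k, QSchur.superCoeffMinus m 0 A h h' k •
              QSchur.phi QSchur.qZ m 0 r (QSchur.shift A h' h k) ∧
          ∀ (K V : Type*) [Field K] [Finite K] [AddCommGroup V] [Module K V]
            [FiniteDimensional K V], Module.finrank K V = r →
            QSchur.conv (QSchur.orbitFun K V D) (QSchur.orbitFun K V A) =
              ∑ k with 1 ≤ A h k, (QSchur.blmCoeffMinus A h' k).eval (Nat.card K : ℤ) •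
                QSchur.orbitFun K V (QSchur.shift A h' h k)) := by
  refine ⟨fun A hA => QSchur.existsUnique_isPhi _ hA, fun A hA h h' hh => ⟨⟨?_, ?_⟩, ?_, ?_⟩⟩
  · exact fun k hk => ⟨QSchur.shift_mem_superMatrices hA (Or.inl hh) hk,
      QSchur.superCoeffPlus_eq_aeval A h h' k⟩
  · intro D hD hE
    refine ⟨?_, fun K V _ _ _ _ _ _ => QSchur.conv_orbitFun_plus hh hE⟩
    rw [QSchur.phi_mul_phi_plus _ hA hD hh hE]
    simp only [QSchur.superCoeffPlus_eq]
  · exact fun k hk => ⟨QSchur.shift_mem_superMatrices hA (Or.inr hh) hk,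
      QSchur.superCoeffMinus_eq_aeval A h h' k⟩
  · intro D hD hE
    refine ⟨?_, fun K V _ _ _ _ _ _ => QSchur.conv_orbitFun_minus hh hE⟩
    rw [QSchur.phi_mul_phi_minus _ hA hD hh hE]
    simp only [QSchur.superCoeffMinus_eq]
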